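/- Let $q$ be a prime power, $m\ge 3$, and let $\mathcal P$ be the point set of a non-degenerate classical polar space of one of the following types in $\mathrm{PG}(m,q)$: an elliptic or hyperbolic quadric ($m$ odd) with $q\neq 2$; a parabolic quadric ($m$ even) with $q\ge 4$; or a Hermitian variety ($q$ a square). A set $S$ of points of $\mathrm{PG}(m,q)$ is called a \emph{quasi-polar space} (a quasi-quadric or a quasi-Hermitian variety) of one of the types elliptic, hyperbolic, parabolic, Hermitian if every hyperplane meets $S$ in a number of points that occurs as the size of a hyperplane section of a non-degenerate polar space of that type in $\mathrm{PG}(m,q)$. A set $\mathcal P'$ is \emph{obtained from $\mathcal P$ by switching in the hyperplane $\pi$} if $\mathcal P'=(\mathcal P\setminus R)\cup R'$ for some sets $R,R'$ of points of $\pi$. The hyperplane $\pi$ is \emph{singular} (with respect to $\mathcal P$) if $|\pi\cap\mathcal P|$ equals the number of points of a cone in $\pi$ whose vertex is a point and whose base is a non-degenerate polar space of the same type as $\mathcal P$ in an $(m-2)$-dimensional subspace of $\pi$ not containing the vertex. Let $\pi$ be a hyperplane of $\mathrm{PG}(m,q)$, and let $\mathcal P'\neq\mathcal P$ be a quasi-polar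 space (of any of the four types) obtained from $\mathcal P$ by switching in $\pi$. Then $\pi$ is a singular hyperplane with respect to $\mathcal P$. Equivalently, switching in a non-singular hyperplane yields a quasi-polar space only if $\mathcal P'=\mathcal P$. -/

import Mathlib

open scoped LinearAlgebra.Projectivization

namespace QuasiPolar

/-- The four types of non-symplectic classical polar spaces. -/
inductive PolarType
  | elliptic
  | hyperbolic
  | parabolic
  | hermitian

section

variable {F V : Type*} [Field F] [AddCommGroup V] [Module F V]

/-- The set of points of `PG(V)` lying in the subspace given by `W`. -/
def pts (W : Submodule F V) : Set (ℙ F V) :=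
  {x | x.submodule ≤ W}

/-- `H` is (the vector space of) a hyperplane of `PG(V)`. -/
def IsHyperplane (H : Submodule F V) : Prop :=
  Module.finrank F H + 1 = Module.finrank F V

/-- The point set of the quadric `Q = 0`; the condition does not depend on the representative. -/
def quadricPoints (Q : QuadraticForm F V) : Set (ℙ F V) :=
  {x | Q x.rep = 0}

/-- `U` is totally singular for `Q`, i.e. its points all lie on the quadric `Q = 0`. -/
def IsTotallySingular (Q : QuadraticForm F V) (U : Submodule F V) : Prop :=
  ∀ u ∈ U, Q u = 0

/-- `S` is a Hermitian variety: the set of absolute points of a non-degenerate Hermitian form `h`,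
Hermitian with respect to an involutory field automorphism `σ` (over a finite field of order `q`
such a `σ` exists iff `q` is a square, and then it is `x ↦ x ^ √q`). -/
def IsHermitianVariety (S : Set (ℙ F V)) : Prop :=
  ∃ (σ : F →+* F) (h : V →ₛₗ[σ] V →ₗ[F] F),
    (∀ a, σ (σ a) = a) ∧ σ ≠ RingHom.id F ∧ h.IsSymm ∧ h.Nondegenerate ∧
      S = {x | h x.rep x.rep = 0}

variable (F V) in
/-- The non-degenerate quadratic form `Q` is of elliptic, hyperbolic or parabolic type.
In vector space dimension `2 * k` the maximal totally singular subspaces of a non-degenerate form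
over a finite field have dimension `k` (hyperbolic) or `k - 1` (elliptic); in odd dimension every
non-degenerate form is parabolic. -/
def HasQuadricType : PolarType → QuadraticForm F V → Prop
  | .elliptic, Q => ∃ k : ℕ, Module.finrank F V = 2 * k ∧
      ¬ ∃ U : Submodule F V, Module.finrank F U = k ∧ IsTotallySingular Q U
  | .hyperbolic, Q => ∃ k : ℕ, Module.finrank F V = 2 * k ∧
      ∃ U : Submodule F V, Module.finrank F U = k ∧ IsTotallySingular Q U
  | .parabolic, _ => Odd (Module.finrank F V)
  | .hermitian, _ => False

/-- `S` is the point set of a non-degenerate classical polar space of type `t` in `PG(V)`: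
a non-degenerate elliptic, hyperbolic or parabolic quadric, or a non-degenerate
Hermitian variety. -/
def IsPolarSpace (t : PolarType) (S : Set (ℙ F V)) : Prop :=
  match t with
  | .hermitian => IsHermitianVariety S
  | t => ∃ Q : QuadraticForm F V, Q.Nondegenerate ∧ HasQuadricType F V t Q ∧ S = quadricPoints Q

/-- `S` is a quasi-polar space of type `t`: every hyperplane meets `S` in a number of points that
is one of the intersection sizes with hyperplanes of a non-degenerate polar space of type `t`
in the same projective space. -/
def IsQuasiPolarSpace (t : PolarType) (S : Set (ℙ F V)) : Prop :=
  ∃ P₀ : Set (ℙ F V), IsPolarSpace t P₀ ∧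
    ∀ H : Submodule F V, IsHyperplane H →
      ∃ H₀ : Submodule F V, IsHyperplane H₀ ∧ (S ∩ pts H).ncard = (P₀ ∩ pts H₀).ncard

/-- `S'` is obtained from `S` by switching in the hyperplane `π`: a set `R` of points of `π` is
replaced by a set `R'` of points of `π`. -/
def IsSwitching (S S' : Set (ℙ F V)) (π : Submodule F V) : Prop :=
  ∃ R R' : Set (ℙ F V), R ⊆ pts π ∧ R' ⊆ pts π ∧ S' = (S \ R) ∪ R'

/-- The cone with vertex the point `p` and base a set `B` of points of the subspace `W`: the union
of `p` and of all the lines joining `p` to a point of `B`. -/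
def cone (p : ℙ F V) (W : Submodule F V) (B : Set (ℙ F W)) : Set (ℙ F V) :=
  {x | x = p ∨ ∃ b ∈ B, x.submodule ≤
    p.submodule ⊔ (Projectivization.map W.subtype W.injective_subtype b).submodule}

/-- `K` is a cone spanning `π`, with vertex a point `p` of `π` and base a
non-degenerate polar space of type `t` in a hyperplane `W` of `π` not through `p`. -/
def IsPolarCone (t : PolarType) (π : Submodule F V) (K : Set (ℙ F V)) : Prop :=
  ∃ (p : ℙ F V) (W : Submodule F V) (B : Set (ℙ F W)),
    p ∈ pts π ∧ W ≤ π ∧ Module.finrank F W + 1 = Module.finrank F π ∧ p ∉ pts W ∧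
      IsPolarSpace t B ∧ K = cone p W B

/-- The hyperplane `π` is singular with respect to the (quasi-)polar space `S` of type `t`: it meets
`S` in the number of points of a cone with vertex a point and base a non-degenerate polar
space of type `t`. -/
def IsSingularHyperplane (t : PolarType) (S : Set (ℙ F V)) (π : Submodule F V) : Prop :=
  ∃ K : Set (ℙ F V), IsPolarCone t π K ∧ (S ∩ pts π).ncard = K.ncard

end

end QuasiPolar

/-! Sizes are counted in nonzero vectors, so every number of points is multiplied by q - 1.
Hyperplanes are indexed by functionals φ, and `kerSum` sums a function over ker φ; at φ = 0 it gives
the total. Let f be the indicator of P' minus that of P, and let π = ker ψ. Since f vanishes off π,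
its hyperplane sum `change` is constant on each pencil {φ + tψ : t ∈ F} (`change_add_smul`).
Hyperplane sums determine a point function (`eq_zero_of_kerSum_eq_zero`, from the second moment).

Call φ tangent if it is the orthogonality functional of a singular vector. If ψ is tangent and
nonzero, π ∩ P is a cone over a residue of the same type (`PolarForm.inter_pts_ker_eq_cone`,
`hasQuadricType_residue`), so π is singular. It remains to prove P' = P when ψ is not tangent. The
section sizes of P come from `PolarForm.exists_anisotropic_core`. Those allowed for P' are collected
in `HasPolarNumbers`, whatever the type of P'.

Elliptic and hyperbolic P: a pencil has at most two tangent members (`isTangent_of_three`), hence a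
non-tangent one because q ≥ 3. Comparing sizes, `change` takes a value κ on every pencil with a
tangent member and κ or κ + E on the others. Bounding the number of exceptional functionals forces κ
= 0. Then either all changes vanish, or P' is a two-intersection set whose size violates the
quadratic counting identity (`even_quadric_arith`).

Hermitian P: surjectivity of the norm puts both tangent and non-tangent members in every pencil
(`hermitian_pencil`). P' must reproduce their difference in size, which is possible in only one way,
so `change` is constant outside the span of ψ. Then f is constant on π. If it were nonzero, π would
lie in P or miss it, and the size of π ∩ P excludes both.

Parabolic P: the section in π is an elliptic or hyperbolic quadric, whose own section by ker φ fixes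
the sum of the signs (tangent 0, otherwise ±1) of the pencil (`exists_signs`). For q ≥ 4 enough
different signs occur to limit `change` to two values, and the first two moments of P' ∩ π finish
the argument. Hermitian numbers for P' have the wrong spacing. -/

namespace QuasiPolar

set_option linter.unusedSectionVars false

/-! ### Moments of hyperplane sums. -/

section Moments

variable {F V : Type*} [Field F] [AddCommGroup V] [Module F V] [Fintype V]

open Classical in
/-- The sum of `f` over the kernel of the functional `φ`. -/
noncomputable def kerSum (f : V → ℤ) (φ : Module.Dual F V) : ℤ :=
  ∑ v, if φ v = 0 then f v else 0

variable (F) in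
/-- `f` is induced by a function on the points of `PG(V)`, extended by `0` at the zero vector. -/
structure IsPointFunction (f : V → ℤ) : Prop where
  map_zero : f 0 = 0
  map_smul : ∀ (a : F) (v : V), a ≠ 0 → f (a • v) = f v

theorem IsPointFunction.sub {f g : V → ℤ} (hf : IsPointFunction F f) (hg : IsPointFunction F g) :
    IsPointFunction F (f - g) :=
  ⟨by simp [hf.map_zero, hg.map_zero], fun a v ha => by simp [hf.map_smul a v ha, hg.map_smul a v ha]⟩

theorem kerSum_sub (f g : V → ℤ) (φ : Module.Dual F V) :
    kerSum (f - g) φ = kerSum f φ - kerSum g φ := by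
  classical
  simp only [kerSum, ← Finset.sum_sub_distrib]
  exact Finset.sum_congr rfl fun v _ => by split_ifs <;> simp

@[simp]
theorem kerSum_zero_right (f : V → ℤ) : kerSum f (0 : Module.Dual F V) = ∑ v, f v := by
  simp [kerSum]

theorem kerSum_congr {f : V → ℤ} {φ ψ : Module.Dual F V}
    (h : ∀ v, (φ v = 0 ↔ ψ v = 0) ∨ f v = 0) : kerSum f φ = kerSum f ψ := by
  classical
  unfold kerSum
  refine Finset.sum_congr rfl fun v _ => ?_
  rcases h v with h | h
  · by_cases h' : ψ v = 0
    · rw [if_pos h', if_pos (h.2 h')]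
    · rw [if_neg h', if_neg (mt h.1 h')]
  · simp [h]

/-- Functionals differing by a multiple of `ψ` have the same sums of a function that vanishes off
the kernel of `ψ`. -/
theorem kerSum_add_smul {f : V → ℤ} {ψ : Module.Dual F V} (hf : ∀ v, ψ v ≠ 0 → f v = 0)
    (φ : Module.Dual F V) (t : F) : kerSum f (φ + t • ψ) = kerSum f φ :=
  kerSum_congr fun v => by
    by_cases h : ψ v = 0
    · simp [h]
    · simp [hf v h]

theorem card_pow_mul_card_dualAnnihilator (W : Submodule F V) :
    Nat.card F ^ Module.finrank F W * Nat.card W.dualAnnihilator = Nat.card V := by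
  rw [Module.natCard_eq_pow_finrank (K := F) (V := W.dualAnnihilator),
    Module.natCard_eq_pow_finrank (K := F) (V := V), ← pow_add,
    Subspace.finrank_add_finrank_dualAnnihilator_eq]

variable [Fintype F] [Fintype (Module.Dual F V)]

open Classical in
-- The functionals counted form the annihilator of W, of dimension dim V - dim W. Multiplying by |F|
-- ^ dim W avoids division.
theorem card_pow_mul_sum_vanish (W : Submodule F V) :
    (Fintype.card F : ℤ) ^ Module.finrank F W *
      ∑ φ : Module.Dual F V, (if ∀ w ∈ W, φ w = 0 then 1 else 0) = Fintype.card V := by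
  have h := card_pow_mul_card_dualAnnihilator W
  have h2 : Nat.card W.dualAnnihilator
      = (Finset.univ.filter fun φ : Module.Dual F V => ∀ w ∈ W, φ w = 0).card :=
    Nat.subtype_card _ fun φ => by simp [Submodule.mem_dualAnnihilator]
  rw [h2, Nat.card_eq_fintype_card, Nat.card_eq_fintype_card] at h
  rw [← h, Finset.sum_boole]
  push_cast
  rfl

open Classical in
theorem card_mul_sum_vanish {v : V} (hv : v ≠ 0) :
    (Fintype.card F : ℤ) * ∑ φ : Module.Dual F V, (if φ v = 0 then 1 else 0) = Fintype.card V := by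
  have h := card_pow_mul_sum_vanish (F ∙ v)
  rw [finrank_span_singleton hv, pow_one] at h
  rw [← h]
  congr 1
  refine Finset.sum_congr rfl fun φ _ => ?_
  congr 1
  simp only [Submodule.mem_span_singleton, forall_exists_index, eq_iff_iff]
  constructor
  · rintro h w a rfl
    simp [h]
  · exact fun h => h v 1 (one_smul F v)

open Classical in
-- Two independent vectors impose two conditions on φ, proportional ones only one, which makes the
-- count q times as large. This excess at equal points produces the sum of squares in the second
-- moment.
theorem card_sq_mul_sum_vanish {u : V} (hu : u ≠ 0) (v : V) :
    (Fintype.card F : ℤ) ^ 2 *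
      ∑ φ : Module.Dual F V, (if φ u = 0 then if φ v = 0 then 1 else 0 else 0) =
        Fintype.card V * (1 + if v ∈ F ∙ u then (Fintype.card F - 1 : ℤ) else 0) := by
  by_cases hv : v ∈ F ∙ u
  · obtain ⟨a, rfl⟩ := Submodule.mem_span_singleton.1 hv
    have : ∀ φ : Module.Dual F V, (if φ u = 0 then if φ (a • u) = 0 then (1 : ℤ) else 0 else 0) =
        if φ u = 0 then 1 else 0 := fun φ => by
      split_ifs with h1 h2
      · rfl
      · simp [h1] at h2
      · rfl
    simp only [this, if_pos hv, sq, mul_assoc, card_mul_sum_vanish hu]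
    ring
  · have hli : LinearIndependent F ![u, v] := by
      rw [LinearIndependent.pair_iff' hu]
      exact fun a ha => hv (Submodule.mem_span_singleton.2 ⟨a, ha⟩)
    have h := card_pow_mul_sum_vanish (Submodule.span F (Set.range ![u, v]))
    rw [finrank_span_eq_card hli, Fintype.card_fin] at h
    rw [if_neg hv, add_zero, mul_one, ← h]
    congr 1
    refine Finset.sum_congr rfl fun φ _ => ?_
    have : (∀ w ∈ Submodule.span F (Set.range ![u, v]), φ w = 0) ↔ φ u = 0 ∧ φ v = 0 := by
      constructor
      · exact fun h => ⟨h u (Submodule.subset_span ⟨0, rfl⟩), h v (Submodule.subset_span ⟨1, rfl⟩)⟩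
      · rintro ⟨h1, h2⟩ w hw
        have : Submodule.span F (Set.range ![u, v]) ≤ LinearMap.ker φ := by
          rw [Submodule.span_le]
          rintro _ ⟨i, rfl⟩
          fin_cases i
          · exact h1
          · exact h2
        exact this hw
    simp only [this]
    split_ifs <;> tauto

open Classical in
theorem sum_span_singleton {f : V → ℤ} (hf : IsPointFunction F f) {u : V} (hu : u ≠ 0) :
    ∑ v, (if v ∈ F ∙ u then f v else 0) = (Fintype.card F - 1) * f u := by
  have h1 : ∑ v, (if v ∈ F ∙ u then f v else 0) = ∑ a : F, f (a • u) := by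
    rw [← Finset.sum_filter]
    symm
    refine Finset.sum_bij (fun a _ => a • u) ?_ ?_ ?_ (fun _ _ => rfl)
    · exact fun a _ => by simpa using Submodule.mem_span_singleton.2 ⟨a, rfl⟩
    · exact fun a _ b _ h => smul_left_injective F hu h
    · intro v hv
      obtain ⟨a, ha⟩ := Submodule.mem_span_singleton.1 (by simpa using hv)
      exact ⟨a, Finset.mem_univ _, ha⟩
  rw [h1, ← Finset.sum_erase_add _ _ (Finset.mem_univ (0 : F)), zero_smul, hf.map_zero, add_zero,
    Finset.sum_congr rfl fun a ha => hf.map_smul a u (Finset.ne_of_mem_erase ha), Finset.sum_const,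
    Finset.card_erase_of_mem (Finset.mem_univ _), Finset.card_univ, nsmul_eq_mul,
    Nat.cast_sub Fintype.card_pos]
  simp

/-- The first moment of the hyperplane sums of `f`. -/
theorem card_mul_sum_kerSum {f : V → ℤ} (hf : IsPointFunction F f) :
    (Fintype.card F : ℤ) * ∑ φ : Module.Dual F V, kerSum f φ = Fintype.card V * ∑ v, f v := by
  classical
  simp only [kerSum]
  rw [Finset.sum_comm, Finset.mul_sum, Finset.mul_sum]
  refine Finset.sum_congr rfl fun v _ => ?_
  by_cases hv : v = 0
  · simp [hv, hf.map_zero]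
  · rw [← card_mul_sum_vanish (F := F) hv, mul_assoc, Finset.sum_mul]
    simp

open Classical in
/-- The sum of the hyperplane sums of `f` over the hyperplanes through a point. -/
theorem card_sq_mul_sum_kerSum_vanish {f : V → ℤ} (hf : IsPointFunction F f) {u : V} (hu : u ≠ 0) :
    (Fintype.card F : ℤ) ^ 2 * ∑ φ : Module.Dual F V, (if φ u = 0 then kerSum f φ else 0) =
      Fintype.card V * (∑ v, f v + (Fintype.card F - 1) ^ 2 * f u) := by
  have h1 : ∑ φ : Module.Dual F V, (if φ u = 0 then kerSum f φ else 0) =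
      ∑ v, f v * ∑ φ : Module.Dual F V, (if φ u = 0 then if φ v = 0 then 1 else 0 else 0) := by
    simp only [Finset.mul_sum, kerSum]
    rw [Finset.sum_comm]
    refine Finset.sum_congr rfl fun φ _ => ?_
    split_ifs <;> simp
  have h2 : ∀ v, (Fintype.card F : ℤ) ^ 2 * (f v *
      ∑ φ : Module.Dual F V, (if φ u = 0 then if φ v = 0 then 1 else 0 else 0)) =
      Fintype.card V * (f v + (Fintype.card F - 1) * if v ∈ F ∙ u then f v else 0) := fun v => by
    rw [mul_left_comm, card_sq_mul_sum_vanish hu]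
    split_ifs <;> ring
  rw [h1, Finset.mul_sum, Finset.sum_congr rfl fun v _ => h2 v, ← Finset.mul_sum,
    Finset.sum_add_distrib, ← Finset.mul_sum, sum_span_singleton hf hu]
  ring

/-- The second moment of the hyperplane sums of `f`. -/
theorem card_sq_mul_sum_kerSum_sq {f : V → ℤ} (hf : IsPointFunction F f) :
    (Fintype.card F : ℤ) ^ 2 * ∑ φ : Module.Dual F V, kerSum f φ ^ 2 =
      Fintype.card V * ((∑ v, f v) ^ 2 + (Fintype.card F - 1) ^ 2 * ∑ v, f v ^ 2) := by
  classical
  have h1 : ∑ φ : Module.Dual F V, kerSum f φ ^ 2 =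
      ∑ u, f u * ∑ φ : Module.Dual F V, (if φ u = 0 then kerSum f φ else 0) := by
    simp only [Finset.mul_sum]
    rw [Finset.sum_comm]
    refine Finset.sum_congr rfl fun φ _ => ?_
    conv_lhs => rw [sq, kerSum, Finset.sum_mul, ← kerSum]
    refine Finset.sum_congr rfl fun v _ => ?_
    split_ifs <;> simp
  have h2 : ∀ u, (Fintype.card F : ℤ) ^ 2 * (f u *
      ∑ φ : Module.Dual F V, (if φ u = 0 then kerSum f φ else 0)) =
      f u * (Fintype.card V * ∑ v, f v) +
        (Fintype.card V * (Fintype.card F - 1) ^ 2) * f u ^ 2 := fun u => by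
    by_cases hu : u = 0
    · simp [hu, hf.map_zero]
    · rw [mul_left_comm, card_sq_mul_sum_kerSum_vanish hf hu]
      ring
  rw [h1, Finset.mul_sum, Finset.sum_congr rfl fun u _ => h2 u, Finset.sum_add_distrib,
    ← Finset.sum_mul, ← Finset.mul_sum]
  ring

/-- A function all of whose hyperplane sums vanish is zero. -/
theorem eq_zero_of_kerSum_eq_zero {f : V → ℤ} (hf : IsPointFunction F f)
    (h : ∀ φ : Module.Dual F V, kerSum f φ = 0) : f = 0 := by
  have h1 := card_sq_mul_sum_kerSum_sq hf
  have h0 : ∑ v, f v = 0 := by simpa using h 0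
  simp only [h, h0] at h1
  have hV : (Fintype.card V : ℤ) ≠ 0 := by exact_mod_cast Fintype.card_ne_zero
  have hF : (Fintype.card F - 1 : ℤ) ≠ 0 := by
    have : 1 < Fintype.card F := Fintype.one_lt_card
    omega
  have h2 : ∑ v, f v ^ 2 = 0 := by
    have : (Fintype.card V : ℤ) * ((Fintype.card F - 1) ^ 2 * ∑ v, f v ^ 2) = 0 := by
      simpa using h1.symm
    rcases mul_eq_zero.1 this with h | h
    · exact absurd h hV
    · exact (mul_eq_zero.1 h).resolve_left (pow_ne_zero 2 hF)
  funext v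
  exact pow_eq_zero_iff (two_ne_zero) |>.1
    ((Finset.sum_eq_zero_iff_of_nonneg fun v _ => sq_nonneg (f v)).1 h2 v (Finset.mem_univ v))

end Moments

/-! ### Point sets, their vectors, and hyperplanes as kernels. -/

section Points

variable {F V : Type*} [Field F] [AddCommGroup V] [Module F V]

/-- The nonzero vectors spanning a point of `S`. -/
def vectors (S : Set (ℙ F V)) : Set V :=
  {v | ∃ h : v ≠ 0, Projectivization.mk F v h ∈ S}

theorem zero_notMem_vectors (S : Set (ℙ F V)) : (0 : V) ∉ vectors S :=
  fun h => h.1 rfl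

theorem smul_mem_vectors_iff {S : Set (ℙ F V)} {a : F} (ha : a ≠ 0) {v : V} :
    a • v ∈ vectors S ↔ v ∈ vectors S := by
  by_cases hv : v = 0
  · simp [hv]
  · have h : Projectivization.mk F (a • v) (smul_ne_zero ha hv) = Projectivization.mk F v hv :=
      (Projectivization.mk_eq_mk_iff' F _ _ _ _).2 ⟨a, rfl⟩
    simp [vectors, hv, ha, h]

theorem rep_mem_vectors_iff {S : Set (ℙ F V)} (x : ℙ F V) : x.rep ∈ vectors S ↔ x ∈ S := by
  simp [vectors, x.rep_nonzero, Projectivization.mk_rep]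

theorem mem_pts_mk_iff {W : Submodule F V} {v : V} (hv : v ≠ 0) :
    Projectivization.mk F v hv ∈ pts W ↔ v ∈ W := by
  simp [pts, Projectivization.submodule_mk]

theorem vectors_inj {S T : Set (ℙ F V)} (h : vectors S = vectors T) : S = T := by
  ext x
  rw [← rep_mem_vectors_iff, h, rep_mem_vectors_iff]

/-- A point consists of the unit multiples of its representative. All later sizes carry this factor
|F| - 1. -/
theorem ncard_vectors [Finite F] [Finite V] (S : Set (ℙ F V)) :
    ((vectors S).ncard : ℤ) = (Nat.card F - 1) * S.ncard := by
  have hinj : Function.Injective fun x : ℙ F V × Fˣ => x.2 • x.1.rep := by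
    rintro ⟨x, a⟩ ⟨y, b⟩ h
    simp only [Units.smul_def] at h
    have hxy : x = y := by
      rw [← x.mk_rep, ← y.mk_rep, Projectivization.mk_eq_mk_iff']
      exact ⟨a⁻¹ * b, by rw [mul_smul, ← h, smul_smul, Units.inv_mul, one_smul]⟩
    subst hxy
    exact Prod.ext rfl (Units.ext (smul_left_injective F x.rep_nonzero h))
  have himg : (fun x : ℙ F V × Fˣ => x.2 • x.1.rep) '' (S ×ˢ Set.univ) = vectors S := by
    ext v
    constructor
    · rintro ⟨⟨x, a⟩, ⟨hx, -⟩, rfl⟩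
      exact (smul_mem_vectors_iff a.ne_zero).2 ((rep_mem_vectors_iff x).2 hx)
    · rintro ⟨hv, h⟩
      obtain ⟨a, ha⟩ := Projectivization.exists_smul_eq_mk_rep F v hv
      exact ⟨⟨_, a⁻¹⟩, ⟨h, trivial⟩, inv_smul_eq_iff.2 ha.symm⟩
  rw [← himg, Set.ncard_image_of_injective _ hinj, Set.ncard_prod, Set.ncard_univ,
    Nat.card_units, Nat.cast_mul, Nat.cast_sub Nat.card_pos]
  push_cast
  ring

open Classical in
/-- The indicator function of the vectors spanning a point of `S`. -/
noncomputable def pointIndicator (S : Set (ℙ F V)) (v : V) : ℤ :=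
  if v ∈ vectors S then 1 else 0

theorem pointIndicator_congr {S T : Set (ℙ F V)} {v w : V} (h : v ∈ vectors S ↔ w ∈ vectors T) :
    pointIndicator S v = pointIndicator T w := by
  classical
  unfold pointIndicator
  exact if_congr h rfl rfl

theorem isPointFunction_pointIndicator (S : Set (ℙ F V)) : IsPointFunction F (pointIndicator S) :=
  ⟨if_neg (zero_notMem_vectors S), fun _ _ ha =>
    pointIndicator_congr (smul_mem_vectors_iff ha)⟩

theorem pointIndicator_sq (S : Set (ℙ F V)) (v : V) :
    pointIndicator S v ^ 2 = pointIndicator S v := by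
  unfold pointIndicator
  split_ifs <;> simp

theorem sum_pointIndicator [Fintype V] (S : Set (ℙ F V)) :
    ∑ v, pointIndicator S v = (vectors S).ncard := by
  classical
  simp only [pointIndicator, Finset.sum_boole]
  rw [← Set.ncard_coe_finset]
  simp

theorem kerSum_pointIndicator_eq_ncard [Fintype V] (S : Set (ℙ F V)) (φ : Module.Dual F V) :
    kerSum (pointIndicator S) φ = ({v | φ v = 0 ∧ v ∈ vectors S}.ncard : ℤ) := by
  classical
  simp only [pointIndicator, kerSum]
  rw [Finset.sum_congr rfl fun v _ => (ite_and (φ v = 0) (v ∈ vectors S) (1 : ℤ) 0).symm,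
    Finset.sum_boole, ← Set.ncard_coe_finset]
  simp

theorem kerSum_pointIndicator [Finite F] [Fintype V] (S : Set (ℙ F V)) (φ : Module.Dual F V) :
    kerSum (pointIndicator S) φ = (Nat.card F - 1) * (S ∩ pts (LinearMap.ker φ)).ncard := by
  rw [kerSum_pointIndicator_eq_ncard, ← ncard_vectors]
  congr 2
  ext v
  constructor
  · rintro ⟨h, hv, hS⟩
    exact ⟨hv, hS, (mem_pts_mk_iff hv).2 h⟩
  · rintro ⟨hv, hS, h⟩
    exact ⟨(mem_pts_mk_iff hv).1 h, hv, hS⟩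

theorem isHyperplane_iff_exists_ker [FiniteDimensional F V] {H : Submodule F V} :
    IsHyperplane H ↔ ∃ φ : Module.Dual F V, φ ≠ 0 ∧ LinearMap.ker φ = H := by
  constructor
  · intro h
    have hlt : H < ⊤ := lt_top_iff_ne_top.2 fun h' => by
      subst h'
      simp [IsHyperplane] at h
    obtain ⟨φ, hφ, hH⟩ := Submodule.exists_le_ker_of_lt_top H hlt
    refine ⟨φ, hφ, (Submodule.eq_of_le_of_finrank_eq hH ?_).symm⟩
    have := Module.Dual.finrank_ker_add_one_of_ne_zero hφ
    unfold IsHyperplane at h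
    omega
  · rintro ⟨φ, hφ, rfl⟩
    exact Module.Dual.finrank_ker_add_one_of_ne_zero hφ

/-- Every hyperplane sum of a quasi-polar space is a hyperplane sum of a polar space. -/
theorem IsQuasiPolarSpace.exists_kerSum [Finite F] [Fintype V] {t : PolarType} {S : Set (ℙ F V)}
    (hS : IsQuasiPolarSpace t S) :
    ∃ P₀ : Set (ℙ F V), IsPolarSpace t P₀ ∧ ∀ φ : Module.Dual F V, φ ≠ 0 →
      ∃ ψ : Module.Dual F V, ψ ≠ 0 ∧
        kerSum (pointIndicator S) φ = kerSum (pointIndicator P₀) ψ := by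
  obtain ⟨P₀, hP₀, h⟩ := hS
  refine ⟨P₀, hP₀, fun φ hφ => ?_⟩
  obtain ⟨H₀, hH₀, hc⟩ := h _ (isHyperplane_iff_exists_ker.2 ⟨φ, hφ, rfl⟩)
  obtain ⟨ψ, hψ, rfl⟩ := isHyperplane_iff_exists_ker.1 hH₀
  exact ⟨ψ, hψ, by rw [kerSum_pointIndicator, kerSum_pointIndicator, hc]⟩

/-- Switching in a hyperplane does not change a set of points outside that hyperplane. -/
theorem IsSwitching.pointIndicator_eq {P P' : Set (ℙ F V)} {φ : Module.Dual F V}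
    (h : IsSwitching P P' (LinearMap.ker φ)) {v : V} (hv : φ v ≠ 0) :
    pointIndicator P' v = pointIndicator P v := by
  obtain ⟨R, R', hR, hR', rfl⟩ := h
  have hv0 : v ≠ 0 := fun h => hv (by simp [h])
  have hnot : ∀ T : Set (ℙ F V), T ⊆ pts (LinearMap.ker φ) → Projectivization.mk F v hv0 ∉ T :=
    fun T hT h => hv ((mem_pts_mk_iff hv0).1 (hT h))
  exact pointIndicator_congr (by simp [vectors, hv0, hnot R hR, hnot R' hR'])

end Points

-- A common framework for quadratic and Hermitian forms.

universe u v

/-- What quadratic forms and Hermitian forms have in common: a notion of singular vector, and an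
additive map to the dual space sending a vector to its (reflexive) orthogonality functional.
An affine line whose direction `p` is singular and not orthogonal to it carries exactly `lineCount`
singular vectors. -/
structure PolarForm (F : Type u) (V : Type v) [Field F] [AddCommGroup V] [Module F V] where
  IsSingular : V → Prop
  dual : V →+ Module.Dual F V
  lineCount : ℕ
  singular_zero : IsSingular 0
  singular_smul : ∀ (a : F) {v : V}, IsSingular v → IsSingular (a • v)
  dual_comm : ∀ {v w : V}, dual v w = 0 → dual w v = 0
  dual_self : ∀ {v : V}, IsSingular v → dual v v = 0
  exists_dual_smul : ∀ {a : F} (v : V), a ≠ 0 → ∃ b : F, b ≠ 0 ∧ dual (b • v) = a • dual v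
  singular_add_iff : ∀ {p v : V}, IsSingular p → dual p v = 0 → (IsSingular (v + p) ↔ IsSingular v)
  card_line : ∀ {p v : V}, IsSingular p → dual p v ≠ 0 →
    Nat.card {t : F // IsSingular (v + t • p)} = lineCount

theorem exists_eq_smul_of_ker_le {F V : Type*} [Field F] [AddCommGroup V] [Module F V]
    {φ ψ : Module.Dual F V} (h : ∀ v, ψ v = 0 → φ v = 0) : ∃ c : F, φ = c • ψ := by
  by_cases hψ : ψ = 0
  · exact ⟨0, LinearMap.ext fun v => by simpa using h v (by simp [hψ])⟩
  · obtain ⟨w, hw⟩ : ∃ w, ψ w ≠ 0 := by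
      by_contra! h'
      exact hψ (LinearMap.ext h')
    refine ⟨φ w / ψ w, LinearMap.ext fun v => ?_⟩
    have := h (v - (ψ v / ψ w) • w) (by simp [hw])
    simp only [map_sub, map_smul, smul_eq_mul, sub_eq_zero] at this
    simp only [LinearMap.smul_apply, smul_eq_mul, this]
    ring

theorem finrank_eq_finrank_add_one {F V : Type*} [Field F] [AddCommGroup V] [Module F V]
    [FiniteDimensional F V] {W K : Submodule F V} {p : V} (hp : p ∉ W) (hW : W ⊔ F ∙ p = K) :
    Module.finrank F K = Module.finrank F W + 1 := by
  have hp0 : p ≠ 0 := fun h => hp (h ▸ W.zero_mem)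
  have h := Submodule.finrank_sup_add_finrank_inf_eq W (F ∙ p)
  have hd : W ⊓ F ∙ p = ⊥ := by
    rw [eq_bot_iff]
    rintro x ⟨hxW, hx⟩
    obtain ⟨a, rfl⟩ := Submodule.mem_span_singleton.1 hx
    by_cases ha : a = 0
    · simp [ha]
    · exact absurd ((W.smul_mem_iff ha).1 hxW) hp
  rw [hW, hd, finrank_bot, finrank_span_singleton hp0] at h
  omega

theorem exists_complement_of_mem {F V : Type*} [Field F] [AddCommGroup V] [Module F V]
    {K : Submodule F V} {p : V} (hp : p ∈ K) (hp0 : p ≠ 0) :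
    ∃ W : Submodule F V, W ≤ K ∧ p ∉ W ∧ W ⊔ F ∙ p = K := by
  obtain ⟨W', hW'⟩ := (F ∙ p).exists_isCompl
  have hpK : F ∙ p ≤ K := (Submodule.span_singleton_le_iff_mem p K).2 hp
  refine ⟨W' ⊓ K, inf_le_right, fun h => hp0 ?_, ?_⟩
  · exact (Submodule.disjoint_def.1 hW'.disjoint) p (Submodule.mem_span_singleton_self p) h.1
  · rw [sup_comm, ← sup_inf_assoc_of_le W' hpK, hW'.sup_eq_top, top_inf_eq]

namespace PolarForm

section

variable {F : Type u} {V : Type v} [Field F] [AddCommGroup V] [Module F V]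

/-- The restriction of a form to a subspace. -/
def restrict (β : PolarForm F V) (W : Submodule F V) : PolarForm F W where
  IsSingular w := β.IsSingular w
  dual := {
    toFun := fun w => (β.dual w).comp W.subtype
    map_zero' := by ext; simp
    map_add' := fun x y => by ext; simp }
  lineCount := β.lineCount
  singular_zero := β.singular_zero
  singular_smul a _ h := β.singular_smul a h
  dual_comm h := β.dual_comm h
  dual_self h := β.dual_self h
  exists_dual_smul w ha := by
    obtain ⟨b, hb, h⟩ := β.exists_dual_smul (w : V) ha
    exact ⟨b, hb, LinearMap.ext fun x => by
      simpa using congrArg (fun φ : Module.Dual F V => φ x) h⟩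
  singular_add_iff hp h := β.singular_add_iff hp h
  card_line hp h := β.card_line hp h

variable (β : PolarForm F V)

@[simp]
theorem restrict_isSingular {W : Submodule F V} (w : W) :
    (β.restrict W).IsSingular w ↔ β.IsSingular (w : V) := Iff.rfl

@[simp]
theorem restrict_lineCount (W : Submodule F V) : (β.restrict W).lineCount = β.lineCount := rfl

/-- A form is nondegenerate if no nonzero singular vector is orthogonal to the whole space. -/
def IsNondegenerate : Prop :=
  ∀ v, β.IsSingular v → β.dual v = 0 → v = 0

/-- `φ` is the orthogonality functional of a singular vector. -/
def IsTangent (φ : Module.Dual F V) : Prop :=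
  ∃ p, β.IsSingular p ∧ β.dual p = φ

theorem singular_add_smul_iff {p v : V} (hp : β.IsSingular p) (h : β.dual p v = 0) (t : F) :
    β.IsSingular (v + t • p) ↔ β.IsSingular v :=
  β.singular_add_iff (β.singular_smul t hp) (β.dual_comm (by simp [β.dual_comm h]))

/-- If a singular x in ker φ is orthogonal to ker φ, then `β.dual x` is a multiple of φ. A nonzero
multiple could be rescaled to exhibit φ as tangent, and a zero one puts x in the radical. -/
theorem restrict_ker_isNondegenerate (hβ : β.IsNondegenerate) {φ : Module.Dual F V}
    (hφ : ¬ β.IsTangent φ) : (β.restrict (LinearMap.ker φ)).IsNondegenerate := by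
  rintro ⟨x, hx⟩ hs hd
  obtain ⟨c, hc⟩ := exists_eq_smul_of_ker_le (φ := β.dual x) (ψ := φ) fun v hv =>
    congrArg (fun f : Module.Dual F (LinearMap.ker φ) => f ⟨v, hv⟩) hd
  by_cases h0 : c = 0
  · exact Subtype.ext (hβ x hs (by rw [hc, h0, zero_smul]))
  · obtain ⟨b, -, hb⟩ := β.exists_dual_smul x (inv_ne_zero h0)
    exact absurd ⟨b • x, β.singular_smul b hs, by rw [hb, hc, smul_smul, inv_mul_cancel₀ h0,
      one_smul]⟩ hφ

/-- A singular x in W orthogonal to W is also orthogonal to p, so `β.dual x` is a multiple of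
`β.dual p`. Subtracting a multiple of p from x gives a singular vector of the radical, so x is a
multiple of p; as p is not in W, x = 0. -/
theorem restrict_complement_isNondegenerate (hβ : β.IsNondegenerate) {p : V}
    (hp : β.IsSingular p) {W : Submodule F V} (hpW : p ∉ W)
    (hW : W ⊔ F ∙ p = LinearMap.ker (β.dual p)) : (β.restrict W).IsNondegenerate := by
  rintro ⟨x, hx⟩ hs hd
  have hpx : β.dual p x = 0 := by
    have : x ∈ LinearMap.ker (β.dual p) := hW ▸ Submodule.mem_sup_left hx
    exact this
  obtain ⟨c, hc⟩ := exists_eq_smul_of_ker_le (φ := β.dual x) (ψ := β.dual p) fun v hv => by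
    have hv' : v ∈ W ⊔ F ∙ p := hW ▸ hv
    obtain ⟨w, hw, y, hy, rfl⟩ := Submodule.mem_sup.1 hv'
    obtain ⟨a, rfl⟩ := Submodule.mem_span_singleton.1 hy
    have h1 : β.dual x w = 0 := congrArg (fun f : Module.Dual F W => f ⟨w, hw⟩) hd
    simp [h1, β.dual_comm hpx]
  by_cases h0 : c = 0
  · exact Subtype.ext (hβ x hs (by rw [hc, h0, zero_smul]))
  · obtain ⟨b, hb0, hb⟩ := β.exists_dual_smul p h0
    have hx0 : x + (-b) • p = 0 := by
      refine hβ _ ((β.singular_add_smul_iff hp hpx _).2 hs) ?_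
      rw [map_add, neg_smul, map_neg, hb, hc, add_neg_cancel]
    have : b • p ∈ W := by
      have : x = b • p := by
        rw [neg_smul] at hx0
        exact add_neg_eq_zero.1 hx0
      exact this ▸ hx
    exact absurd ((W.smul_mem_iff hb0).1 this) hpW

/-- The number of singular vectors. -/
noncomputable def singCount : ℕ := {v | β.IsSingular v}.ncard

theorem singCount_restrict (W : Submodule F V) :
    (β.restrict W).singCount = {v | v ∈ W ∧ β.IsSingular v}.ncard := by
  unfold singCount
  rw [← Set.ncard_image_of_injective _ W.subtype_injective]
  congr 1
  ext v
  simp [and_comm]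

/-- The normalized deviation of the number of singular vectors from its expected value. -/
noncomputable def excess : ℤ := Nat.card F * β.singCount - β.lineCount * Nat.card V

variable [Finite F] [Finite V]

theorem card_ker_mul {φ : Module.Dual F V} (hφ : φ ≠ 0) :
    Nat.card F * Nat.card (LinearMap.ker φ) = Nat.card V := by
  rw [Module.natCard_eq_pow_finrank (K := F) (V := LinearMap.ker φ),
    Module.natCard_eq_pow_finrank (K := F) (V := V), ← pow_succ',
    Module.Dual.finrank_ker_add_one_of_ne_zero hφ]

/-- Double count pairs (t, v) with v + t p singular and v not orthogonal to p. Translation by t p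
permutes these v, and each line in direction p contributes `lineCount`. -/
theorem card_mul_ncard_singular_off_ker {p : V} (hp : β.IsSingular p) :
    Nat.card F * {v | β.dual p v ≠ 0 ∧ β.IsSingular v}.ncard =
      β.lineCount * {v | β.dual p v ≠ 0}.ncard := by
  classical
  have := Fintype.ofFinite F
  have := Fintype.ofFinite V
  have hpp := β.dual_self hp
  have h1 : ∀ t : F, (∑ v, if β.dual p v ≠ 0 ∧ β.IsSingular (v + t • p) then 1 else 0) =
      {v | β.dual p v ≠ 0 ∧ β.IsSingular v}.ncard := fun t => by
    rw [Set.ncard_eq_toFinset_card', Set.toFinset_ofPred, Finset.card_filter]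
    refine Fintype.sum_equiv (Equiv.addRight (t • p)) _ _ fun v => ?_
    simp [hpp]
  have h2 : ∀ v, (∑ t : F, if β.dual p v ≠ 0 ∧ β.IsSingular (v + t • p) then 1 else 0) =
      if β.dual p v ≠ 0 then β.lineCount else 0 := fun v => by
    split_ifs with h
    · rw [← β.card_line hp h, Nat.card_eq_fintype_card, Fintype.card_subtype, Finset.card_filter]
      simp [h]
    · simp [h]
  calc Nat.card F * {v | β.dual p v ≠ 0 ∧ β.IsSingular v}.ncard
      = ∑ t : F, ∑ v, if β.dual p v ≠ 0 ∧ β.IsSingular (v + t • p) then 1 else 0 := by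
        simp [h1]
    _ = ∑ v, if β.dual p v ≠ 0 then β.lineCount else 0 := by
        rw [Finset.sum_comm]
        exact Finset.sum_congr rfl fun v _ => h2 v
    _ = _ := by
        rw [← Finset.sum_filter, Finset.sum_const, Set.ncard_eq_toFinset_card', Set.toFinset_ofPred,
          smul_eq_mul, mul_comm]

/-- A tangent hyperplane has the same excess as the whole space. -/
theorem excess_restrict_ker_dual {p : V} (hp : β.IsSingular p) (hp0 : β.dual p ≠ 0) :
    (β.restrict (LinearMap.ker (β.dual p))).excess = β.excess := by
  have h := β.card_mul_ncard_singular_off_ker hp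
  have h1 : {v | v ∈ LinearMap.ker (β.dual p) ∧ β.IsSingular v}.ncard +
      {v | β.dual p v ≠ 0 ∧ β.IsSingular v}.ncard = β.singCount := by
    rw [singCount, ← Set.ncard_union_eq]
    · congr 1
      ext v
      simp only [Set.mem_union, Set.mem_ofPred_eq, LinearMap.mem_ker]
      tauto
    · rw [Set.disjoint_left]
      exact fun v h1 h2 => h2.1 h1.1
  have h2 : Nat.card (LinearMap.ker (β.dual p)) + {v | β.dual p v ≠ 0}.ncard = Nat.card V := by
    have : Nat.card (LinearMap.ker (β.dual p)) = {v | β.dual p v = 0}.ncard := rfl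
    rw [this, ← Set.ncard_univ, ← Set.ncard_union_eq]
    · congr 1
      ext v
      simp only [Set.mem_union, Set.mem_ofPred_eq, Set.mem_univ, iff_true]
      tauto
    · rw [Set.disjoint_left]
      exact fun v h1 h2 => h2 h1
  have h3 := card_ker_mul hp0
  rw [excess, excess, singCount_restrict, restrict_lineCount]
  zify at h h1 h2 h3
  rw [← h1, ← h2]
  linear_combination -h

/-- The singular vectors of a tangent hyperplane form a cone over those of a complement. -/
theorem excess_restrict_complement {p : V} (hp : β.IsSingular p) {W : Submodule F V}
    (hpW : p ∉ W) (hW : W ⊔ F ∙ p = LinearMap.ker (β.dual p)) (hp0 : β.dual p ≠ 0) :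
    β.excess = Nat.card F * (β.restrict W).excess := by
  rw [← β.excess_restrict_ker_dual hp hp0]
  have hc : Nat.card (LinearMap.ker (β.dual p)) = Nat.card F * Nat.card W := by
    rw [Module.natCard_eq_pow_finrank (K := F) (V := LinearMap.ker (β.dual p)),
      Module.natCard_eq_pow_finrank (K := F) (V := W), finrank_eq_finrank_add_one hpW hW, pow_succ']
  have hs : {v | v ∈ LinearMap.ker (β.dual p) ∧ β.IsSingular v}.ncard =
      Nat.card F * {v | v ∈ W ∧ β.IsSingular v}.ncard := by
    rw [← Set.ncard_univ, ← Set.ncard_prod]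
    symm
    refine Set.ncard_congr (fun x _ => x.2 + x.1 • p) ?_ ?_ ?_
    · rintro ⟨a, w⟩ ⟨-, hw, hs⟩
      have hw' : w ∈ LinearMap.ker (β.dual p) := hW ▸ Submodule.mem_sup_left hw
      refine ⟨?_, (β.singular_add_smul_iff hp hw' a).2 hs⟩
      rw [← hW]
      exact Submodule.add_mem_sup hw (Submodule.smul_mem _ _ (Submodule.mem_span_singleton_self p))
    · rintro ⟨a, w⟩ ⟨b, x⟩ ⟨-, hw, -⟩ ⟨-, hx, -⟩ (h : w + a • p = x + b • p)
      have hab : a = b := by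
        by_contra hab
        refine hpW ((W.smul_mem_iff (sub_ne_zero.2 hab)).1 ?_)
        have : (a - b) • p = x - w := by
          rw [sub_smul, sub_eq_sub_iff_add_eq_add, add_comm, h]
        exact this ▸ W.sub_mem hx hw
      subst hab
      simpa using h
    · rintro v ⟨hv, hs⟩
      rw [← hW] at hv
      obtain ⟨w, hw, y, hy, rfl⟩ := Submodule.mem_sup.1 hv
      obtain ⟨a, rfl⟩ := Submodule.mem_span_singleton.1 hy
      have hw' : w ∈ LinearMap.ker (β.dual p) := hW ▸ Submodule.mem_sup_left hw
      exact ⟨(a, w), ⟨trivial, hw, (β.singular_add_smul_iff hp hw' a).1 hs⟩, rfl⟩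
  rw [excess, excess, singCount_restrict, singCount_restrict, hc, hs]
  simp only [restrict_lineCount]
  push_cast
  ring

theorem kerSum_pointIndicator_eq [Fintype V] {S : Set (ℙ F V)}
    (hS : ∀ v, v ∈ vectors S ↔ v ≠ 0 ∧ β.IsSingular v) (φ : Module.Dual F V) :
    kerSum (pointIndicator S) φ + 1 = (β.restrict (LinearMap.ker φ)).singCount := by
  rw [kerSum_pointIndicator_eq_ncard, singCount_restrict]
  have : {v | v ∈ LinearMap.ker φ ∧ β.IsSingular v} = insert 0 {v | φ v = 0 ∧ v ∈ vectors S} := by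
    ext v
    by_cases hv : v = 0
    · simp [hv, β.singular_zero]
    · simp [hS, hv]
  rw [this, Set.ncard_insert_of_notMem (fun h => zero_notMem_vectors S h.2)]
  push_cast
  rfl

theorem card_mul_kerSum_pointIndicator [Fintype V] {S : Set (ℙ F V)}
    (hS : ∀ v, v ∈ vectors S ↔ v ≠ 0 ∧ β.IsSingular v) (φ : Module.Dual F V) :
    Nat.card F * (kerSum (pointIndicator S) φ + 1) = (β.restrict (LinearMap.ker φ)).excess +
      β.lineCount * Nat.card (LinearMap.ker φ) := by
  rw [β.kerSum_pointIndicator_eq hS, excess]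
  simp

theorem card_mul_sum_pointIndicator [Fintype V] {S : Set (ℙ F V)}
    (hS : ∀ v, v ∈ vectors S ↔ v ≠ 0 ∧ β.IsSingular v) :
    Nat.card F * (∑ v, pointIndicator S v + 1) = β.excess + β.lineCount * Nat.card V := by
  have : {v | β.IsSingular v} = insert 0 (vectors S) := by
    ext v
    by_cases hv : v = 0
    · simp [hv, β.singular_zero]
    · simp [hS, hv]
  rw [sum_pointIndicator, excess, singCount, this,
    Set.ncard_insert_of_notMem (zero_notMem_vectors S)]
  push_cast
  ring

end

/-- Splitting off hyperbolic pairs until an anisotropic subspace is left determines the excess. -/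
theorem exists_anisotropic_core {F : Type u} [Field F] [Finite F] (n : ℕ) :
    ∀ {V : Type v} [AddCommGroup V] [Module F V] [Finite V] (β : PolarForm F V),
      β.IsNondegenerate → Module.finrank F V = n →
      ∃ (j : ℕ) (U : Submodule F V), n = 2 * j + Module.finrank F U ∧
        (∀ u ∈ U, β.IsSingular u → u = 0) ∧
        β.excess = Nat.card F ^ j * (Nat.card F - β.lineCount * Nat.card F ^ Module.finrank F U) := by
  induction n using Nat.strong_induction_on with
  | _ n ih =>
    intro V _ _ _ β hβ hn
    by_cases hiso : ∃ p, p ≠ 0 ∧ β.IsSingular p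
    · obtain ⟨p, hp0, hp⟩ := hiso
      have hd : β.dual p ≠ 0 := fun h => hp0 (hβ p hp h)
      -- Passing to a complement of p in its orthogonal space lowers the dimension by two and
      -- divides the excess by q, which accounts for one more factor of q.
      obtain ⟨W, -, hpW, hW⟩ :=
        exists_complement_of_mem (K := LinearMap.ker (β.dual p)) (β.dual_self hp) hp0
      have h1 := finrank_eq_finrank_add_one hpW hW
      have h2 := Module.Dual.finrank_ker_add_one_of_ne_zero hd
      obtain ⟨j, U, hU, hUs, he⟩ := ih (Module.finrank F W) (by omega) (β.restrict W)
        (β.restrict_complement_isNondegenerate hβ hp hpW hW) rfl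
      have hUf : Module.finrank F (U.map W.subtype) = Module.finrank F U :=
        (Submodule.equivMapOfInjective _ W.subtype_injective U).finrank_eq.symm
      refine ⟨j + 1, U.map W.subtype, by omega, ?_, ?_⟩
      · rintro _ ⟨u, hu, rfl⟩ hs
        rw [hUs u hu hs, map_zero]
      · rw [β.excess_restrict_complement hp hpW hW hd, he, hUf, restrict_lineCount]
        ring
    · push Not at hiso
      refine ⟨0, ⊤, by simp [hn], fun u _ hs => by_contra fun h => hiso u h hs, ?_⟩
      have : β.singCount = 1 := by
        rw [singCount, Set.ncard_eq_one]
        refine ⟨0, Set.eq_singleton_iff_unique_mem.2 ⟨β.singular_zero, fun u hs => ?_⟩⟩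
        exact by_contra fun h => hiso u h hs
      rw [excess, this, finrank_top, Module.natCard_eq_pow_finrank (K := F) (V := V)]
      push_cast
      ring

end PolarForm

/-! ### Quadratic forms over finite fields. -/

section Quadric

variable {F : Type u} {V : Type v} [Field F] [AddCommGroup V] [Module F V]

/-- The polar form of a quadratic form. -/
def quadraticPolarForm (Q : QuadraticForm F V) : PolarForm F V where
  IsSingular v := Q v = 0
  dual := Q.polarBilin.toAddMonoidHom
  lineCount := 1
  singular_zero := Q.map_zero
  singular_smul a v h := by rw [Q.map_smul, h, smul_zero]
  dual_comm {v w} h := by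
    simpa [QuadraticMap.polar_comm Q w v] using h
  dual_self {v} h := by
    simpa [QuadraticMap.polar_self] using Or.inr h
  exists_dual_smul {a} v ha := ⟨a, ha, by simp⟩
  singular_add_iff {p v} hp h := by
    have h' : QuadraticMap.polar Q v p = 0 := by
      rw [QuadraticMap.polar_comm]
      exact h
    rw [QuadraticMap.map_add Q, hp, h', add_zero, add_zero]
  card_line {p v} hp h := by
    have h' : QuadraticMap.polar Q v p ≠ 0 := by
      rw [QuadraticMap.polar_comm]
      exact h
    rw [Nat.card_eq_one_iff_unique]
    have key : ∀ t : F, Q (v + t • p) = 0 ↔ t = -Q v / QuadraticMap.polar Q v p := fun t => by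
      rw [QuadraticMap.map_add Q, QuadraticMap.map_smul, hp, QuadraticMap.polar_smul_right,
        eq_div_iff h', eq_neg_iff_add_eq_zero]
      simp [add_comm]
    exact ⟨⟨fun s t => Subtype.ext (((key s).1 s.2).trans ((key t).1 t.2).symm)⟩,
      ⟨⟨_, (key _).2 rfl⟩⟩⟩

@[simp]
theorem quadraticPolarForm_isSingular (Q : QuadraticForm F V) (v : V) :
    (quadraticPolarForm Q).IsSingular v ↔ Q v = 0 := Iff.rfl

theorem quadraticPolarForm_dual (Q : QuadraticForm F V) (v : V) :
    (quadraticPolarForm Q).dual v = Q.polarBilin v := rfl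

@[simp]
theorem quadraticPolarForm_lineCount (Q : QuadraticForm F V) :
    (quadraticPolarForm Q).lineCount = 1 := rfl

theorem mem_vectors_quadricPoints (Q : QuadraticForm F V) (v : V) :
    v ∈ vectors (quadricPoints Q) ↔ v ≠ 0 ∧ (quadraticPolarForm Q).IsSingular v := by
  constructor
  · rintro ⟨hv, h⟩
    obtain ⟨a, ha⟩ := Projectivization.exists_smul_eq_mk_rep F v hv
    have h' : Q (Projectivization.mk F v hv).rep = 0 := h
    rw [← ha, Units.smul_def, Q.map_smul] at h'
    exact ⟨hv, by simpa using h'⟩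
  · rintro ⟨hv, h⟩
    obtain ⟨a, ha⟩ := Projectivization.exists_smul_eq_mk_rep F v hv
    refine ⟨hv, ?_⟩
    change Q (Projectivization.mk F v hv).rep = 0
    rw [← ha, Units.smul_def, Q.map_smul]
    simpa using h

theorem isNondegenerate_quadraticPolarForm {Q : QuadraticForm F V} (hQ : Q.Nondegenerate) :
    (quadraticPolarForm Q).IsNondegenerate := fun v h1 h2 => by
  have : v ∈ Q.radical := ⟨h1, h2⟩
  rw [hQ.radical_eq_bot] at this
  exact this

variable [Finite F]

theorem exists_mul_self_eq_of_two_eq_zero (h : (2 : F) = 0) (a : F) : ∃ b : F, b * b = a := by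
  have := Fintype.ofFinite F
  have h2 : ringChar F = 2 := by
    have := CharP.ringChar_of_prime_eq_zero Nat.prime_two (R := F) (by exact_mod_cast h)
    exact this
  obtain ⟨b, hb⟩ := FiniteField.isSquare_of_char_two h2 a
  exact ⟨b, hb.symm⟩

/-- Over a finite field a quadratic form is nondegenerate as soon as no nonzero singular vector is
orthogonal to the whole space. -/
theorem nondegenerate_of_isNondegenerate {Q : QuadraticForm F V}
    (hQ : (quadraticPolarForm Q).IsNondegenerate) : Q.Nondegenerate := by
  refine ⟨eq_bot_iff.2 fun v hv => hQ v hv.1 hv.2, ?_⟩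
  have hself : ∀ v, Q.polarBilin v = 0 → (2 : F) * Q v = 0 := fun v hv => by
    have : QuadraticMap.polar Q v v = 0 := congrArg (fun f : V →ₗ[F] F => f v) hv
    rw [QuadraticMap.polar_self] at this
    simpa using this
  by_cases h2 : (2 : F) = 0
  · by_cases hk : ∀ v, Q.polarBilin v = 0 → v = 0
    · rw [rank_le_one_iff]
      exact ⟨0, fun v => ⟨0, by
        rw [smul_zero]
        exact Subtype.ext (hk v v.2).symm⟩⟩
    · push Not at hk
      obtain ⟨z, hz, hz0⟩ := hk
      have hQz : Q z ≠ 0 := fun h => hz0 (hQ z h hz)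
      rw [rank_le_one_iff]
      refine ⟨⟨z, hz⟩, fun v => ?_⟩
      -- In characteristic 2, Q is additive on the radical of its polar form and every scalar is a
      -- square. So b z + v is singular for a suitable b, hence zero, and the radical is at most a
      -- line.
      obtain ⟨b, hb⟩ := exists_mul_self_eq_of_two_eq_zero h2 (Q v / Q z)
      refine ⟨b, Subtype.ext ?_⟩
      have hneg : ∀ x : F, x + x = 0 := fun x => by rw [← two_mul, h2, zero_mul]
      have hv : Q.polarBilin (v : V) = 0 := v.2
      have h0 : b • z + (v : V) = 0 := by
        refine hQ _ ?_ ?_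
        · have hp : QuadraticMap.polar Q (b • z) (v : V) = 0 := by
            have : QuadraticMap.polar Q z (v : V) = 0 :=
              congrArg (fun f : V →ₗ[F] F => f v) hz
            simp [this]
          change Q _ = 0
          rw [QuadraticMap.map_add Q, hp, Q.map_smul, hb, smul_eq_mul, div_mul_cancel₀ _ hQz,
            hneg, zero_add]
        · rw [quadraticPolarForm_dual, map_add, map_smul, hz, hv, smul_zero, zero_add]
      have hvv : (v : V) + v = 0 := by
        rw [← two_smul F (v : V), h2, zero_smul]
      change b • z = (v : V)
      rw [eq_neg_of_add_eq_zero_left h0, eq_comm]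
      exact eq_neg_of_add_eq_zero_left hvv
  · rw [rank_le_one_iff]
    refine ⟨0, fun v => ⟨0, ?_⟩⟩
    rw [smul_zero]
    refine Subtype.ext (hQ v ?_ v.2).symm
    exact (mul_eq_zero.1 (hself v v.2)).resolve_left h2

open MvPolynomial in
/-- A ternary quadratic form over a finite field is isotropic. -/
theorem exists_isotropic_of_linearIndependent (Q : QuadraticForm F V) {x : Fin 3 → V}
    (hx : LinearIndependent F x) : ∃ v ∈ Submodule.span F (Set.range x), v ≠ 0 ∧ Q v = 0 := by
  classical
  have := Fintype.ofFinite F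
  let f : MvPolynomial (Fin 3) F :=
    ∑ i, ∑ j, C (if i = j then Q (x i) else if i < j then QuadraticMap.polar Q (x i) (x j) else 0) *
      X i * X j
  have hdeg : f.totalDegree < Fintype.card (Fin 3) := by
    refine lt_of_le_of_lt (b := 2) ?_ (by simp)
    refine (totalDegree_finsetSum _ _).trans (Finset.sup_le fun i _ => ?_)
    refine (totalDegree_finsetSum _ _).trans (Finset.sup_le fun j _ => ?_)
    refine (totalDegree_mul _ _).trans ?_
    rw [totalDegree_X]
    refine Nat.succ_le_succ ((totalDegree_mul _ _).trans ?_)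
    rw [totalDegree_C, totalDegree_X]
  have heval : ∀ c : Fin 3 → F, eval c f = Q (∑ i, c i • x i) := fun c => by
    simp only [f, Fin.sum_univ_three, map_add, map_mul, eval_C, eval_X]
    rw [QuadraticMap.map_add Q, QuadraticMap.map_add Q, QuadraticMap.polar_add_left]
    simp [QuadraticMap.map_smul]
    ring
  -- Chevalley–Warning: f has degree at most 2 in three variables, so the characteristic divides the
  -- number of zeros, and 0 is not the only one.
  have hdvd := char_dvd_card_solutions (ringChar F) hdeg
  have hp : (ringChar F).Prime := CharP.char_is_prime F _
  have h0 : eval (0 : Fin 3 → F) f = 0 := by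
    rw [heval]
    simp
  have hcard : 1 < Fintype.card {c : Fin 3 → F // eval c f = 0} := by
    have hpos : 0 < Fintype.card {c : Fin 3 → F // eval c f = 0} :=
      Fintype.card_pos_iff.2 ⟨⟨0, h0⟩⟩
    exact lt_of_lt_of_le hp.one_lt (Nat.le_of_dvd hpos hdvd)
  obtain ⟨c, hc⟩ := Fintype.exists_ne_of_one_lt_card hcard ⟨0, h0⟩
  refine ⟨∑ i, c.1 i • x i, Submodule.sum_mem _ fun i _ =>
    Submodule.smul_mem _ _ (Submodule.subset_span ⟨i, rfl⟩), fun h => hc ?_, ?_⟩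
  · exact Subtype.ext (funext (Fintype.linearIndependent_iff.1 hx c.1 h))
  · rw [← heval]
    exact c.2

theorem finrank_le_two_of_anisotropic [Finite V] (Q : QuadraticForm F V) {U : Submodule F V}
    (hU : ∀ u ∈ U, Q u = 0 → u = 0) : Module.finrank F U ≤ 2 := by
  by_contra! h
  obtain ⟨x, hx⟩ := exists_linearIndependent_of_le_finrank (R := F) (M := U) (n := 3) h
  obtain ⟨v, -, hv0, hv⟩ := exists_isotropic_of_linearIndependent (Q.comp U.subtype) hx
  exact hv0 (Subtype.ext (hU v v.2 hv))

/-- The anisotropic core has dimension 0 or 2, and this decides the sign ε. Separating β from Q lets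
the lemma apply to restrictions of a polar form. -/
theorem excess_of_even [Finite V] {Q : QuadraticForm F V} {β : PolarForm F V} (hβ : β.IsNondegenerate)
    (hs : ∀ v, β.IsSingular v ↔ Q v = 0) (hl : β.lineCount = 1) {k : ℕ}
    (hk : Module.finrank F V = 2 * k) :
    ∃ ε : ℤ, (ε = 1 ∨ ε = -1) ∧ β.excess = ε * Nat.card F ^ k * (Nat.card F - 1) := by
  obtain ⟨j, U, hj, hU, he⟩ := PolarForm.exists_anisotropic_core _ β hβ rfl
  have hU2 := finrank_le_two_of_anisotropic Q (U := U) fun u hu h => hU u hu ((hs u).2 h)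
  rw [he, hl]
  obtain h0 | h0 : Module.finrank F U = 0 ∨ Module.finrank F U = 2 := by omega
  · obtain rfl : j = k := by omega
    refine ⟨1, Or.inl rfl, ?_⟩
    rw [h0]
    push_cast
    ring
  · obtain rfl : j + 1 = k := by omega
    refine ⟨-1, Or.inr rfl, ?_⟩
    rw [h0]
    push_cast
    ring

/-- The anisotropic core has dimension 1, so the factor q - q ^ 1 vanishes. -/
theorem excess_of_odd [Finite V] {Q : QuadraticForm F V} {β : PolarForm F V} (hβ : β.IsNondegenerate)
    (hs : ∀ v, β.IsSingular v ↔ Q v = 0) (hl : β.lineCount = 1)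
    (hk : Odd (Module.finrank F V)) : β.excess = 0 := by
  obtain ⟨j, U, hj, hU, he⟩ := PolarForm.exists_anisotropic_core _ β hβ rfl
  have hU2 := finrank_le_two_of_anisotropic Q (U := U) fun u hu h => hU u hu ((hs u).2 h)
  obtain ⟨k, hk⟩ := hk
  obtain h0 : Module.finrank F U = 1 := by omega
  rw [he, hl, h0]
  push_cast
  ring

end Quadric

/-! ### Tangent functionals of a quadric in a pencil. -/

section Tangent

variable {F : Type u} {V : Type v} [Field F] [AddCommGroup V] [Module F V]

/-- `β.dual` is injective on singular vectors: if x and y have the same image they are orthogonal,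
so x - y is singular and lies in the radical. -/
theorem PolarForm.ncard_isTangent {β : PolarForm F V} (hβ : β.IsNondegenerate) :
    {φ | β.IsTangent φ}.ncard = β.singCount := by
  have : {φ | β.IsTangent φ} = β.dual '' {v | β.IsSingular v} := by
    ext φ
    rfl
  rw [this, Set.InjOn.ncard_image, singCount]
  intro x hx y hy hxy
  have h : x + (-1 : F) • y = 0 := by
    refine hβ _ ((β.singular_add_smul_iff hy ?_ _).2 hx) (by simp [hxy])
    rw [← hxy]
    exact β.dual_self hx
  simpa [add_neg_eq_zero] using h

/-- The difference quotient p of z₁ and z₂ represents ψ. If p is not singular, Q on the line z₁ + s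
p is a quadratic polynomial vanishing at s = 0 and s = t₂ - t₁. The vector z₃ deviates from this
line only by some y in the radical of the polar form. Either Q y = 0 and the polynomial has a third
root, or the characteristic is 2 and p can be made singular by adding a multiple of y. -/
theorem isTangent_of_three [Finite F] {Q : QuadraticForm F V} {φ ψ : Module.Dual F V}
    {t₁ t₂ t₃ : F} (h₁₂ : t₁ ≠ t₂) (h₁₃ : t₁ ≠ t₃) (h₂₃ : t₂ ≠ t₃)
    (h₁ : (quadraticPolarForm Q).IsTangent (φ + t₁ • ψ))
    (h₂ : (quadraticPolarForm Q).IsTangent (φ + t₂ • ψ))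
    (h₃ : (quadraticPolarForm Q).IsTangent (φ + t₃ • ψ)) :
    (quadraticPolarForm Q).IsTangent ψ := by
  obtain ⟨z₁, hz₁, hd₁⟩ := h₁
  obtain ⟨z₂, hz₂, hd₂⟩ := h₂
  obtain ⟨z₃, hz₃, hd₃⟩ := h₃
  have hs₂ : t₂ - t₁ ≠ 0 := sub_ne_zero.2 h₁₂.symm
  have hs₃ : t₃ - t₁ ≠ 0 := sub_ne_zero.2 h₁₃.symm
  have hs : t₃ - t₂ ≠ 0 := sub_ne_zero.2 h₂₃.symm
  rw [quadraticPolarForm_dual] at hd₁ hd₂ hd₃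
  rw [quadraticPolarForm_isSingular] at hz₁ hz₂ hz₃
  obtain ⟨p, hp⟩ : ∃ p, p = (t₂ - t₁)⁻¹ • (z₂ - z₁) := ⟨_, rfl⟩
  have hd : ∀ x, Q.polarBilin z₁ x = φ x + t₁ * ψ x ∧ Q.polarBilin z₂ x = φ x + t₂ * ψ x ∧
      Q.polarBilin z₃ x = φ x + t₃ * ψ x := fun x => by
    rw [hd₁, hd₂, hd₃]
    exact ⟨rfl, rfl, rfl⟩
  have hdp : Q.polarBilin p = ψ := by
    refine LinearMap.ext fun x => ?_
    rw [hp, map_smul, map_sub, LinearMap.smul_apply, LinearMap.sub_apply, (hd x).1, (hd x).2.1,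
      smul_eq_mul, add_sub_add_left_eq_sub, ← sub_mul, inv_mul_cancel_left₀ hs₂]
  by_cases hQp : Q p = 0
  · exact ⟨p, hQp, hdp⟩
  obtain ⟨y, hy⟩ : ∃ y, y = z₃ - (z₁ + (t₃ - t₁) • p) := ⟨_, rfl⟩
  have hdy : Q.polarBilin y = 0 := by
    refine LinearMap.ext fun x => ?_
    rw [hy, map_sub, map_add, map_smul, LinearMap.sub_apply, LinearMap.add_apply,
      LinearMap.smul_apply, hdp, (hd x).1, (hd x).2.2, smul_eq_mul, LinearMap.zero_apply]
    ring
  have hpy : ∀ x, QuadraticMap.polar Q x y = 0 := fun x => by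
    rw [QuadraticMap.polar_comm]
    exact congrArg (fun f : V →ₗ[F] F => f x) hdy
  have hz₂' : z₂ = z₁ + (t₂ - t₁) • p := by
    rw [hp, smul_smul, mul_inv_cancel₀ hs₂, one_smul]
    abel
  have hz₃' : z₃ = (z₁ + (t₃ - t₁) • p) + y := by
    rw [hy]
    abel
  have e₂ : (t₂ - t₁) * (QuadraticMap.polar Q z₁ p + (t₂ - t₁) * Q p) = 0 := by
    have := hz₂
    rw [hz₂', QuadraticMap.map_add Q, hz₁, Q.map_smul, QuadraticMap.polar_smul_right] at this
    simp only [smul_eq_mul] at this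
    linear_combination this
  have e₂' := (mul_eq_zero.1 e₂).resolve_left hs₂
  have e₃ : (t₃ - t₁) * (QuadraticMap.polar Q z₁ p + (t₃ - t₁) * Q p) + Q y = 0 := by
    have := hz₃
    rw [hz₃', QuadraticMap.map_add Q, hpy, QuadraticMap.map_add Q, hz₁, Q.map_smul,
      QuadraticMap.polar_smul_right] at this
    simp only [smul_eq_mul] at this
    linear_combination this
  have e₄ : (t₃ - t₁) * (t₃ - t₂) * Q p + Q y = 0 := by
    linear_combination e₃ - (t₃ - t₁) * e₂'
  by_cases hQy : Q y = 0
  · rw [hQy, add_zero] at e₄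
    exact absurd e₄ (mul_ne_zero (mul_ne_zero hs₃ hs) hQp)
  · have h2 : (2 : F) = 0 := by
      have := hpy y
      rw [QuadraticMap.polar_self] at this
      simpa [hQy] using this
    obtain ⟨a, ha⟩ := exists_mul_self_eq_of_two_eq_zero h2 (Q p / Q y)
    refine ⟨p + a • y, ?_, ?_⟩
    · rw [quadraticPolarForm_isSingular, QuadraticMap.map_add Q, QuadraticMap.polar_smul_right,
        hpy, Q.map_smul, ha, smul_eq_mul, div_mul_cancel₀ _ hQy, smul_zero, add_zero, ← two_mul,
        h2, zero_mul]
    · rw [quadraticPolarForm_dual, map_add, map_smul, hdy, hdp, smul_zero, add_zero]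

/-- On a pencil of hyperplanes containing a non-tangent one, at most two are tangent. -/
theorem ncard_isTangent_line_le [Finite F] {Q : QuadraticForm F V} {ψ : Module.Dual F V}
    (hψ : ¬ (quadraticPolarForm Q).IsTangent ψ) (φ : Module.Dual F V) :
    {t : F | (quadraticPolarForm Q).IsTangent (φ + t • ψ)}.ncard ≤ 2 := by
  by_contra! h
  obtain ⟨t₁, t₂, t₃, h₁, h₂, h₃, h₁₂, h₁₃, h₂₃⟩ := (Set.two_lt_ncard_iff (Set.toFinite _)).1 h
  exact hψ (isTangent_of_three h₁₂ h₁₃ h₂₃ h₁ h₂ h₃)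

end Tangent

/-! ### Trace and norm of an involutory automorphism of a finite field. -/

section Involution

variable {F : Type u} [Field F] {σ : F →+* F}

/-- The number of elements fixed by `σ`. -/
noncomputable def fixedCard (σ : F →+* F) : ℕ := {a | σ a = a}.ncard

variable [Finite F]

theorem AddMonoidHom.card_ker_mul_card_range {G : Type*} [AddCommGroup G] (f : G →+ G) :
    Nat.card f.ker * Nat.card f.range = Nat.card G := by
  rw [← AddSubgroup.index_ker, AddSubgroup.card_mul_index]

theorem MonoidHom.card_ker_mul_card_range {G : Type*} [CommGroup G] (f : G →* G) :
    Nat.card f.ker * Nat.card f.range = Nat.card G := by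
  rw [← Subgroup.index_ker, Subgroup.card_mul_index]

variable (hσ : ∀ a, σ (σ a) = a) (hσ1 : σ ≠ RingHom.id F)

include hσ hσ1

theorem exists_trace_ne_zero : ∃ b, b + σ b ≠ 0 := by
  by_contra! h
  have h2 : (1 : F) + 1 = 0 := by simpa using h 1
  refine hσ1 (RingHom.ext fun a => ?_)
  have : a + a = 0 := by linear_combination a * h2
  rw [RingHom.id_apply]
  linear_combination h a - this

/-- The trace maps onto the fixed field, since b a / (b + σ b) has trace a, and its kernel is the
fixed field multiplied by σ x - x for any x not fixed. -/
theorem ncard_trace_fiber_aux :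
    {t | t + σ t = 0}.ncard = fixedCard σ ∧ Nat.card F = fixedCard σ ^ 2 := by
  let τ : F →+ F := AddMonoidHom.id F + σ.toAddMonoidHom
  have hτ : ∀ t, τ t = t + σ t := fun t => rfl
  have hker : Nat.card τ.ker = {t | t + σ t = 0}.ncard := rfl
  have hrange : Nat.card τ.range = fixedCard σ := by
    have : (τ.range : Set F) = {a | σ a = a} := by
      ext a
      constructor
      · rintro ⟨t, rfl⟩
        simp [hτ, hσ, add_comm]
      · intro ha
        obtain ⟨b, hb⟩ := exists_trace_ne_zero hσ hσ1
        refine ⟨b * a / (b + σ b), ?_⟩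
        have ha' : σ a = a := ha
        rw [hτ, map_div₀, map_mul, map_add, hσ, ha', add_comm (σ b) b, ← add_div,
          div_eq_iff hb]
        ring
    rw [fixedCard, ← this]
    rfl
  obtain ⟨x, hx⟩ : ∃ x, σ x ≠ x := by
    by_contra! h
    exact hσ1 (RingHom.ext h)
  have hx0 : σ x - x ≠ 0 := sub_ne_zero.2 hx
  have hfib : {t | t + σ t = 0}.ncard = fixedCard σ := by
    have : {t | t + σ t = 0} = (fun a => (σ x - x) * a) '' {a | σ a = a} := by
      ext t
      constructor
      · intro ht
        refine ⟨t / (σ x - x), ?_, mul_div_cancel₀ t hx0⟩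
        have ht' : σ t = -t := by
          have : t + σ t = 0 := ht
          linear_combination this
        change σ _ = _
        rw [map_div₀, map_sub, hσ, ht', ← neg_sub, div_neg, neg_div, neg_neg]
      · rintro ⟨a, ha, rfl⟩
        have ha' : σ a = a := ha
        change _ + _ = (0 : F)
        rw [map_mul, map_sub, hσ, ha']
        ring
    rw [this, Set.ncard_image_of_injective _ (mul_right_injective₀ hx0), fixedCard]
  have h := AddMonoidHom.card_ker_mul_card_range τ
  rw [hker, hrange, hfib] at h
  exact ⟨hfib, by rw [← h, sq]⟩

theorem card_eq_fixedCard_sq : Nat.card F = fixedCard σ ^ 2 :=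
  (ncard_trace_fiber_aux hσ hσ1).2

theorem two_le_fixedCard : 2 ≤ fixedCard σ := by
  have : 1 < {a | σ a = a}.ncard :=
    (Set.one_lt_ncard_iff (Set.toFinite _)).2 ⟨0, 1, by simp, by simp, zero_ne_one⟩
  exact this

theorem ncard_trace_fiber {a : F} (ha : σ a = a) : {t | t + σ t = a}.ncard = fixedCard σ := by
  obtain ⟨b, hb⟩ := exists_trace_ne_zero hσ hσ1
  rw [← (ncard_trace_fiber_aux hσ hσ1).1]
  have : {t | t + σ t = a} = (fun t => t + b * a / (b + σ b)) '' {t | t + σ t = 0} := by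
    have hs : b * a / (b + σ b) + σ (b * a / (b + σ b)) = a := by
      rw [map_div₀, map_mul, map_add, hσ, ha, add_comm (σ b) b, ← add_div, div_eq_iff hb]
      ring
    ext t
    constructor
    · intro ht
      refine ⟨t - b * a / (b + σ b), ?_, sub_add_cancel _ _⟩
      have ht' : t + σ t = a := ht
      change _ + _ = (0 : F)
      rw [map_sub]
      linear_combination ht' - hs
    · rintro ⟨t, ht, rfl⟩
      have ht' : t + σ t = 0 := ht
      change _ + _ = a
      rw [map_add]
      linear_combination ht' + hs
  rw [this, Set.ncard_image_of_injective _ (add_left_injective _)]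

/-- The norm map of a quadratic extension of finite fields is surjective. -/
theorem exists_mul_conj_eq {a : F} (ha : σ a = a) : ∃ t, t * σ t = a := by
  by_cases ha0 : a = 0
  · exact ⟨0, by simp [ha0]⟩
  let σu : Fˣ →* Fˣ := Units.map σ.toMonoidHom
  let N : Fˣ →* Fˣ := MonoidHom.id Fˣ * σu
  let M : Fˣ →* Fˣ := MonoidHom.id Fˣ / σu
  have hσu : ∀ s : Fˣ, ((σu s : Fˣ) : F) = σ s := fun s => rfl
  have hN : ∀ s : Fˣ, N s = s * σu s := fun s => rfl
  have hM : ∀ s : Fˣ, M s = s / σu s := fun s => rfl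
  have hMker : ∀ s : Fˣ, s ∈ M.ker ↔ σ s = s := fun s => by
    rw [MonoidHom.mem_ker, hM, div_eq_one, Units.ext_iff, hσu, eq_comm]
  have hq := card_eq_fixedCard_sq hσ hσ1
  have hr := two_le_fixedCard hσ hσ1
  have hMcard : Nat.card M.ker + 1 = fixedCard σ := by
    have : {a | σ a = a} = insert 0 ((fun s : Fˣ => (s : F)) '' (M.ker : Set Fˣ)) := by
      ext b
      by_cases hb : b = 0
      · simp [hb]
      · have : σ b = b ↔ ∃ s : Fˣ, s ∈ M.ker ∧ (s : F) = b := by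
          constructor
          · exact fun h => ⟨Units.mk0 b hb, (hMker _).2 h, rfl⟩
          · rintro ⟨s, hs, rfl⟩
            exact (hMker s).1 hs
        simpa [hb] using this
    rw [fixedCard, this, Set.ncard_insert_of_notMem, Set.ncard_image_of_injective _ Units.val_injective]
    · rfl
    · rintro ⟨s, -, hs⟩
      exact s.ne_zero hs
  -- Hilbert 90: an element t of norm 1 equals s / σ s with s = 1 + t, or with s = σ x - x when t =
  -- -1.
  have hle : N.ker ≤ M.range := by
    intro t ht
    have ht' : (t : F) * σ t = 1 := by
      rw [MonoidHom.mem_ker, hN, Units.ext_iff] at ht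
      exact ht
    by_cases h1 : 1 + (t : F) = 0
    · obtain ⟨x, hx⟩ : ∃ x, σ x ≠ x := by
        by_contra! h
        exact hσ1 (RingHom.ext h)
      have hx0 : σ x - x ≠ 0 := sub_ne_zero.2 hx
      refine ⟨Units.mk0 _ hx0, ?_⟩
      rw [hM, div_eq_iff_eq_mul, Units.ext_iff, Units.val_mul, hσu, Units.val_mk0, map_sub, hσ]
      linear_combination (σ x - x) * h1
    · refine ⟨Units.mk0 _ h1, ?_⟩
      rw [hM, div_eq_iff_eq_mul, Units.ext_iff, Units.val_mul, hσu, Units.val_mk0, map_add, map_one]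
      linear_combination -ht'
  have hcF : Nat.card Fˣ + 1 = fixedCard σ ^ 2 := by
    rw [Nat.card_units, hq]
    have : 0 < fixedCard σ ^ 2 := by positivity
    omega
  have e1 := MonoidHom.card_ker_mul_card_range M
  have e2 := MonoidHom.card_ker_mul_card_range N
  have e3 : Nat.card N.ker ≤ Nat.card M.range := Subgroup.card_le_of_le hle
  have hNM : N.range ≤ M.ker := by
    rintro _ ⟨s, rfl⟩
    rw [hMker, hN, Units.val_mul, map_mul, hσu, hσ, mul_comm]
  -- Kernel and range orders of N and of M have the same product, so |ker N| ≤ |range M| gives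
  -- |range N| ≥ |ker M|.
  have heq : N.range = M.ker := by
    refine Subgroup.eq_of_le_of_card_ge hNM ?_
    by_contra! hlt
    have h0 : 0 < Nat.card M.range := Nat.card_pos
    have : Nat.card N.ker * Nat.card N.range < Nat.card M.ker * Nat.card M.range :=
      calc Nat.card N.ker * Nat.card N.range ≤ Nat.card M.range * Nat.card N.range :=
            Nat.mul_le_mul_right _ e3
        _ < Nat.card M.range * Nat.card M.ker := Nat.mul_lt_mul_of_pos_left hlt h0
        _ = _ := mul_comm _ _
    omega
  have hmem : Units.mk0 a ha0 ∈ N.range := by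
    rw [heq, hMker]
    exact ha
  obtain ⟨t, ht⟩ := hmem
  exact ⟨t, congrArg Units.val ht⟩

end Involution

/-! ### Hermitian forms over finite fields. -/

section Hermitian

variable {F : Type u} {V : Type v} [Field F] [Finite F] [AddCommGroup V] [Module F V]
  {σ : F →+* F}

/-- The polar form of a Hermitian form. -/
noncomputable def hermitianPolarForm (hσ : ∀ a, σ (σ a) = a) (hσ1 : σ ≠ RingHom.id F)
    (h : V →ₛₗ[σ] V →ₗ[F] F) (hs : h.IsSymm) : PolarForm F V where
  IsSingular v := h v v = 0
  dual := h.toAddMonoidHom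
  lineCount := fixedCard σ
  singular_zero := by simp
  singular_smul a v hv := by simp [hv]
  dual_comm {v w} hv := by
    have hv' : h v w = 0 := hv
    change h w v = 0
    rw [← hs.eq, hv', map_zero]
  dual_self hv := hv
  exists_dual_smul {a} v ha := ⟨σ a, by simpa using ha, by
    change h (σ a • v) = a • h v
    rw [h.map_smulₛₗ, hσ]⟩
  singular_add_iff {p v} hp hv := by
    have hv' : h p v = 0 := hv
    have hv'' : h v p = 0 := by rw [← hs.eq, hv', map_zero]
    simp [hp, hv', hv'']
  card_line {p v} hp hv := by
    have hv' : σ (h p v) ≠ 0 := fun h0 => hv (by simpa using h0)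
    -- Up to the scalar σ (h p v), the singular points of the line are the solutions of a trace
    -- equation.
    have key : ∀ t : F, h (v + t • p) (v + t • p) =
        h v v + (t * σ (h p v) + σ (t * σ (h p v))) := fun t => by
      have : h v p = σ (h p v) := (hs.eq p v).symm
      simp [hp, hσ, this]
      ring
    have hvv : σ (-h v v) = -h v v := by rw [map_neg, hs.eq]
    rw [← ncard_trace_fiber hσ hσ1 hvv]
    have : {t : F | h (v + t • p) (v + t • p) = 0} =
        (fun t => t / σ (h p v)) '' {t | t + σ t = -h v v} := by
      ext t
      constructor
      · intro ht
        refine ⟨t * σ (h p v), ?_, mul_div_cancel_right₀ t hv'⟩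
        have ht' : h (v + t • p) (v + t • p) = 0 := ht
        change _ + _ = _
        rw [key] at ht'
        linear_combination ht'
      · rintro ⟨s, hs', rfl⟩
        have hs'' : s + σ s = -h v v := hs'
        change h _ _ = 0
        rw [key, div_mul_cancel₀ s hv', hs'', add_neg_cancel]
    rw [← Set.ncard_image_of_injective _ (f := fun t => t / σ (h p v))
      fun a b hab => (div_left_inj' hv').1 hab, ← this]
    rfl

variable {hσ : ∀ a, σ (σ a) = a} {hσ1 : σ ≠ RingHom.id F}
  {h : V →ₛₗ[σ] V →ₗ[F] F} {hs : h.IsSymm}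

@[simp]
theorem hermitianPolarForm_lineCount :
    (hermitianPolarForm hσ hσ1 h hs).lineCount = fixedCard σ := rfl

theorem mem_vectors_hermitian (v : V) :
    v ∈ vectors {x : ℙ F V | h x.rep x.rep = 0} ↔
      v ≠ 0 ∧ (hermitianPolarForm hσ hσ1 h hs).IsSingular v := by
  have key : ∀ hv : v ≠ 0, h (Projectivization.mk F v hv).rep (Projectivization.mk F v hv).rep = 0 ↔
      h v v = 0 := fun hv => by
    obtain ⟨a, ha⟩ := Projectivization.exists_smul_eq_mk_rep F v hv
    rw [← ha, Units.smul_def]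
    simp
  constructor
  · rintro ⟨hv, h⟩
    exact ⟨hv, (key hv).1 h⟩
  · rintro ⟨hv, h⟩
    exact ⟨hv, (key hv).2 h⟩

theorem isNondegenerate_hermitianPolarForm (hn : h.Nondegenerate) :
    (hermitianPolarForm hσ hσ1 h hs).IsNondegenerate := fun v _ hv =>
  hn.1 v fun y => congrArg (fun f : Module.Dual F V => f y) hv

/-- An anisotropic space for a Hermitian form over a finite field has dimension at most one. -/
theorem finrank_le_one_of_anisotropic (hσ : ∀ a, σ (σ a) = a) (hσ1 : σ ≠ RingHom.id F)
    (hs : h.IsSymm) [Finite V] {U : Submodule F V}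
    (hU : ∀ u ∈ U, h u u = 0 → u = 0) : Module.finrank F U ≤ 1 := by
  by_contra! hlt
  obtain ⟨x, hx⟩ := exists_linearIndependent_of_le_finrank (R := F) (M := U) (n := 2) hlt
  have hx' : LinearIndependent F ![(x 0), (x 1)] := by
    convert! hx using 1
    ext i
    fin_cases i <;> rfl
  obtain ⟨u, hu⟩ : ∃ u, u = (x 0 : V) := ⟨_, rfl⟩
  obtain ⟨w, hw⟩ : ∃ w, w = (x 1 : V) := ⟨_, rfl⟩
  have hu0 : u ≠ 0 := fun h0 => hx.ne_zero 0 (Subtype.ext (hu ▸ h0))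
  have huU : u ∈ U := hu ▸ (x 0).2
  have hwU : w ∈ U := hw ▸ (x 1).2
  have huu : h u u ≠ 0 := fun h0 => hu0 (hU u huU h0)
  obtain ⟨y, hy⟩ : ∃ y, y = w - (h u w / h u u) • u := ⟨_, rfl⟩
  have huy : h u y = 0 := by
    rw [hy, map_sub, map_smul, smul_eq_mul, div_mul_cancel₀ _ huu, sub_self]
  have hyu : h y u = 0 := by rw [← hs.eq, huy, map_zero]
  -- This quotient lies in the fixed field, hence is a norm t σ(t); then y + t u is singular for y
  -- orthogonal to u.
  have hfix : σ (-h y y / h u u) = -h y y / h u u := by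
    rw [map_div₀, map_neg, hs.eq, hs.eq]
  obtain ⟨t, ht⟩ := exists_mul_conj_eq hσ hσ1 hfix
  have hzero : h (y + t • u) (y + t • u) = 0 := by
    have : t * σ t * h u u = -h y y := by rw [ht, div_mul_cancel₀ _ huu]
    simp [huy, hyu]
    linear_combination this
  have h0 := hU (y + t • u) (U.add_mem (hy ▸ U.sub_mem hwU (U.smul_mem _ huU)) (U.smul_mem _ huU))
    hzero
  have hlin : (t - h u w / h u u) • x 0 + (1 : F) • x 1 = 0 := by
    apply Subtype.ext
    simp only [Submodule.coe_add, Submodule.coe_smul, ← hu, ← hw, ZeroMemClass.coe_zero]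
    rw [← h0, hy, sub_smul, one_smul]
    abel
  exact one_ne_zero (LinearIndependent.pair_iff.1 hx' _ _ hlin).2

/-- The core has dimension 0 or 1 according to the parity of dim V, which gives the sign. -/
theorem excess_hermitian [Finite V] {β : PolarForm F V} (hσ : ∀ a, σ (σ a) = a)
    (hσ1 : σ ≠ RingHom.id F) (hs : h.IsSymm) (hβ : β.IsNondegenerate)
    (hβs : ∀ v, β.IsSingular v ↔ h v v = 0) (hl : β.lineCount = fixedCard σ) :
    β.excess = (-1) ^ Module.finrank F V * fixedCard σ ^ (Module.finrank F V + 1) *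
      (fixedCard σ - 1) := by
  obtain ⟨j, U, hj, hU, he⟩ := PolarForm.exists_anisotropic_core _ β hβ rfl
  have hU1 := finrank_le_one_of_anisotropic hσ hσ1 hs (U := U)
    fun u hu h => hU u hu ((hβs u).2 h)
  rw [he, hl, hj, card_eq_fixedCard_sq hσ hσ1]
  obtain h0 | h0 : Module.finrank F U = 0 ∨ Module.finrank F U = 1 := by omega
  · rw [h0, pow_add (-1 : ℤ), pow_mul (-1 : ℤ)]
    push_cast
    ring
  · rw [h0, pow_add (-1 : ℤ), pow_mul (-1 : ℤ)]
    push_cast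
    ring

end Hermitian

/-! ### Sizes of hyperplane sections, with y = q ^ k for quadrics and r ^ k (r = √q) for Hermitian
varieties. -/

section Sizes

variable {F : Type u} {V : Type v} [Field F] [Finite F] [AddCommGroup V] [Module F V]

theorem PolarForm.card_mul_kerSum_of_isTangent [Fintype V] (β : PolarForm F V) {S : Set (ℙ F V)}
    (hS : ∀ v, v ∈ vectors S ↔ v ≠ 0 ∧ β.IsSingular v) {φ : Module.Dual F V} (hφ : φ ≠ 0)
    (ht : β.IsTangent φ) :
    Nat.card F * (kerSum (pointIndicator S) φ + 1) =
      β.excess + β.lineCount * Nat.card (LinearMap.ker φ) := by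
  obtain ⟨p, hp, rfl⟩ := ht
  rw [β.card_mul_kerSum_pointIndicator hS, β.excess_restrict_ker_dual hp hφ]

theorem finrank_ker_eq [FiniteDimensional F V] {φ : Module.Dual F V} (hφ : φ ≠ 0) {n : ℕ}
    (hn : Module.finrank F V = n + 1) : Module.finrank F (LinearMap.ker φ) = n := by
  have := Module.Dual.finrank_ker_add_one_of_ne_zero hφ
  omega

variable (F) in
theorem card_ne_zero_int : (Nat.card F : ℤ) ≠ 0 := by
  exact_mod_cast Nat.card_pos.ne'

section Even

variable [Fintype V] {Q : QuadraticForm F V} (hQ : (quadraticPolarForm Q).IsNondegenerate) {k : ℕ}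
  (hk : Module.finrank F V = 2 * (k + 1))

include hQ hk

theorem even_quadric_kerSum_of_not_isTangent {φ : Module.Dual F V}
    (hφt : ¬ (quadraticPolarForm Q).IsTangent φ) :
    kerSum (pointIndicator (quadricPoints Q)) φ = (Nat.card F ^ k) ^ 2 - 1 := by
  have hφ : φ ≠ 0 := fun h => hφt ⟨0, (quadraticPolarForm Q).singular_zero, by simp [h]⟩
  have h := (quadraticPolarForm Q).card_mul_kerSum_pointIndicator (mem_vectors_quadricPoints Q) φ
  have hf := finrank_ker_eq (n := 2 * k + 1) hφ (by omega)
  rw [excess_of_odd (Q := Q.comp (LinearMap.ker φ).subtype)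
    (PolarForm.restrict_ker_isNondegenerate _ hQ hφt) (fun v => Iff.rfl) rfl (hf ▸ ⟨k, rfl⟩),
    Module.natCard_eq_pow_finrank (K := F) (V := LinearMap.ker φ), hf] at h
  refine mul_left_cancel₀ (card_ne_zero_int F) ?_
  push_cast [quadraticPolarForm_lineCount] at h
  linear_combination h

/-- Sizes of an elliptic or hyperbolic quadric and of its tangent hyperplane sections. -/
theorem even_quadric_sizes : ∃ ε : ℤ, (ε = 1 ∨ ε = -1) ∧
    (∀ φ, φ ≠ 0 → (quadraticPolarForm Q).IsTangent φ →
      kerSum (pointIndicator (quadricPoints Q)) φ =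
        (Nat.card F ^ k) ^ 2 - 1 + ε * Nat.card F ^ k * (Nat.card F - 1)) ∧
    ∑ v, pointIndicator (quadricPoints Q) v =
      Nat.card F * (Nat.card F ^ k) ^ 2 - 1 + ε * Nat.card F ^ k * (Nat.card F - 1) := by
  obtain ⟨ε, hε, he⟩ := excess_of_even hQ (fun v => Iff.rfl) rfl hk
  refine ⟨ε, hε, fun φ hφ ht => ?_, ?_⟩
  · have h := (quadraticPolarForm Q).card_mul_kerSum_of_isTangent
      (mem_vectors_quadricPoints Q) hφ ht
    have hf := finrank_ker_eq (n := 2 * k + 1) hφ (by omega)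
    rw [he, Module.natCard_eq_pow_finrank (K := F) (V := LinearMap.ker φ), hf] at h
    refine mul_left_cancel₀ (card_ne_zero_int F) ?_
    push_cast [quadraticPolarForm_lineCount] at h
    linear_combination h
  · have h := (quadraticPolarForm Q).card_mul_sum_pointIndicator (mem_vectors_quadricPoints Q)
    rw [he, Module.natCard_eq_pow_finrank (K := F) (V := V), hk] at h
    refine mul_left_cancel₀ (card_ne_zero_int F) ?_
    push_cast [quadraticPolarForm_lineCount] at h
    linear_combination h

end Even

section Odd

variable [Fintype V] {Q : QuadraticForm F V} (hQ : (quadraticPolarForm Q).IsNondegenerate) {k : ℕ}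
  (hk : Module.finrank F V = 2 * (k + 1) + 1)

include hQ hk

theorem odd_quadric_kerSum_of_isTangent {φ : Module.Dual F V} (hφ : φ ≠ 0)
    (hφt : (quadraticPolarForm Q).IsTangent φ) :
    kerSum (pointIndicator (quadricPoints Q)) φ = Nat.card F * (Nat.card F ^ k) ^ 2 - 1 := by
  have h := (quadraticPolarForm Q).card_mul_kerSum_of_isTangent
    (mem_vectors_quadricPoints Q) hφ hφt
  have hf := finrank_ker_eq (n := 2 * (k + 1)) hφ (by omega)
  rw [excess_of_odd hQ (fun v => Iff.rfl) rfl (hk ▸ ⟨k + 1, rfl⟩),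
    Module.natCard_eq_pow_finrank (K := F) (V := LinearMap.ker φ), hf] at h
  refine mul_left_cancel₀ (card_ne_zero_int F) ?_
  push_cast [quadraticPolarForm_lineCount] at h
  linear_combination h

theorem odd_quadric_kerSum_of_not_isTangent {φ : Module.Dual F V}
    (hφt : ¬ (quadraticPolarForm Q).IsTangent φ) : ∃ ε : ℤ, (ε = 1 ∨ ε = -1) ∧
    kerSum (pointIndicator (quadricPoints Q)) φ =
      Nat.card F * (Nat.card F ^ k) ^ 2 - 1 + ε * Nat.card F ^ k * (Nat.card F - 1) := by
  have hφ : φ ≠ 0 := fun h => hφt ⟨0, (quadraticPolarForm Q).singular_zero, by simp [h]⟩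
  have h := (quadraticPolarForm Q).card_mul_kerSum_pointIndicator (mem_vectors_quadricPoints Q) φ
  have hf := finrank_ker_eq (n := 2 * (k + 1)) hφ (by omega)
  obtain ⟨ε, hε, he⟩ := excess_of_even (Q := Q.comp (LinearMap.ker φ).subtype)
    (PolarForm.restrict_ker_isNondegenerate _ hQ hφt) (fun v => Iff.rfl) rfl hf
  refine ⟨ε, hε, ?_⟩
  rw [he, Module.natCard_eq_pow_finrank (K := F) (V := LinearMap.ker φ), hf] at h
  refine mul_left_cancel₀ (card_ne_zero_int F) ?_
  push_cast [quadraticPolarForm_lineCount] at h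
  linear_combination h

theorem odd_quadric_sum : ∑ v, pointIndicator (quadricPoints Q) v =
    Nat.card F ^ 2 * (Nat.card F ^ k) ^ 2 - 1 := by
  have h := (quadraticPolarForm Q).card_mul_sum_pointIndicator (mem_vectors_quadricPoints Q)
  rw [excess_of_odd hQ (fun v => Iff.rfl) rfl (hk ▸ ⟨k + 1, rfl⟩),
    Module.natCard_eq_pow_finrank (K := F) (V := V), hk] at h
  refine mul_left_cancel₀ (card_ne_zero_int F) ?_
  push_cast [quadraticPolarForm_lineCount] at h
  linear_combination h

end Odd

section Hermitian

variable [Fintype V] {σ : F →+* F} {hσ : ∀ a, σ (σ a) = a} {hσ1 : σ ≠ RingHom.id F}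
  {h : V →ₛₗ[σ] V →ₗ[F] F} {hs : h.IsSymm} (hn : (hermitianPolarForm hσ hσ1 h hs).IsNondegenerate)
  {k : ℕ} (hk : Module.finrank F V = k + 2)

include hn hk

/-- Sizes of the tangent hyperplane sections of a Hermitian variety. -/
theorem hermitian_kerSum_of_isTangent {φ : Module.Dual F V} (hφ : φ ≠ 0)
    (hφt : (hermitianPolarForm hσ hσ1 h hs).IsTangent φ) :
    kerSum (pointIndicator {x : ℙ F V | h x.rep x.rep = 0}) φ =
      fixedCard σ * (fixedCard σ ^ k) ^ 2 - 1 +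
        (-1) ^ k * (fixedCard σ * fixedCard σ ^ k * (fixedCard σ - 1)) := by
  have h1 := (hermitianPolarForm hσ hσ1 h hs).card_mul_kerSum_of_isTangent
    mem_vectors_hermitian hφ hφt
  have hf := finrank_ker_eq (n := k + 1) hφ (by omega)
  rw [excess_hermitian hσ hσ1 hs hn (fun v => Iff.rfl) rfl, hk,
    Module.natCard_eq_pow_finrank (K := F) (V := LinearMap.ker φ), hf] at h1
  refine mul_left_cancel₀ (card_ne_zero_int F) ?_
  rw [card_eq_fixedCard_sq hσ hσ1] at h1 ⊢
  push_cast [hermitianPolarForm_lineCount] at h1 ⊢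
  linear_combination h1

/-- Sizes of the non-tangent hyperplane sections of a Hermitian variety. -/
theorem hermitian_kerSum_of_not_isTangent {φ : Module.Dual F V}
    (hφt : ¬ (hermitianPolarForm hσ hσ1 h hs).IsTangent φ) :
    kerSum (pointIndicator {x : ℙ F V | h x.rep x.rep = 0}) φ =
      fixedCard σ * (fixedCard σ ^ k) ^ 2 - 1 -
        (-1) ^ k * (fixedCard σ ^ k * (fixedCard σ - 1)) := by
  have hφ : φ ≠ 0 := fun h' => hφt ⟨0, (hermitianPolarForm hσ hσ1 h hs).singular_zero, by simp [h']⟩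
  have h1 := (hermitianPolarForm hσ hσ1 h hs).card_mul_kerSum_pointIndicator
    mem_vectors_hermitian φ
  have hf := finrank_ker_eq (n := k + 1) hφ (by omega)
  rw [excess_hermitian (h := h.domRestrict₁₂ (LinearMap.ker φ) (LinearMap.ker φ)) hσ hσ1
    ⟨fun x y => hs.eq x y⟩
    (PolarForm.restrict_ker_isNondegenerate _ hn hφt) (fun v => Iff.rfl) rfl,
    Module.natCard_eq_pow_finrank (K := F) (V := LinearMap.ker φ), hf] at h1
  refine mul_left_cancel₀ (card_ne_zero_int F) ?_
  rw [card_eq_fixedCard_sq hσ hσ1] at h1 ⊢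
  push_cast [hermitianPolarForm_lineCount] at h1 ⊢
  linear_combination h1

end Hermitian

end Sizes

/-! ### The change of hyperplane sums under switching. -/

section Switching

variable {F : Type u} {V : Type v} [Field F] [Fintype F] [AddCommGroup V] [Module F V] [Fintype V]
  [Fintype (Module.Dual F V)]

theorem card_dual : Fintype.card (Module.Dual F V) = Fintype.card V := by
  rw [← Nat.card_eq_fintype_card, ← Nat.card_eq_fintype_card,
    Module.natCard_eq_pow_finrank (K := F) (V := V),
    Module.natCard_eq_pow_finrank (K := F) (V := Module.Dual F V), Subspace.dual_finrank_eq]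

open Classical in
theorem sum_mem_span_singleton {ψ : Module.Dual F V} (hψ : ψ ≠ 0) (c : ℤ) :
    ∑ φ : Module.Dual F V, (if φ ∈ F ∙ ψ then c else 0) = Fintype.card F * c := by
  have : (Finset.univ.filter fun φ : Module.Dual F V => φ ∈ F ∙ ψ).card = Fintype.card F := by
    have h := Module.natCard_eq_pow_finrank (K := F) (V := F ∙ ψ)
    rw [finrank_span_singleton hψ, pow_one, Nat.card_eq_fintype_card (α := F)] at h
    rw [← h]
    exact (Nat.subtype_card _ fun φ => by simp).symm
  rw [← Finset.sum_filter, Finset.sum_const, this, nsmul_eq_mul]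

theorem kerSum_of_mem_span {f : V → ℤ} {ψ : Module.Dual F V} (hf : ∀ v, ψ v ≠ 0 → f v = 0)
    {φ : Module.Dual F V} (hφ : φ ∈ F ∙ ψ) : kerSum f φ = ∑ v, f v := by
  obtain ⟨t, rfl⟩ := Submodule.mem_span_singleton.1 hφ
  rw [← zero_add (t • ψ), kerSum_add_smul hf, kerSum_zero_right]

open Classical in
/-- The first two moments of a point function supported on the hyperplane `ker ψ` and having two
sums over the other hyperplanes. -/
theorem two_value_moments {f : V → ℤ} (hf : IsPointFunction F f) {ψ : Module.Dual F V}
    (hψ : ψ ≠ 0) (hsupp : ∀ v, ψ v ≠ 0 → f v = 0) {a c : ℤ}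
    (h : ∀ φ, φ ∉ F ∙ ψ → kerSum f φ = a ∨ kerSum f φ = a + c) {N : ℤ}
    (hN : N = (Finset.univ.filter fun φ => φ ∉ F ∙ ψ ∧ kerSum f φ ≠ a).card) :
    (Fintype.card F : ℤ) * (Fintype.card F * (∑ v, f v - a) + Fintype.card V * a + c * N) =
      Fintype.card V * ∑ v, f v ∧
    (Fintype.card F : ℤ) ^ 2 * (Fintype.card F * ((∑ v, f v) ^ 2 - a ^ 2) + Fintype.card V * a ^ 2 +
      ((a + c) ^ 2 - a ^ 2) * N) =
      Fintype.card V * ((∑ v, f v) ^ 2 + (Fintype.card F - 1) ^ 2 * ∑ v, f v ^ 2) := by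
  -- The q multiples of ψ all see the total sum of f; among the other functionals, N see a + c and
  -- the rest a.
  have key : ∀ g : ℤ → ℤ, ∑ φ : Module.Dual F V, g (kerSum f φ) =
      Fintype.card F * (g (∑ v, f v) - g a) + Fintype.card V * g a + (g (a + c) - g a) * N :=
    fun g => by
    have : ∀ φ, g (kerSum f φ) = (if φ ∈ F ∙ ψ then g (∑ v, f v) - g a else 0) + g a +
        (g (a + c) - g a) * (if φ ∉ F ∙ ψ ∧ kerSum f φ ≠ a then 1 else 0) := fun φ => by
      by_cases hφ : φ ∈ F ∙ ψ
      · rw [if_pos hφ, if_neg (fun h => h.1 hφ), kerSum_of_mem_span hsupp hφ]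
        ring
      · rw [if_neg hφ]
        by_cases hc : kerSum f φ = a
        · rw [if_neg (fun h => h.2 hc), hc]
          ring
        · rw [if_pos ⟨hφ, hc⟩, (h φ hφ).resolve_left hc]
          ring
    rw [Finset.sum_congr rfl fun φ _ => this φ, Finset.sum_add_distrib, Finset.sum_add_distrib,
      sum_mem_span_singleton hψ, ← Finset.mul_sum, Finset.sum_boole, Finset.sum_const,
      Finset.card_univ, card_dual, nsmul_eq_mul, hN]
  constructor
  · rw [← card_mul_sum_kerSum hf, key fun x => x, add_sub_cancel_left]
  · rw [← card_sq_mul_sum_kerSum_sq hf, key fun x => x ^ 2]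

variable {P P' : Set (ℙ F V)} {ψ : Module.Dual F V}

/-- The change of the hyperplane sum over `ker φ` when `P` is replaced by `P'`. -/
noncomputable def change (P P' : Set (ℙ F V)) (φ : Module.Dual F V) : ℤ :=
  kerSum (pointIndicator P') φ - kerSum (pointIndicator P) φ

theorem change_eq (φ : Module.Dual F V) :
    change P P' φ = kerSum (pointIndicator P' - pointIndicator P) φ :=
  (kerSum_sub _ _ _).symm

variable (F) in
theorem isPointFunction_sub (P P' : Set (ℙ F V)) :
    IsPointFunction F (pointIndicator P' - pointIndicator P) :=
  (isPointFunction_pointIndicator P').sub (isPointFunction_pointIndicator P)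

theorem eq_of_pointIndicator_eq (h : ∀ v, pointIndicator P' v = pointIndicator P v) : P' = P := by
  refine vectors_inj (Set.ext fun v => ?_)
  have := h v
  unfold pointIndicator at this
  split_ifs at this <;> tauto

theorem eq_of_change_eq_zero (h : ∀ φ, change P P' φ = 0) : P' = P := by
  refine eq_of_pointIndicator_eq fun v => sub_eq_zero.1 ?_
  exact congrFun (eq_zero_of_kerSum_eq_zero (isPointFunction_sub F P P')
    fun φ => by rw [← change_eq, h φ]) v

variable (hsw : ∀ v, ψ v ≠ 0 → pointIndicator P' v = pointIndicator P v)

include hsw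

theorem change_add_smul (φ : Module.Dual F V) (t : F) :
    change P P' (φ + t • ψ) = change P P' φ := by
  rw [change_eq, change_eq, kerSum_add_smul]
  exact fun v hv => sub_eq_zero.2 (hsw v hv)

theorem change_zero : change P P' 0 = change P P' ψ := by
  rw [← change_add_smul hsw 0 1, zero_add, one_smul]

theorem change_of_mem_span {φ : Module.Dual F V} (hφ : φ ∈ F ∙ ψ) :
    change P P' φ = change P P' ψ := by
  obtain ⟨t, rfl⟩ := Submodule.mem_span_singleton.1 hφ
  rw [← zero_add (t • ψ), change_add_smul hsw, change_zero hsw]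

theorem sum_sub_eq_change :
    ∑ v, (pointIndicator P' - pointIndicator P) v = change P P' ψ := by
  rw [← change_zero hsw, change_eq, kerSum_zero_right]

theorem sum_pointIndicator_eq_add_change :
    ∑ v, pointIndicator P' v = ∑ v, pointIndicator P v + change P P' ψ := by
  rw [← sum_sub_eq_change hsw, ← Finset.sum_add_distrib]
  simp

/-- If the change is constant on the hyperplanes other than `ker ψ`, then nothing changes unless
`ker ψ` is contained in or disjoint from `P`. -/
theorem eq_or_of_change_eq_const (hψ : ψ ≠ 0) {κ : ℤ}
    (h : ∀ φ, φ ∉ F ∙ ψ → change P P' φ = κ) :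
    P' = P ∨ (∀ v, v ≠ 0 → ψ v = 0 → v ∈ vectors P) ∨
      (∀ v, v ≠ 0 → ψ v = 0 → v ∉ vectors P) := by
  classical
  have key : ∀ u, u ≠ 0 → ψ u = 0 →
      (Fintype.card F : ℤ) ^ 2 * (Fintype.card F * (change P P' ψ - κ)) +
        Fintype.card F * (Fintype.card V * κ) =
      Fintype.card V * (change P P' ψ +
        (Fintype.card F - 1) ^ 2 * (pointIndicator P' - pointIndicator P) u) := fun u hu hψu => by
    rw [← sum_sub_eq_change hsw, ← card_sq_mul_sum_kerSum_vanish (isPointFunction_sub F P P') hu,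
      ← card_mul_sum_vanish (F := F) hu, sum_sub_eq_change hsw,
      ← sum_mem_span_singleton hψ (change P P' ψ - κ)]
    have : ∀ φ : Module.Dual F V,
        (if φ u = 0 then kerSum (pointIndicator P' - pointIndicator P) φ else 0) =
          (if φ ∈ F ∙ ψ then change P P' ψ - κ else 0) + (if φ u = 0 then 1 else 0) * κ :=
      fun φ => by
        rw [← change_eq]
        by_cases hφ : φ ∈ F ∙ ψ
        · have h0 : φ u = 0 := by
            obtain ⟨t, rfl⟩ := Submodule.mem_span_singleton.1 hφ
            simp [hψu]
          rw [if_pos h0, if_pos hφ, if_pos h0, change_of_mem_span hsw hφ]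
          ring
        · rw [if_neg hφ, h φ hφ]
          split_ifs <;> ring
    rw [Finset.sum_congr rfl fun φ _ => this φ, Finset.sum_add_distrib, ← Finset.sum_mul]
    ring
  by_cases hu : ∃ u, u ≠ 0 ∧ ψ u = 0 ∧ pointIndicator P' u ≠ pointIndicator P u
  · right
    obtain ⟨u, hu0, hψu, hne⟩ := hu
    -- The sum of the changes over the hyperplanes through a point of ker ψ does not depend on the
    -- point, so neither does the difference of indicators. If nonzero, it is -1 (every point was in
    -- P) or +1 (none was).
    have hconst : ∀ v, v ≠ 0 → ψ v = 0 → pointIndicator P' v - pointIndicator P v =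
        pointIndicator P' u - pointIndicator P u := fun v hv0 hψv => by
      have e := (key v hv0 hψv).symm.trans (key u hu0 hψu)
      have hV : (Fintype.card V : ℤ) ≠ 0 := by exact_mod_cast Fintype.card_ne_zero
      have hF : (Fintype.card F - 1 : ℤ) ≠ 0 := by
        have : 1 < Fintype.card F := Fintype.one_lt_card
        omega
      exact mul_left_cancel₀ (pow_ne_zero 2 hF) (add_left_cancel (mul_left_cancel₀ hV e))
    by_cases huP : u ∈ vectors P
    · left
      intro v hv0 hψv
      by_contra hvP
      have := hconst v hv0 hψv
      unfold pointIndicator at this hne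
      rw [if_pos huP, if_neg hvP] at this
      rw [if_pos huP] at hne
      split_ifs at this hne <;> omega
    · right
      intro v hv0 hψv hvP
      have := hconst v hv0 hψv
      unfold pointIndicator at this hne
      rw [if_neg huP, if_pos hvP] at this
      rw [if_neg huP] at hne
      split_ifs at this hne <;> omega
  · left
    push Not at hu
    refine eq_of_pointIndicator_eq fun v => ?_
    by_cases hv0 : v = 0
    · rw [hv0, (isPointFunction_pointIndicator P).map_zero,
        (isPointFunction_pointIndicator P').map_zero]
    · by_cases hψv : ψ v = 0
      · exact hu v hv0 hψv
      · exact hsw v hψv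

open Classical in
/-- Counting the hyperplanes at which the change takes the exceptional value `κ + E`. -/
theorem card_mul_change_eq (hψ : ψ ≠ 0) {κ E : ℤ}
    (h : ∀ φ, φ ∉ F ∙ ψ → change P P' φ = κ ∨ change P P' φ = κ + E) :
    (Fintype.card F : ℤ) * (Fintype.card F * (change P P' ψ - κ) + Fintype.card V * κ +
      E * (Finset.univ.filter fun φ => φ ∉ F ∙ ψ ∧ change P P' φ ≠ κ).card) =
      Fintype.card V * change P P' ψ := by
  have := (two_value_moments (isPointFunction_sub F P P') hψ
    (fun v hv => sub_eq_zero.2 (hsw v hv)) (fun φ hφ => change_eq (P := P) φ ▸ h φ hφ) rfl).1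
  rw [sum_sub_eq_change hsw] at this
  simpa only [← change_eq] using this

end Switching

/-! ### Switching in elliptic and hyperbolic quadrics. -/

section EvenQuadric

/-- After substitution the equation reads E = 2 + (q - 3) y², so y divides 2, contrary to y ≥ 3. It
rules out a set P' with the section sizes of P and total size larger by E. -/
theorem even_quadric_arith {q y ε a : ℤ} (hq : 3 ≤ q) (hy : q ≤ y) (hε : ε = 1 ∨ ε = -1)
    (ha : a = y ^ 2 - 1) {E s : ℤ} (hE : E = ε * y * (q - 1)) (hs : s = q * y ^ 2 - 1 + E + E) :
    (s - a) * (s - (a + E)) ≠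
      y ^ 2 * (s ^ 2 + (q - 1) ^ 2 * s) - (a + (a + E)) * (q * y ^ 2 * s) +
        q ^ 2 * y ^ 2 * (a * (a + E)) := by
  intro h
  have hE2 : E ^ 2 = y ^ 2 * (q - 1) ^ 2 := by
    rcases hε with rfl | rfl <;> rw [hE] <;> ring
  have h1 : y ^ 2 * (q - 1) ^ 2 * (E - 2 - (q - 3) * y ^ 2) = 0 := by
    subst hs ha
    linear_combination -h + (2 * y ^ 2 * q - 4 * y ^ 2 + 2) * hE2
  have hy0 : y ≠ 0 := by omega
  have hq0 : q - 1 ≠ 0 := by omega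
  have h2 := (mul_eq_zero.1 h1).resolve_left (mul_ne_zero (pow_ne_zero 2 hy0) (pow_ne_zero 2 hq0))
  have h3 : y ∣ 2 := ⟨ε * (q - 1) - (q - 3) * y, by rw [hE] at h2; linear_combination -h2⟩
  have := Int.le_of_dvd (by norm_num) h3
  omega

variable {F : Type u} {V : Type v} [Field F] [Fintype F] [AddCommGroup V] [Module F V] [Fintype V]
  [Fintype (Module.Dual F V)] {P P' : Set (ℙ F V)} {ψ : Module.Dual F V}

open Classical in
-- Sum over all φ the number of tangent members of its pencil: each tangent functional is counted q
-- times, each φ contributes at most 2, and those in X contribute nothing.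
theorem two_mul_card_le {T : Module.Dual F V → Prop}
    (hT : ∀ φ, {t : F | T (φ + t • ψ)}.ncard ≤ 2) {X : Finset (Module.Dual F V)}
    (hX : ∀ φ ∈ X, ∀ t : F, ¬ T (φ + t • ψ)) :
    Fintype.card F * {φ | T φ}.ncard + 2 * X.card ≤ 2 * Fintype.card V := by
  have h1 : ∑ φ, {t : F | T (φ + t • ψ)}.ncard = Fintype.card F * {φ | T φ}.ncard := by
    have h2 : ∀ φ, {t : F | T (φ + t • ψ)}.ncard = ∑ t : F, if T (φ + t • ψ) then 1 else 0 :=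
      fun φ => by
        rw [Set.ncard_eq_toFinset_card', Set.toFinset_ofPred, Finset.card_filter]
    have h3 : ∀ t : F, (∑ φ, if T (φ + t • ψ) then 1 else 0) = {φ | T φ}.ncard := fun t => by
      rw [Set.ncard_eq_toFinset_card', Set.toFinset_ofPred, Finset.card_filter]
      exact Fintype.sum_equiv (Equiv.addRight (t • ψ)) _ _ fun φ => rfl
    rw [Finset.sum_congr rfl fun φ _ => h2 φ, Finset.sum_comm, Finset.sum_congr rfl fun t _ => h3 t]
    simp
  have h4 : ∑ φ, ({t : F | T (φ + t • ψ)}.ncard + if φ ∈ X then 2 else 0) ≤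
      ∑ _φ : Module.Dual F V, 2 := Finset.sum_le_sum fun φ _ => by
    split_ifs with h
    · have : {t : F | T (φ + t • ψ)} = ∅ := by
        ext t
        simpa using hX φ h t
      simp [this]
    · simpa using hT φ
  rw [Finset.sum_add_distrib, h1, Finset.sum_ite_mem, Finset.univ_inter, Finset.sum_const,
    Finset.sum_const, Finset.card_univ, card_dual, smul_eq_mul, smul_eq_mul] at h4
  omega

/-- In the sum of (kerSum - a)(kerSum - b) over all functionals only φ = 0 survives; expanding the
product turns it into the first two moments. -/
theorem kerSum_quadratic_identity {f : V → ℤ} (hf : IsPointFunction F f) (hf2 : ∀ v, f v ^ 2 = f v)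
    {q y a b : ℤ} (hq : (Fintype.card F : ℤ) = q) (hV : (Fintype.card V : ℤ) = q ^ 2 * y)
    (h : ∀ φ : Module.Dual F V, φ ≠ 0 → (kerSum f φ - a) * (kerSum f φ - b) = 0) :
    (∑ v, f v - a) * (∑ v, f v - b) =
      y * ((∑ v, f v) ^ 2 + (q - 1) ^ 2 * ∑ v, f v) - (a + b) * (q * y * ∑ v, f v) +
        q ^ 2 * y * (a * b) := by
  classical
  have hq0 : q ≠ 0 := by
    rw [← hq]
    exact_mod_cast Fintype.card_ne_zero
  have h1 := card_mul_sum_kerSum hf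
  have h2 := card_sq_mul_sum_kerSum_sq hf
  simp only [hf2] at h2
  rw [hq, hV] at h1 h2
  have e1 : ∑ φ : Module.Dual F V, kerSum f φ = q * y * ∑ v, f v :=
    mul_left_cancel₀ hq0 (by linear_combination h1)
  have e2 : ∑ φ : Module.Dual F V, kerSum f φ ^ 2 = y * ((∑ v, f v) ^ 2 + (q - 1) ^ 2 * ∑ v, f v) :=
    mul_left_cancel₀ (pow_ne_zero 2 hq0) (by linear_combination h2)
  have e3 : ∑ φ : Module.Dual F V, (kerSum f φ - a) * (kerSum f φ - b) =
      (∑ v, f v - a) * (∑ v, f v - b) := by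
    rw [Finset.sum_eq_single 0 (fun φ _ hφ => h φ hφ) (by simp), kerSum_zero_right]
  have e4 : ∑ φ : Module.Dual F V, (kerSum f φ - a) * (kerSum f φ - b) =
      ∑ φ : Module.Dual F V, kerSum f φ ^ 2 - (a + b) * ∑ φ : Module.Dual F V, kerSum f φ +
        Fintype.card V * (a * b) := by
    rw [← card_dual (F := F), Finset.mul_sum, ← Finset.sum_sub_distrib, ← nsmul_eq_mul,
      ← Finset.card_univ, ← Finset.sum_const, ← Finset.sum_add_distrib]
    exact Finset.sum_congr rfl fun φ _ => by ring
  rw [← e3, e4, e1, e2, hV]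

/-- Switching in a non-tangent hyperplane of an elliptic or hyperbolic quadric. -/
theorem eq_of_even_quadric (hsw : ∀ v, ψ v ≠ 0 → pointIndicator P' v = pointIndicator P v)
    (hψ : ψ ≠ 0) {T : Module.Dual F V → Prop} (hψT : ¬ T ψ)
    (hT : ∀ φ, {t : F | T (φ + t • ψ)}.ncard ≤ 2) {q y ε b : ℤ}
    (hTc : ({φ | T φ}.ncard : ℤ) = q * y ^ 2 + ε * y * (q - 1))
    (hq : (Fintype.card F : ℤ) = q) (hq3 : 3 ≤ q) (hy : q ≤ y) (hε : ε = 1 ∨ ε = -1)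
    (hV : (Fintype.card V : ℤ) = q ^ 2 * y ^ 2)
    (hPt : ∀ φ, φ ≠ 0 → T φ → kerSum (pointIndicator P) φ = y ^ 2 - 1 + ε * y * (q - 1))
    (hPn : ∀ φ, ¬ T φ → kerSum (pointIndicator P) φ = y ^ 2 - 1)
    (hs : ∑ v, pointIndicator P v = q * y ^ 2 - 1 + ε * y * (q - 1))
    (hP' : ∀ φ : Module.Dual F V, φ ≠ 0 → kerSum (pointIndicator P') φ = b ∨
      kerSum (pointIndicator P') φ = b + ε * y * (q - 1))
    (hb : b = y ^ 2 - 1 ∨ y * (q - 1) ≤ |b - (y ^ 2 - 1)|) : P' = P := by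
  classical
  obtain ⟨E, hE⟩ : ∃ E, E = ε * y * (q - 1) := ⟨_, rfl⟩
  obtain ⟨κ, hκ⟩ : ∃ κ, κ = b - (y ^ 2 - 1) := ⟨_, rfl⟩
  rw [← hE] at hTc hPt hs hP'
  rw [← hκ] at hb
  have hyq : 0 < y * (q - 1) := mul_pos (by omega) (by omega)
  have hE0 : E ≠ 0 := by
    rcases hε with rfl | rfl <;> rw [hE] <;> intro h <;> linarith
  have habs : |E| = y * (q - 1) := by
    rcases hε with rfl | rfl
    · rw [hE, one_mul, abs_of_pos hyq]
    · rw [hE, neg_one_mul, neg_mul, abs_neg, abs_of_pos hyq]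
  have hcn : ∀ φ, φ ≠ 0 → ¬ T φ → change P P' φ = κ ∨ change P P' φ = κ + E := fun φ hφ hTφ => by
    unfold change
    rw [hPn φ hTφ]
    rcases hP' φ hφ with h | h <;> rw [h]
    · left; omega
    · right; omega
  have hline : ∀ φ, φ ∉ F ∙ ψ → ∀ t : F, φ + t • ψ ≠ 0 := fun φ hφ t h0 =>
    hφ (Submodule.mem_span_singleton.2 ⟨-t, by rw [neg_smul]; exact (eq_neg_of_add_eq_zero_left h0).symm⟩)
  have hnt : ∀ φ, ∃ t : F, ¬ T (φ + t • ψ) := fun φ => by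
    by_contra! h
    have h1 : {t : F | T (φ + t • ψ)} = Set.univ := Set.eq_univ_of_forall h
    have h2 := hT φ
    rw [h1, Set.ncard_univ, Nat.card_eq_fintype_card] at h2
    omega
  -- A tangent member allows the changes κ - E and κ, a non-tangent one κ and κ + E; the pencil has
  -- a single change, hence κ.
  have hct : ∀ φ, φ ∉ F ∙ ψ → ∀ t : F, T (φ + t • ψ) → change P P' φ = κ := fun φ hφ t ht => by
    obtain ⟨t', ht'⟩ := hnt φ
    have e1 := change_add_smul hsw φ t
    have e2 := change_add_smul hsw φ t'
    unfold change at e1 e2 ⊢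
    rw [hPt _ (hline φ hφ t) ht] at e1
    rw [hPn _ ht'] at e2
    rcases hP' _ (hline φ hφ t) with h | h <;> rcases hP' _ (hline φ hφ t') with h' | h' <;>
      rw [h] at e1 <;> rw [h'] at e2 <;> omega
  have hc : ∀ φ, φ ∉ F ∙ ψ → change P P' φ = κ ∨ change P P' φ = κ + E := fun φ hφ => by
    obtain ⟨t, ht⟩ := hnt φ
    rw [← change_add_smul hsw φ t]
    exact hcn _ (hline φ hφ t) ht
  have hcount := card_mul_change_eq hsw hψ hc
  have hXle := two_mul_card_le (ψ := ψ) hT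
    (X := Finset.univ.filter fun φ => φ ∉ F ∙ ψ ∧ change P P' φ ≠ κ) fun φ hφ t ht => by
      simp only [Finset.mem_filter, Finset.mem_univ, true_and] at hφ
      exact hφ.2 (hct φ hφ.1 t ht)
  have hXmem : ∀ φ, φ ∉ F ∙ ψ → change P P' φ ≠ κ →
      φ ∈ Finset.univ.filter fun φ => φ ∉ F ∙ ψ ∧ change P P' φ ≠ κ := fun φ h1 h2 => by
    simp [h1, h2]
  generalize Finset.univ.filter (fun φ => φ ∉ F ∙ ψ ∧ change P P' φ ≠ κ) = X at hcount hXle hXmem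
  zify at hXle
  rw [hq, hV] at hcount
  rw [hq, hV, hTc] at hXle
  have hq0 : q ≠ 0 := by omega
  have hcount' : q * (change P P' ψ - κ) + q ^ 2 * y ^ 2 * κ + E * X.card =
      q * y ^ 2 * change P P' ψ := mul_left_cancel₀ hq0 (by linear_combination hcount)
  have hEle : -E ≤ y * (q - 1) := habs ▸ neg_le_abs E
  -- Exceptional pencils contain no tangent functional, so the number of tangents bounds |X|; the
  -- margin is q y ((q - 2) y - (q - 1)) > 0.
  have hX : (X.card : ℤ) < q ^ 2 * y ^ 2 - q * y ^ 2 := by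
    have h1 : 0 < y * ((q - 2) * y - (q - 1)) := by
      refine mul_pos (by omega) ?_
      nlinarith [mul_nonneg (by omega : 0 ≤ q - 2) (by omega : 0 ≤ y - 3)]
    have h2 : q * -E ≤ q * (y * (q - 1)) := mul_le_mul_of_nonneg_left hEle (by omega)
    nlinarith [mul_pos (by omega : 0 < q) h1]
  have hX0 : (0 : ℤ) ≤ X.card := Int.natCast_nonneg _
  -- The hypothesis gives |κ| < |E| = y (q - 1), and `hb` leaves no such κ except 0.
  have hcontra : ∀ Z : ℤ, |Z| < q ^ 2 * y ^ 2 - q * y ^ 2 →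
      κ * (q ^ 2 * y ^ 2 - q * y ^ 2) = E * Z → κ = 0 := fun Z hZ h => by
    rcases hb with hb | hb
    · rw [hκ, hb, sub_self]
    · exfalso
      have h1 := congrArg abs h
      have hpos : 0 < q ^ 2 * y ^ 2 - q * y ^ 2 := lt_of_le_of_lt (abs_nonneg Z) hZ
      rw [abs_mul, abs_mul, abs_of_pos hpos, habs] at h1
      have h2 := mul_le_mul_of_nonneg_right hb hpos.le
      have h3 := mul_lt_mul_of_pos_left hZ hyq
      linarith
  rcases hcn ψ hψ hψT with hψc | hψc <;> rw [hψc] at hcount'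
  · have h0 : κ = 0 := hcontra (-X.card) (by rw [abs_neg, abs_of_nonneg hX0]; exact hX)
      (by linear_combination hcount')
    rw [h0] at hcount'
    have hXz : X.card = 0 := by
      have : E * (X.card : ℤ) = 0 := by linear_combination hcount'
      exact_mod_cast (mul_eq_zero.1 this).resolve_left hE0
    refine eq_of_change_eq_zero fun φ => ?_
    by_cases hφ : φ ∈ F ∙ ψ
    · rw [change_of_mem_span hsw hφ, hψc, h0]
    · by_contra hne
      have := hXmem φ hφ (by rwa [h0])
      rw [Finset.card_eq_zero.1 hXz] at this
      exact absurd this (Finset.notMem_empty φ)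
  -- Here ker ψ itself has the change κ + E. Once κ = 0, P' has the section sizes of P but E more
  -- vectors.
  · exfalso
    have h0 : κ = 0 := hcontra (q * y ^ 2 - q - X.card) (by
      have h1 : q * y ^ 2 * 2 ≤ q * y ^ 2 * q :=
        mul_le_mul_of_nonneg_left (by omega) (by positivity)
      have h2 : q ≤ q * y ^ 2 := le_mul_of_one_le_right (by omega) (by nlinarith)
      rw [abs_lt]
      constructor
      · linarith
      · nlinarith) (by linear_combination hcount')
    have hid := kerSum_quadratic_identity (isPointFunction_pointIndicator P')
      (pointIndicator_sq P') (a := b) (b := b + E) hq hV fun φ hφ => by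
        rcases hP' φ hφ with h | h <;> rw [h] <;> ring
    have hsum := sum_pointIndicator_eq_add_change hsw
    rw [hψc, h0, hs, zero_add] at hsum
    rw [hsum] at hid
    exact even_quadric_arith hq3 hy hε (by omega) hE rfl hid

end EvenQuadric

/-! ### Switching when every pencil is mixed. -/

section HermitianSwitching

variable {F : Type u} {V : Type v} [Field F] [Fintype F] [AddCommGroup V] [Module F V] [Fintype V]
  [Fintype (Module.Dual F V)] {P P' : Set (ℙ F V)} {ψ : Module.Dual F V}

theorem add_smul_ne_zero_of_notMem_span {φ : Module.Dual F V} (hφ : φ ∉ F ∙ ψ) (t : F) :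
    φ + t • ψ ≠ 0 := fun h0 =>
  hφ (Submodule.mem_span_singleton.2
    ⟨-t, by rw [neg_smul]; exact (eq_neg_of_add_eq_zero_left h0).symm⟩)

/-- Switching in a non-tangent hyperplane of a Hermitian variety. -/
theorem eq_of_forall_pencil (hsw : ∀ v, ψ v ≠ 0 → pointIndicator P' v = pointIndicator P v)
    (hψ : ψ ≠ 0) {T : Module.Dual F V → Prop}
    (hT : ∀ φ, φ ∉ F ∙ ψ → (∃ t : F, T (φ + t • ψ)) ∧ ∃ t : F, ¬ T (φ + t • ψ)) {a b : ℤ}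
    (hPt : ∀ φ, φ ≠ 0 → T φ → kerSum (pointIndicator P) φ = a)
    (hPn : ∀ φ, φ ≠ 0 → ¬ T φ → kerSum (pointIndicator P) φ = b) {Z : Set ℤ}
    (hZ : ∀ x ∈ Z, ∀ y ∈ Z, ∀ x' ∈ Z, ∀ y' ∈ Z, x - y = a - b → x' - y' = a - b → x = x')
    (hP' : ∀ φ : Module.Dual F V, φ ≠ 0 → kerSum (pointIndicator P') φ ∈ Z)
    (h0 : kerSum (pointIndicator P) ψ ≠ 0)
    (h1 : kerSum (pointIndicator P) ψ + 1 ≠ Nat.card (LinearMap.ker ψ)) : P' = P := by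
  -- A tangent and a non-tangent member undergo the same change, so P' has two allowed sizes x and y
  -- differing by a - b; `hZ` says that this determines x.
  have key : ∀ φ, φ ∉ F ∙ ψ → ∃ x ∈ Z, ∃ y ∈ Z, x - y = a - b ∧ change P P' φ = x - a :=
    fun φ hφ => by
      obtain ⟨⟨t, ht⟩, t', ht'⟩ := hT φ hφ
      have e1 := change_add_smul hsw φ t
      have e2 := change_add_smul hsw φ t'
      have hn1 := add_smul_ne_zero_of_notMem_span hφ t
      have hn2 := add_smul_ne_zero_of_notMem_span hφ t'
      refine ⟨_, hP' _ hn1, _, hP' _ hn2, ?_, ?_⟩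
      · unfold change at e1 e2
        rw [hPt _ hn1 ht] at e1
        rw [hPn _ hn2 ht'] at e2
        linear_combination e1 - e2
      · rw [← e1, change, hPt _ hn1 ht]
  have hconst : ∃ κ, ∀ φ, φ ∉ F ∙ ψ → change P P' φ = κ := by
    by_cases hex : ∃ φ, φ ∉ F ∙ ψ
    · obtain ⟨φ₀, hφ₀⟩ := hex
      refine ⟨change P P' φ₀, fun φ hφ => ?_⟩
      obtain ⟨x, hx, y, hy, hxy, e⟩ := key φ hφ
      obtain ⟨x', hx', y', hy', hxy', e'⟩ := key φ₀ hφ₀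
      rw [e, e', hZ x hx y hy x' hx' y' hy' hxy hxy']
    · exact ⟨0, fun φ hφ => absurd ⟨φ, hφ⟩ hex⟩
  obtain ⟨κ, hκ⟩ := hconst
  rcases eq_or_of_change_eq_const hsw hψ hκ with h | h | h
  · exact h
  · refine absurd ?_ h1
    rw [kerSum_pointIndicator_eq_ncard]
    have : (LinearMap.ker ψ : Set V) = insert 0 {v | ψ v = 0 ∧ v ∈ vectors P} := by
      ext v
      by_cases hv : v = 0
      · simp [hv]
      · simpa [hv] using fun hψv => h v hv hψv
    have h' : Nat.card (LinearMap.ker ψ) = (LinearMap.ker ψ : Set V).ncard := rfl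
    rw [h', this, Set.ncard_insert_of_notMem (fun h => zero_notMem_vectors P h.2)]
    push_cast
    rfl
  · refine absurd ?_ h0
    rw [kerSum_pointIndicator_eq_ncard]
    have : {v | ψ v = 0 ∧ v ∈ vectors P} = ∅ := by
      ext v
      simp only [Set.mem_ofPred_eq, Set.mem_empty_iff_false, iff_false]
      exact fun hv => h v hv.2.1 hv.1 hv.2
    rw [this]
    simp

end HermitianSwitching

/-! ### Pencils of hyperplanes of a Hermitian variety. -/

section HermitianPencil

variable {F : Type u} {V : Type v} [Field F] [Finite F] [AddCommGroup V] [Module F V] [Finite V]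
  {σ : F →+* F} {hσ : ∀ a, σ (σ a) = a} {hσ1 : σ ≠ RingHom.id F} {h : V →ₛₗ[σ] V →ₗ[F] F}
  {hs : h.IsSymm}

theorem exists_eq_of_nondegenerate (hn : h.Nondegenerate) (φ : Module.Dual F V) :
    ∃ z, h z = φ := by
  have hinj : Function.Injective (h : V → Module.Dual F V) := by
    intro x y hxy
    rw [← sub_eq_zero]
    refine hn.1 _ fun w => ?_
    rw [map_sub, hxy, sub_self]
    rfl
  have hcard : Nat.card V = Nat.card (Module.Dual F V) := by
    rw [Module.natCard_eq_pow_finrank (K := F) (V := V),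
      Module.natCard_eq_pow_finrank (K := F) (V := Module.Dual F V), Subspace.dual_finrank_eq]
  have : Finite (Module.Dual F V) := Module.finite_of_finite F
  exact ((Nat.bijective_iff_injective_and_card _).2 ⟨hinj, hcard⟩).2 φ

theorem isTangent_hermitian_iff (hn : h.Nondegenerate) (z : V) :
    (hermitianPolarForm hσ hσ1 h hs).IsTangent (h z) ↔ h z z = 0 := by
  constructor
  · rintro ⟨p, hp, hd⟩
    have : p = z := by
      rw [← sub_eq_zero]
      refine hn.1 _ fun w => ?_
      have hd' : h p = h z := hd
      rw [map_sub, hd', sub_self]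
      rfl
    exact this ▸ hp
  · exact fun hz => ⟨z, hz, rfl⟩

/-- A pencil of hyperplanes containing a non-tangent hyperplane of a Hermitian variety contains
both tangent and further non-tangent ones. -/
theorem hermitian_pencil (hn : h.Nondegenerate) {ψ : Module.Dual F V}
    (hψ : ¬ (hermitianPolarForm hσ hσ1 h hs).IsTangent ψ) (φ : Module.Dual F V) :
    (∃ t : F, (hermitianPolarForm hσ hσ1 h hs).IsTangent (φ + t • ψ)) ∧
      ∃ t : F, ¬ (hermitianPolarForm hσ hσ1 h hs).IsTangent (φ + t • ψ) := by
  obtain ⟨p, rfl⟩ := exists_eq_of_nondegenerate hn ψ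
  obtain ⟨z, rfl⟩ := exists_eq_of_nondegenerate hn φ
  rw [isTangent_hermitian_iff hn] at hψ
  obtain ⟨y, hy⟩ : ∃ y, y = z - (h p z / h p p) • p := ⟨_, rfl⟩
  have hpy : h p y = 0 := by
    rw [hy, map_sub, map_smul, smul_eq_mul, div_mul_cancel₀ _ hψ, sub_self]
  have hyp : h y p = 0 := by rw [← hs.eq, hpy, map_zero]
  have hz : z = y + (h p z / h p p) • p := by rw [hy, sub_add_cancel]
  -- By semilinearity h z + σ(c) h p = h (z + c p). The shift by h p z / h p p replaces z by its
  -- part y orthogonal to p, and tangency becomes a norm equation in t.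
  have key : ∀ t : F, (hermitianPolarForm hσ hσ1 h hs).IsTangent
      (h z + (σ (t - h p z / h p p)) • h p) ↔ h y y + t * σ t * h p p = 0 := fun t => by
    have : h z + (σ (t - h p z / h p p)) • h p = h (y + t • p) := by
      rw [← h.map_smulₛₗ, ← map_add]
      congr 1
      conv_lhs => rw [hz]
      rw [add_assoc, ← add_smul, ← hz, add_sub_cancel]
    rw [this, isTangent_hermitian_iff hn]
    simp only [map_add, LinearMap.map_smulₛₗ, LinearMap.add_apply, LinearMap.smul_apply, hpy, hyp,
      smul_eq_mul, RingHom.id_apply]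
    constructor <;> intro e <;> linear_combination e
  constructor
  · have hfix : σ (-h y y / h p p) = -h y y / h p p := by
      rw [map_div₀, map_neg, hs.eq, hs.eq]
    obtain ⟨t, ht⟩ := exists_mul_conj_eq hσ hσ1 hfix
    refine ⟨_, (key t).2 ?_⟩
    rw [ht, div_mul_cancel₀ _ hψ, add_neg_cancel]
  · by_contra! hall
    have e0 := (key 0).1 (hall _)
    have e1 := (key 1).1 (hall _)
    simp only [map_zero, map_one, mul_one, one_mul, zero_mul, mul_zero, add_zero] at e0 e1
    rw [e0, zero_add] at e1
    exact hψ e1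

end HermitianPencil

/-! ### Switching in parabolic quadrics. -/

section ParabolicQuadric

theorem sum_le_add_card {ι : Type*} [Fintype ι] {e : ι → ℤ} (he : ∀ i, e i ≤ 1) (i : ι) :
    ∑ j, e j ≤ e i + (Fintype.card ι - 1) := by
  classical
  rw [← Finset.add_sum_erase _ _ (Finset.mem_univ i)]
  have h := Finset.sum_le_card_nsmul (Finset.univ.erase i) e 1 fun j _ => he j
  rw [Finset.card_erase_of_mem (Finset.mem_univ i), Finset.card_univ, nsmul_eq_mul, mul_one,
    Nat.cast_sub (Fintype.card_pos_iff.2 ⟨i⟩)] at h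
  push_cast at h
  linarith

/-- The sum is one below its maximum, so exactly one entry is 0 and the others are 1. -/
theorem exists_signs_of_sum_eq_card_sub_one {ι : Type*} [Fintype ι] {e : ι → ℤ}
    (he : ∀ i, e i = 0 ∨ e i = 1 ∨ e i = -1) (hc : 2 ≤ Fintype.card ι)
    (h : ∑ i, e i = Fintype.card ι - 1) : (∃ i, e i = 0) ∧ ∃ i, e i = 1 := by
  have hle : ∀ i, e i ≤ 1 := fun i => by rcases he i with h | h | h <;> omega
  constructor
  · by_contra! hne
    by_cases hall : ∀ i, e i = 1
    · simp only [hall, Finset.sum_const, Finset.card_univ, nsmul_eq_mul, mul_one] at h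
      omega
    · push Not at hall
      obtain ⟨i, hi⟩ := hall
      have := sum_le_add_card hle i
      rcases he i with h' | h' | h'
      · exact hne i h'
      · exact hi h'
      · omega
  · by_contra! hne
    have : ∑ i, e i ≤ 0 := Finset.sum_nonpos fun i _ => by
      rcases he i with h' | h' | h'
      · omega
      · exact absurd h' (hne i)
      · omega
    omega

/-- Without an entry 1 and with at most two zeros the sum is at most 2 - |ι| ≤ -2, which is the
reason for q ≥ 4; without an entry -1 it is nonnegative. -/
theorem exists_signs_of_sum_eq_neg_one {ι : Type*} [Fintype ι] {e : ι → ℤ}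
    (he : ∀ i, e i = 0 ∨ e i = 1 ∨ e i = -1) (hc : 4 ≤ Fintype.card ι)
    (h0 : {i | e i = 0}.ncard ≤ 2) (h : ∑ i, e i = -1) : (∃ i, e i = 1) ∧ ∃ i, e i = -1 := by
  classical
  constructor
  · by_contra! hne
    have h1 : ∀ i, e i = (if e i = 0 then 1 else 0) - 1 := fun i => by
      rcases he i with h' | h' | h'
      · simp [h']
      · exact absurd h' (hne i)
      · simp [h']
    have h2 : ∑ i, e i = {i | e i = 0}.ncard - Fintype.card ι := by
      rw [Finset.sum_congr rfl fun i _ => h1 i, Finset.sum_sub_distrib, Finset.sum_boole,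
        Set.ncard_eq_toFinset_card', Set.toFinset_ofPred]
      simp
    omega
  · by_contra! hne
    have : 0 ≤ ∑ i, e i := Finset.sum_nonneg fun i _ => by
      rcases he i with h' | h' | h'
      · omega
      · omega
      · exact absurd h' (hne i)
    omega

variable {F : Type u} {V : Type v} [Field F] [Fintype F] [AddCommGroup V] [Module F V] [Fintype V]
  [Fintype (Module.Dual F V)] {P P' : Set (ℙ F V)} {ψ : Module.Dual F V}

theorem pointIndicator_inter_pts_ker (P : Set (ℙ F V)) {v : V} (hv : ψ v = 0) :
    pointIndicator (P ∩ pts (LinearMap.ker ψ)) v = pointIndicator P v :=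
  pointIndicator_congr <| by
    constructor
    · exact fun ⟨h, hP, _⟩ => ⟨h, hP⟩
    · exact fun ⟨h, hP⟩ => ⟨h, hP, (mem_pts_mk_iff h).2 hv⟩

theorem pointIndicator_inter_pts_ker_of_ne (P : Set (ℙ F V)) {v : V} (hv : ψ v ≠ 0) :
    pointIndicator (P ∩ pts (LinearMap.ker ψ)) v = 0 := by
  unfold pointIndicator
  rw [if_neg]
  exact fun ⟨h, _, hP⟩ => hv ((mem_pts_mk_iff h).1 hP)

theorem sum_pointIndicator_inter_pts_ker (P : Set (ℙ F V)) (ψ : Module.Dual F V) :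
    ∑ v, pointIndicator (P ∩ pts (LinearMap.ker ψ)) v = kerSum (pointIndicator P) ψ := by
  unfold kerSum
  refine Finset.sum_congr rfl fun v _ => ?_
  by_cases hv : ψ v = 0
  · rw [if_pos hv, pointIndicator_inter_pts_ker P hv]
  · rw [if_neg hv, pointIndicator_inter_pts_ker_of_ne P hv]

theorem kerSum_inter_pts_ker_sub (hsw : ∀ v, ψ v ≠ 0 → pointIndicator P' v = pointIndicator P v)
    (φ : Module.Dual F V) :
    kerSum (pointIndicator (P' ∩ pts (LinearMap.ker ψ))) φ =
      kerSum (pointIndicator (P ∩ pts (LinearMap.ker ψ))) φ + change P P' φ := by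
  have : pointIndicator (P' ∩ pts (LinearMap.ker ψ)) - pointIndicator (P ∩ pts (LinearMap.ker ψ)) =
      pointIndicator P' - pointIndicator P := by
    funext v
    simp only [Pi.sub_apply]
    by_cases hv : ψ v = 0
    · rw [pointIndicator_inter_pts_ker P hv, pointIndicator_inter_pts_ker P' hv]
    · rw [pointIndicator_inter_pts_ker_of_ne P hv, pointIndicator_inter_pts_ker_of_ne P' hv,
        hsw v hv, sub_self, sub_self]
  rw [change_eq, ← this, kerSum_sub]
  ring

/-- Counting along the pencil of hyperplanes through the intersection of two hyperplanes. -/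
theorem sum_pencil (P : Set (ℙ F V)) (φ ψ : Module.Dual F V) :
    ∑ t : F, kerSum (pointIndicator P) (φ + t • ψ) + kerSum (pointIndicator P) ψ =
      ∑ v, pointIndicator P v +
        Fintype.card F * kerSum (pointIndicator (P ∩ pts (LinearMap.ker ψ))) φ := by
  classical
  unfold kerSum
  rw [Finset.sum_comm, Finset.mul_sum, ← Finset.sum_add_distrib, ← Finset.sum_add_distrib]
  refine Finset.sum_congr rfl fun v _ => ?_
  by_cases hψ : ψ v = 0
  · rw [if_pos hψ, pointIndicator_inter_pts_ker P hψ]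
    have : ∀ t : F, (φ + t • ψ) v = φ v := fun t => by simp [hψ]
    simp only [this]
    rw [Finset.sum_const, Finset.card_univ, nsmul_eq_mul]
    ring
  -- A vector off ker ψ lies in exactly one kernel of the pencil φ + tψ.
  · rw [if_neg hψ, pointIndicator_inter_pts_ker_of_ne P hψ,
      Finset.sum_eq_single (-φ v / ψ v)]
    · rw [if_pos (by simp [hψ])]
      simp
    · intro t _ ht
      rw [if_neg]
      intro h0
      refine ht ?_
      simp only [LinearMap.add_apply, LinearMap.smul_apply, smul_eq_mul] at h0
      rw [eq_div_iff hψ]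
      linear_combination h0
    · simp

section

variable {T : Module.Dual F V → Prop} {q y η : ℤ}

/-- The entry e t is 0 for a tangent member and otherwise its sign relative to η. By `sum_pencil`
these entries add up to q - 1 or to -1, depending on the section of P ∩ ker ψ by ker φ. -/
theorem exists_signs (hψη : kerSum (pointIndicator P) ψ = q * y ^ 2 - 1 + η * y * (q - 1))
    (hT : ∀ φ, {t : F | T (φ + t • ψ)}.ncard ≤ 2)
    (hq : (Fintype.card F : ℤ) = q) (hq4 : 4 ≤ q) (hy : 0 < y) (hη : η = 1 ∨ η = -1)
    (hPt : ∀ φ, φ ≠ 0 → T φ → kerSum (pointIndicator P) φ = q * y ^ 2 - 1)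
    (hPn : ∀ φ, ¬ T φ → ∃ ε : ℤ, (ε = 1 ∨ ε = -1) ∧
      kerSum (pointIndicator P) φ = q * y ^ 2 - 1 + ε * y * (q - 1))
    (hs : ∑ v, pointIndicator P v = q ^ 2 * y ^ 2 - 1) {φ : Module.Dual F V} (hφ : φ ∉ F ∙ ψ) :
    ∃ e : F → ℤ, (∀ t, kerSum (pointIndicator P) (φ + t • ψ) =
        q * y ^ 2 - 1 + η * (e t) * (y * (q - 1))) ∧
      (kerSum (pointIndicator (P ∩ pts (LinearMap.ker ψ))) φ = y ^ 2 - 1 + η * y * (q - 1) →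
        (∃ t, e t = 0) ∧ ∃ t, e t = 1) ∧
      (kerSum (pointIndicator (P ∩ pts (LinearMap.ker ψ))) φ = y ^ 2 - 1 →
        (∃ t, e t = 1) ∧ ∃ t, e t = -1) := by
  have hη2 : η * η = 1 := by rcases hη with rfl | rfl <;> rfl
  have hg : y * (q - 1) ≠ 0 := mul_ne_zero hy.ne' (by omega)
  have hex : ∀ t : F, ∃ e : ℤ, (e = 0 ∨ e = 1 ∨ e = -1) ∧ (e = 0 → T (φ + t • ψ)) ∧
      kerSum (pointIndicator P) (φ + t • ψ) = q * y ^ 2 - 1 + η * e * (y * (q - 1)) := fun t => by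
    by_cases ht : T (φ + t • ψ)
    · exact ⟨0, Or.inl rfl, fun _ => ht, by
        rw [hPt _ (add_smul_ne_zero_of_notMem_span hφ t) ht]
        ring⟩
    · obtain ⟨ε, hε, h⟩ := hPn _ ht
      refine ⟨η * ε, ?_, ?_, ?_⟩
      · rcases hε with rfl | rfl <;> rcases hη with rfl | rfl <;> simp
      · rcases hε with rfl | rfl <;> rcases hη with rfl | rfl <;> simp
      · rw [h]
        linear_combination (-ε * (y * (q - 1))) * hη2
  choose e he heT hek using hex
  have hsum := sum_pencil P φ ψ
  rw [Finset.sum_congr rfl fun t _ => hek t, Finset.sum_add_distrib, Finset.sum_const,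
    Finset.card_univ, nsmul_eq_mul, hψη, hs, ← Finset.sum_mul, ← Finset.mul_sum, hq] at hsum
  refine ⟨e, hek, fun hK => ?_, fun hK => ?_⟩
  · rw [hK] at hsum
    refine exists_signs_of_sum_eq_card_sub_one he (by omega) ?_
    rw [hq]
    refine mul_right_cancel₀ hg ?_
    linear_combination η * hsum + (-(∑ i, e i) * (y * (q - 1)) + y * (q - 1) ^ 2) * hη2
  · rw [hK] at hsum
    refine exists_signs_of_sum_eq_neg_one he (by omega) ?_ ?_
    · exact (Set.ncard_le_ncard (fun t ht => heT t ht) (Set.toFinite _)).trans (hT φ)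
    · refine mul_right_cancel₀ hg ?_
      linear_combination η * hsum + (-(∑ i, e i) * (y * (q - 1)) - y * (q - 1)) * hη2

/-- The two sides differ by q³ y³ (q - 1)³ (y - 1). -/
theorem parabolic_second_moment_ne {q y : ℤ} (hq : 4 ≤ q) (hy : 2 ≤ y) :
    q ^ 2 * (q * ((q * y ^ 2 - 1) ^ 2 - (y ^ 2 - 1) ^ 2) + q ^ 3 * y ^ 2 * (y ^ 2 - 1) ^ 2 +
      ((y ^ 2 - 1 + y * (q - 1)) ^ 2 - (y ^ 2 - 1) ^ 2) * (q * (y * (q - 1)))) ≠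
    q ^ 3 * y ^ 2 * ((q * y ^ 2 - 1) ^ 2 + (q - 1) ^ 2 * (q * y ^ 2 - 1)) := by
  intro h
  have h1 : q ^ 3 * y ^ 3 * (q - 1) ^ 3 * (y - 1) = 0 := by linear_combination -h
  have : 0 < q ^ 3 * y ^ 3 * (q - 1) ^ 3 * (y - 1) := by
    have h2 : 0 < q - 1 := by omega
    have h3 : 0 < y - 1 := by omega
    have h4 : 0 < q := by omega
    have h5 : 0 < y := by omega
    positivity
  omega

/-- Switching in a non-tangent hyperplane of a parabolic quadric never produces the intersection
numbers of a parabolic quadric. -/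
theorem eq_of_parabolic_quadric (hsw : ∀ v, ψ v ≠ 0 → pointIndicator P' v = pointIndicator P v)
    (hψ : ψ ≠ 0) (hψη : kerSum (pointIndicator P) ψ = q * y ^ 2 - 1 + η * y * (q - 1))
    (hT : ∀ φ, {t : F | T (φ + t • ψ)}.ncard ≤ 2)
    (hq : (Fintype.card F : ℤ) = q) (hq4 : 4 ≤ q) (hy : 2 ≤ y) (hη : η = 1 ∨ η = -1)
    (hV : (Fintype.card V : ℤ) = q ^ 3 * y ^ 2)
    (hPt : ∀ φ, φ ≠ 0 → T φ → kerSum (pointIndicator P) φ = q * y ^ 2 - 1)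
    (hPn : ∀ φ, ¬ T φ → ∃ ε : ℤ, (ε = 1 ∨ ε = -1) ∧
      kerSum (pointIndicator P) φ = q * y ^ 2 - 1 + ε * y * (q - 1))
    (hs : ∑ v, pointIndicator P v = q ^ 2 * y ^ 2 - 1)
    (hK : ∀ φ, φ ∉ F ∙ ψ →
      kerSum (pointIndicator (P ∩ pts (LinearMap.ker ψ))) φ = y ^ 2 - 1 ∨
      kerSum (pointIndicator (P ∩ pts (LinearMap.ker ψ))) φ = y ^ 2 - 1 + η * y * (q - 1))
    (hP' : ∀ φ : Module.Dual F V, φ ≠ 0 → ∃ ε : ℤ, (ε = 0 ∨ ε = 1 ∨ ε = -1) ∧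
      kerSum (pointIndicator P') φ = q * y ^ 2 - 1 + ε * y * (q - 1)) : P' = P := by
  classical
  have hη2 : η * η = 1 := by rcases hη with rfl | rfl <;> rfl
  have hg : 0 < y * (q - 1) := mul_pos (by omega) (by omega)
  obtain ⟨g, hgd⟩ : ∃ g, g = y * (q - 1) := ⟨_, rfl⟩
  -- With g = y (q - 1), the change equals η (ε - e t) g for every t, with ε in {0, 1, -1}. Entries
  -- 1 and -1 together force it to be 0; entries 0 and 1 together leave 0 and -η g.
  have hc : ∀ φ, φ ∉ F ∙ ψ →
      (kerSum (pointIndicator (P ∩ pts (LinearMap.ker ψ))) φ = y ^ 2 - 1 → change P P' φ = 0) ∧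
      (kerSum (pointIndicator (P ∩ pts (LinearMap.ker ψ))) φ = y ^ 2 - 1 + η * y * (q - 1) →
        change P P' φ = 0 ∨ change P P' φ = 0 + -(η * y * (q - 1))) := fun φ hφ => by
    obtain ⟨e, hek, h1, h2⟩ := exists_signs hψη hT hq hq4 (by omega) hη hPt hPn hs hφ
    have hδ : ∀ t, ∃ ε : ℤ, (ε = 0 ∨ ε = 1 ∨ ε = -1) ∧ change P P' φ = (η * (ε - e t)) * g :=
      fun t => by
        obtain ⟨ε, hε, h⟩ := hP' _ (add_smul_ne_zero_of_notMem_span hφ t)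
        refine ⟨η * ε, by rcases hη with rfl | rfl <;> rcases hε with rfl | rfl | rfl <;> simp, ?_⟩
        rw [← change_add_smul hsw φ t, change, h, hek, hgd]
        linear_combination (-ε * (y * (q - 1))) * hη2
    have huniq : ∀ x x' : ℤ, change P P' φ = (η * x) * g → change P P' φ = (η * x') * g → x = x' :=
      fun x x' e e' => by
        have h3 := mul_right_cancel₀ (hgd ▸ hg.ne' : g ≠ 0) (e.symm.trans e')
        rcases hη with rfl | rfl <;> omega
    constructor
    · intro hKφ
      obtain ⟨⟨t, ht⟩, t', ht'⟩ := h2 hKφ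
      obtain ⟨ε, hε, e1⟩ := hδ t
      obtain ⟨ε', hε', e2⟩ := hδ t'
      rw [ht] at e1
      rw [ht'] at e2
      have := huniq _ _ e1 e2
      rw [e1, (by omega : ε - 1 = 0)]
      simp
    · intro hKφ
      obtain ⟨⟨t, ht⟩, t', ht'⟩ := h1 hKφ
      obtain ⟨ε, hε, e1⟩ := hδ t
      obtain ⟨ε', hε', e2⟩ := hδ t'
      rw [ht] at e1
      rw [ht'] at e2
      have := huniq _ _ e1 e2
      rcases (by omega : ε - 0 = 0 ∨ ε - 0 = -1) with h | h
      · left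
        rw [e1, h]
        simp
      · right
        rw [e1, h, hgd]
        ring
  have hcc : ∀ φ, φ ∉ F ∙ ψ → change P P' φ = 0 ∨ change P P' φ = 0 + -(η * y * (q - 1)) :=
    fun φ hφ => by
      rcases hK φ hφ with h | h
      · exact Or.inl ((hc φ hφ).1 h)
      · exact (hc φ hφ).2 h
  -- A change -η g occurs only where the section of P ∩ ker ψ has its other size, which it turns
  -- into y² - 1. So P' ∩ ker ψ has the same two sizes.
  have hS : ∀ φ, φ ∉ F ∙ ψ →
      kerSum (pointIndicator (P' ∩ pts (LinearMap.ker ψ))) φ = y ^ 2 - 1 ∨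
      kerSum (pointIndicator (P' ∩ pts (LinearMap.ker ψ))) φ = y ^ 2 - 1 + η * y * (q - 1) :=
    fun φ hφ => by
      rw [kerSum_inter_pts_ker_sub hsw]
      rcases hK φ hφ with h | h
      · rw [(hc φ hφ).1 h, h, add_zero]
        exact Or.inl rfl
      · rcases (hc φ hφ).2 h with h' | h' <;> rw [h', h]
        · right; ring
        · left; ring
  obtain ⟨X, hX⟩ : ∃ X : ℕ, X = (Finset.univ.filter fun φ => φ ∉ F ∙ ψ ∧
    kerSum (pointIndicator (P' ∩ pts (LinearMap.ker ψ))) φ ≠ y ^ 2 - 1).card := ⟨_, rfl⟩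
  obtain ⟨m1, m2⟩ := two_value_moments
    (isPointFunction_pointIndicator (P' ∩ pts (LinearMap.ker ψ))) hψ
    (fun v hv => pointIndicator_inter_pts_ker_of_ne P' hv) hS (congrArg Nat.cast hX)
  simp only [pointIndicator_sq] at m2
  obtain ⟨i, hi, hσ⟩ := hP' ψ hψ
  rw [sum_pointIndicator_inter_pts_ker, hσ, hq, hV] at m1 m2
  have hq0 : q ≠ 0 := by omega
  have m1' : η * X = q * (y * (q - 1)) + i * (q ^ 2 * y ^ 2 - q) := by
    refine mul_left_cancel₀ (mul_ne_zero hq0 hg.ne') ?_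
    linear_combination m1
  have hX0 : (0 : ℤ) ≤ X := Int.natCast_nonneg _
  have hlt : q * (y * (q - 1)) < q ^ 2 * y ^ 2 - q := by
    have h1 : 0 < q * y - q := by nlinarith
    nlinarith
  have hpos : 0 < q * (y * (q - 1)) := mul_pos (by omega) hg
  -- In `m1'` one has X ≥ 0 and q y (q - 1) < q² y² - q, so the other signs are impossible.
  have hcase : i = 0 ∧ η = 1 ∨ i = η := by
    rcases hη with rfl | rfl <;> rcases hi with rfl | rfl | rfl
    · exact Or.inl ⟨rfl, rfl⟩
    · exact Or.inr rfl
    · exfalso; linarith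
    · exfalso; linarith
    · exfalso; linarith
    · exact Or.inr rfl
  rcases hcase with ⟨rfl, rfl⟩ | rfl
  · exfalso
    have hXe : (X : ℤ) = q * (y * (q - 1)) := by linear_combination m1'
    rw [hXe] at m2
    refine parabolic_second_moment_ne hq4 hy ?_
    simpa only [zero_mul, add_zero, one_mul] using m2
  -- The section in ker ψ keeps its size. All other changes are 0 or the same nonzero value, so the
  -- first moment leaves only zeros.
  · have hψ0 : change P P' ψ = 0 := by
      rw [change, hσ, hψη, sub_self]
    have hcount := card_mul_change_eq hsw hψ hcc
    rw [hψ0, hq] at hcount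
    have hzero : (Finset.univ.filter fun φ => φ ∉ F ∙ ψ ∧ change P P' φ ≠ 0) = ∅ := by
      rw [← Finset.card_eq_zero]
      have : q * (i * y * (q - 1)) *
          ((Finset.univ.filter fun φ => φ ∉ F ∙ ψ ∧ change P P' φ ≠ 0).card : ℤ) = 0 := by
        linear_combination -hcount
      have hne : q * (i * y * (q - 1)) ≠ 0 := by
        refine mul_ne_zero hq0 ?_
        rw [mul_assoc]
        refine mul_ne_zero ?_ hg.ne'
        rcases hη with rfl | rfl <;> norm_num
      exact_mod_cast (mul_eq_zero.1 this).resolve_left hne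
    refine eq_of_change_eq_zero fun φ => ?_
    by_cases hφ : φ ∈ F ∙ ψ
    · rw [change_of_mem_span hsw hφ, hψ0]
    · by_contra hne
      have : φ ∈ (Finset.univ.filter fun φ => φ ∉ F ∙ ψ ∧ change P P' φ ≠ 0) := by simp [hφ, hne]
      rw [hzero] at this
      exact absurd this (Finset.notMem_empty φ)

end

end ParabolicQuadric

/-! ### Tangent sections are cones of the same type. -/

section Cone

variable {F : Type u} {V : Type v} [Field F] [AddCommGroup V] [Module F V]

/-- A tangent hyperplane section is a cone over its intersection with a complement of the
vertex. -/
theorem PolarForm.inter_pts_ker_eq_cone (β : PolarForm F V) {S : Set (ℙ F V)}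
    (hS : ∀ v, v ∈ vectors S ↔ v ≠ 0 ∧ β.IsSingular v) {p : V} (hp0 : p ≠ 0)
    (hp : β.IsSingular p) {W : Submodule F V} (hW : W ⊔ F ∙ p = LinearMap.ker (β.dual p))
    {B : Set (ℙ F W)} (hB : ∀ w, w ∈ vectors B ↔ w ≠ 0 ∧ (β.restrict W).IsSingular w) :
    S ∩ pts (LinearMap.ker (β.dual p)) = cone (Projectivization.mk F p hp0) W B := by
  have hWle : ∀ w ∈ W, β.dual p w = 0 := fun w hw => by
    have : w ∈ LinearMap.ker (β.dual p) := hW ▸ Submodule.mem_sup_left hw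
    exact this
  ext x
  obtain ⟨v, hv0, rfl⟩ : ∃ v, ∃ h : v ≠ 0, Projectivization.mk F v h = x :=
    ⟨x.rep, x.rep_nonzero, x.mk_rep⟩
  have hvS : Projectivization.mk F v hv0 ∈ S ↔ β.IsSingular v := by
    have := hS v
    simpa [vectors, hv0] using this
  constructor
  · rintro ⟨hxS, hxK⟩
    have hs := hvS.1 hxS
    have hvK := (mem_pts_mk_iff hv0).1 hxK
    rw [← hW] at hvK
    obtain ⟨w, hw, z, hz, rfl⟩ := Submodule.mem_sup.1 hvK
    obtain ⟨a, rfl⟩ := Submodule.mem_span_singleton.1 hz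
    by_cases hw0 : w = 0
    · left
      rw [Projectivization.mk_eq_mk_iff']
      exact ⟨a, by rw [hw0, zero_add]⟩
    · right
      have hws : β.IsSingular w := (β.singular_add_smul_iff hp (hWle w hw) a).1 hs
      have hw0' : (⟨w, hw⟩ : W) ≠ 0 := fun h => hw0 (congrArg Subtype.val h)
      obtain ⟨_, hwB⟩ := (hB ⟨w, hw⟩).2 ⟨hw0', hws⟩
      refine ⟨_, hwB, ?_⟩
      rw [Projectivization.map_mk, Projectivization.submodule_mk, Projectivization.submodule_mk,
        Projectivization.submodule_mk, Submodule.span_singleton_le_iff_mem]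
      refine Submodule.add_mem _ (Submodule.mem_sup_right ?_)
        (Submodule.mem_sup_left (Submodule.smul_mem _ _ ?_)) <;>
      exact Submodule.mem_span_singleton_self _
  · intro hx
    have hpK : p ∈ LinearMap.ker (β.dual p) := β.dual_self hp
    rcases hx with hx | ⟨b, hb, hx⟩
    · rw [Projectivization.mk_eq_mk_iff'] at hx
      obtain ⟨a, rfl⟩ := hx
      exact ⟨hvS.2 (β.singular_smul a hp), (mem_pts_mk_iff hv0).2 (Submodule.smul_mem _ _ hpK)⟩
    · obtain ⟨w, hw0, rfl⟩ : ∃ w, ∃ h : w ≠ 0, Projectivization.mk F w h = b :=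
        ⟨b.rep, b.rep_nonzero, b.mk_rep⟩
      have hws : β.IsSingular (w : V) := ((hB w).1 ⟨hw0, hb⟩).2
      rw [Projectivization.map_mk, Projectivization.submodule_mk, Projectivization.submodule_mk,
        Projectivization.submodule_mk, Submodule.span_singleton_le_iff_mem] at hx
      obtain ⟨y, hy, z, hz, rfl⟩ := Submodule.mem_sup.1 hx
      obtain ⟨a, rfl⟩ := Submodule.mem_span_singleton.1 hy
      obtain ⟨c, rfl⟩ := Submodule.mem_span_singleton.1 hz
      have hwc : β.dual p (c • (w : V)) = 0 := hWle _ (W.smul_mem c w.2)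
      refine ⟨hvS.2 ?_, (mem_pts_mk_iff hv0).2 (Submodule.add_mem _ (Submodule.smul_mem _ _ hpK) hwc)⟩
      rw [add_comm]
      exact (β.singular_add_smul_iff hp hwc a).2 (β.singular_smul c hws)

theorem exists_le_finrank_eq [FiniteDimensional F V] (U : Submodule F V) {n : ℕ}
    (hn : n ≤ Module.finrank F U) : ∃ U' ≤ U, Module.finrank F U' = n := by
  obtain ⟨x, hx⟩ := exists_linearIndependent_of_le_finrank (R := F) (M := U) hn
  have hx' := hx.map' U.subtype (Submodule.ker_subtype U)
  refine ⟨Submodule.span F (Set.range (U.subtype ∘ x)), ?_, ?_⟩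
  · rw [Submodule.span_le]
    rintro _ ⟨i, rfl⟩
    exact (x i).2
  · rw [finrank_span_eq_card hx', Fintype.card_fin]

variable {Q : QuadraticForm F V} {p : V} {W : Submodule F V}

theorem isTotallySingular_sup_span (hp : Q p = 0) {U : Submodule F V} (hU : IsTotallySingular Q U)
    (hUp : ∀ u ∈ U, QuadraticMap.polar Q p u = 0) : IsTotallySingular Q (U ⊔ F ∙ p) := by
  intro x hx
  obtain ⟨u, hu, y, hy, rfl⟩ := Submodule.mem_sup.1 hx
  obtain ⟨a, rfl⟩ := Submodule.mem_span_singleton.1 hy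
  exact ((quadraticPolarForm Q).singular_add_smul_iff hp (hUp u hu) a).2 (hU u hu)

variable [FiniteDimensional F V]

/-- The residue of a quadric at a singular point has the same type as the quadric. -/
theorem hasQuadricType_residue (hp : Q p = 0) (hpW : p ∉ W)
    (hW : W ⊔ F ∙ p = LinearMap.ker ((quadraticPolarForm Q).dual p))
    (hd : (quadraticPolarForm Q).dual p ≠ 0) {t : PolarType} (ht : HasQuadricType F V t Q) :
    HasQuadricType F W t (Q.comp W.subtype) := by
  have h1 := finrank_eq_finrank_add_one hpW hW
  have h2 := Module.Dual.finrank_ker_add_one_of_ne_zero hd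
  have hWle : ∀ w ∈ W, QuadraticMap.polar Q p w = 0 := fun w hw => by
    have : w ∈ LinearMap.ker ((quadraticPolarForm Q).dual p) := hW ▸ Submodule.mem_sup_left hw
    exact this
  cases t with
  | elliptic =>
    obtain ⟨k, hk, hU⟩ := ht
    refine ⟨k - 1, by omega, ?_⟩
    rintro ⟨U, hUk, hUs⟩
    have hUW : ∀ u ∈ U.map W.subtype, u ∈ W := by
      rintro _ ⟨u, -, rfl⟩
      exact u.2
    refine hU ⟨U.map W.subtype ⊔ F ∙ p, ?_, isTotallySingular_sup_span hp ?_ ?_⟩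
    · rw [finrank_eq_finrank_add_one (fun h => hpW (hUW p h)) rfl,
        ← (Submodule.equivMapOfInjective _ W.subtype_injective U).finrank_eq]
      omega
    · rintro _ ⟨u, hu, rfl⟩
      exact hUs u hu
    · exact fun u hu => hWle u (hUW u hu)
  | hyperbolic =>
    obtain ⟨k, hk, U, hUk, hUs⟩ := ht
    refine ⟨k - 1, by omega, ?_⟩
    -- Intersecting U with the orthogonal space of p and adding p keeps dimension at least k;
    -- intersecting with W then loses only the direction of p.
    obtain ⟨U₁, hU₁⟩ : ∃ U₁, U₁ = U ⊓ LinearMap.ker ((quadraticPolarForm Q).dual p) := ⟨_, rfl⟩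
    have hMs : IsTotallySingular Q (U₁ ⊔ F ∙ p) := by
      refine isTotallySingular_sup_span hp (fun u hu => hUs u ?_) fun u hu => ?_
      · rw [hU₁] at hu
        exact hu.1
      · rw [hU₁] at hu
        exact hu.2
    have hMk : k ≤ Module.finrank F (U₁ ⊔ F ∙ p : Submodule F V) := by
      by_cases hpU : p ∈ U
      · have hle : U ≤ U₁ ⊔ F ∙ p := fun u hu => by
          refine Submodule.mem_sup_left (hU₁ ▸ ⟨hu, ?_⟩)
          have := hUs _ (U.add_mem hpU hu)
          rw [QuadraticMap.map_add Q, hp, hUs u hu, zero_add, zero_add] at this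
          exact this
        rw [← hUk]
        exact Submodule.finrank_mono hle
      · rw [finrank_eq_finrank_add_one (fun h => hpU (by rw [hU₁] at h; exact h.1)) rfl]
        have h3 := Submodule.finrank_sup_add_finrank_inf_eq U
          (LinearMap.ker ((quadraticPolarForm Q).dual p))
        have h4 := Submodule.finrank_le
          (U ⊔ LinearMap.ker ((quadraticPolarForm Q).dual p))
        rw [← hU₁] at h3
        omega
    have hMW : (U₁ ⊔ F ∙ p) ⊓ W ⊔ F ∙ p = U₁ ⊔ F ∙ p := by
      rw [sup_comm, ← inf_comm, ← sup_inf_assoc_of_le W (le_sup_right : F ∙ p ≤ U₁ ⊔ F ∙ p),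
        sup_comm, hW, inf_eq_right]
      refine sup_le (hU₁ ▸ inf_le_right) ?_
      rw [Submodule.span_singleton_le_iff_mem]
      exact (quadraticPolarForm Q).dual_self hp
    have h5 := finrank_eq_finrank_add_one (fun h : p ∈ (U₁ ⊔ F ∙ p) ⊓ W => hpW h.2) hMW
    have h6 : Module.finrank F (((U₁ ⊔ F ∙ p) ⊓ W).comap W.subtype) =
        Module.finrank F ((U₁ ⊔ F ∙ p) ⊓ W : Submodule F V) :=
      (Submodule.comapSubtypeEquivOfLe inf_le_right).finrank_eq
    obtain ⟨U', hU', hk'⟩ := exists_le_finrank_eq (((U₁ ⊔ F ∙ p) ⊓ W).comap W.subtype)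
      (n := k - 1) (by omega)
    exact ⟨U', hk', fun u hu => hMs u (hU' hu).1⟩
  | parabolic =>
    have ht' : Odd (Module.finrank F V) := ht
    change Odd (Module.finrank F W)
    rw [show Module.finrank F V = Module.finrank F W + 2 by omega] at ht'
    rcases ht' with ⟨j, hj⟩
    exact ⟨j - 1, by omega⟩
  | hermitian => exact ht

variable [Finite F]

theorem isPolarSpace_of_quadric {t : PolarType} {Q : QuadraticForm F V} (hQ : Q.Nondegenerate)
    (ht : HasQuadricType F V t Q) : IsPolarSpace t (quadricPoints Q) := by
  cases t with
  | hermitian => exact ht.elim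
  | elliptic => exact ⟨Q, hQ, ht, rfl⟩
  | hyperbolic => exact ⟨Q, hQ, ht, rfl⟩
  | parabolic => exact ⟨Q, hQ, ht, rfl⟩

theorem isSingularHyperplane_of_cone {β : PolarForm F V} {S : Set (ℙ F V)}
    (hS : ∀ v, v ∈ vectors S ↔ v ≠ 0 ∧ β.IsSingular v) {p : V} (hp0 : p ≠ 0)
    (hp : β.IsSingular p) {W : Submodule F V} (hpW : p ∉ W)
    (hW : W ⊔ F ∙ p = LinearMap.ker (β.dual p)) {B : Set (ℙ F W)}
    (hB : ∀ w, w ∈ vectors B ↔ w ≠ 0 ∧ (β.restrict W).IsSingular w) {t : PolarType}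
    (ht : IsPolarSpace t B) : IsSingularHyperplane t S (LinearMap.ker (β.dual p)) := by
  refine ⟨_, ⟨Projectivization.mk F p hp0, W, B, (mem_pts_mk_iff hp0).2 (β.dual_self hp),
    hW ▸ le_sup_left, (finrank_eq_finrank_add_one hpW hW).symm, fun h => hpW ?_, ht, rfl⟩, ?_⟩
  · exact (mem_pts_mk_iff hp0).1 h
  · rw [β.inter_pts_ker_eq_cone hS hp0 hp hW hB]

theorem isSingularHyperplane_quadric {t : PolarType} {Q : QuadraticForm F V} (hQ : Q.Nondegenerate)
    (ht : HasQuadricType F V t Q) {ψ : Module.Dual F V} (hψ : ψ ≠ 0)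
    (hψt : (quadraticPolarForm Q).IsTangent ψ) :
    IsSingularHyperplane t (quadricPoints Q) (LinearMap.ker ψ) := by
  obtain ⟨p, hp, rfl⟩ := hψt
  have hp0 : p ≠ 0 := fun h => hψ (by rw [h, map_zero])
  obtain ⟨W, -, hpW, hW⟩ := exists_complement_of_mem
    (K := LinearMap.ker ((quadraticPolarForm Q).dual p)) ((quadraticPolarForm Q).dual_self hp) hp0
  refine isSingularHyperplane_of_cone (mem_vectors_quadricPoints Q) hp0 hp hpW hW
    (B := quadricPoints (Q.comp W.subtype)) (mem_vectors_quadricPoints _)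
    (isPolarSpace_of_quadric (nondegenerate_of_isNondegenerate ?_)
      (hasQuadricType_residue hp hpW hW hψ ht))
  exact (quadraticPolarForm Q).restrict_complement_isNondegenerate
    (isNondegenerate_quadraticPolarForm hQ) hp hpW hW

theorem isSingularHyperplane_hermitian {σ : F →+* F} {hσ : ∀ a, σ (σ a) = a}
    {hσ1 : σ ≠ RingHom.id F} {h : V →ₛₗ[σ] V →ₗ[F] F} {hs : h.IsSymm} (hn : h.Nondegenerate)
    {ψ : Module.Dual F V} (hψ : ψ ≠ 0) (hψt : (hermitianPolarForm hσ hσ1 h hs).IsTangent ψ) :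
    IsSingularHyperplane .hermitian {x : ℙ F V | h x.rep x.rep = 0} (LinearMap.ker ψ) := by
  obtain ⟨p, hp, rfl⟩ := hψt
  have hp0 : p ≠ 0 := fun h => hψ (by rw [h, map_zero])
  obtain ⟨W, -, hpW, hW⟩ := exists_complement_of_mem
    (K := LinearMap.ker ((hermitianPolarForm hσ hσ1 h hs).dual p))
    ((hermitianPolarForm hσ hσ1 h hs).dual_self hp) hp0
  have hnW := (hermitianPolarForm hσ hσ1 h hs).restrict_complement_isNondegenerate
    (isNondegenerate_hermitianPolarForm hn) hp hpW hW
  have hsW : (h.domRestrict₁₂ W W).IsSymm := ⟨fun x y => hs.eq x y⟩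
  have hleft : (h.domRestrict₁₂ W W).SeparatingLeft := fun x hx =>
    hnW x (hx x) (LinearMap.ext hx)
  refine isSingularHyperplane_of_cone mem_vectors_hermitian hp0 hp hpW hW
    (B := {x : ℙ F W | h.domRestrict₁₂ W W x.rep x.rep = 0})
    (mem_vectors_hermitian (hσ := hσ) (hσ1 := hσ1) (hs := hsW)) ?_
  refine ⟨σ, h.domRestrict₁₂ W W, hσ, hσ1, hsW, ⟨hleft, fun y hy => hleft y fun x => ?_⟩, rfl⟩
  rw [← hsW.eq, hy x, map_zero]

end Cone

/-! ### Intersection numbers of quasi-polar spaces. -/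

section Numbers

variable {F : Type u} {V : Type v} [Field F] [Finite F] [AddCommGroup V] [Module F V]

/-- The possible hyperplane intersection numbers, up to the factor `|F| - 1`, of a quasi-polar
space: those of an elliptic or hyperbolic quadric, of a parabolic quadric, or of a Hermitian
variety. -/
def HasPolarNumbers (S : Set (ℙ F V)) [Fintype V] : Prop :=
  (∃ (k : ℕ) (ε : ℤ), Module.finrank F V = 2 * (k + 1) ∧ (ε = 1 ∨ ε = -1) ∧
    ∀ φ : Module.Dual F V, φ ≠ 0 →
      kerSum (pointIndicator S) φ = (Nat.card F ^ k) ^ 2 - 1 ∨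
      kerSum (pointIndicator S) φ =
        (Nat.card F ^ k) ^ 2 - 1 + ε * Nat.card F ^ k * (Nat.card F - 1)) ∨
  (∃ k : ℕ, Module.finrank F V = 2 * (k + 1) + 1 ∧ ∀ φ : Module.Dual F V, φ ≠ 0 →
    ∃ ε : ℤ, (ε = 0 ∨ ε = 1 ∨ ε = -1) ∧ kerSum (pointIndicator S) φ =
      Nat.card F * (Nat.card F ^ k) ^ 2 - 1 + ε * Nat.card F ^ k * (Nat.card F - 1)) ∨
  ∃ (r k : ℕ), 2 ≤ r ∧ Nat.card F = r ^ 2 ∧ Module.finrank F V = k + 2 ∧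
    ∀ φ : Module.Dual F V, φ ≠ 0 →
      kerSum (pointIndicator S) φ =
        r * ((r : ℤ) ^ k) ^ 2 - 1 + (-1) ^ k * (r * (r : ℤ) ^ k * (r - 1)) ∨
      kerSum (pointIndicator S) φ =
        r * ((r : ℤ) ^ k) ^ 2 - 1 - (-1) ^ k * ((r : ℤ) ^ k * (r - 1))

variable [Fintype V]

theorem IsPolarSpace.exists_quadric_or_hermitian {t : PolarType} {S : Set (ℙ F V)}
    (h : IsPolarSpace t S) :
    (∃ Q : QuadraticForm F V, Q.Nondegenerate ∧ HasQuadricType F V t Q ∧ S = quadricPoints Q) ∨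
      (t = .hermitian ∧ IsHermitianVariety S) := by
  cases t with
  | hermitian => exact Or.inr ⟨rfl, h⟩
  | elliptic => exact Or.inl h
  | hyperbolic => exact Or.inl h
  | parabolic => exact Or.inl h

theorem even_or_odd_of_hasQuadricType {t : PolarType} {Q : QuadraticForm F V}
    (h : HasQuadricType F V t Q) (hn : 2 ≤ Module.finrank F V) :
    (t ≠ .parabolic ∧ ∃ k, Module.finrank F V = 2 * (k + 1)) ∨
      (t = .parabolic ∧ ∃ k, Module.finrank F V = 2 * (k + 1) + 1) := by
  cases t with
  | elliptic =>
    obtain ⟨k, hk, -⟩ := h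
    exact Or.inl ⟨by simp, k - 1, by omega⟩
  | hyperbolic =>
    obtain ⟨k, hk, -⟩ := h
    exact Or.inl ⟨by simp, k - 1, by omega⟩
  | parabolic =>
    obtain ⟨k, hk⟩ := (h : Odd (Module.finrank F V))
    exact Or.inr ⟨rfl, k - 1, by omega⟩
  | hermitian => exact h.elim

theorem hasPolarNumbers_of_isPolarSpace {t : PolarType} {S : Set (ℙ F V)} (h : IsPolarSpace t S)
    (hn : 2 ≤ Module.finrank F V) : HasPolarNumbers S := by
  rcases h.exists_quadric_or_hermitian with ⟨Q, hQ, ht, rfl⟩ | ⟨-, σ, b, hσ, hσ1, hs, hb, rfl⟩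
  · have hQ' := isNondegenerate_quadraticPolarForm hQ
    rcases even_or_odd_of_hasQuadricType ht hn with ⟨-, k, hk⟩ | ⟨-, k, hk⟩
    · obtain ⟨ε, hε, h1, -⟩ := even_quadric_sizes hQ' hk
      refine Or.inl ⟨k, ε, hk, hε, fun φ hφ => ?_⟩
      by_cases hφt : (quadraticPolarForm Q).IsTangent φ
      · exact Or.inr (h1 φ hφ hφt)
      · exact Or.inl (even_quadric_kerSum_of_not_isTangent hQ' hk hφt)
    · refine Or.inr (Or.inl ⟨k, hk, fun φ hφ => ?_⟩)
      by_cases hφt : (quadraticPolarForm Q).IsTangent φ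
      · exact ⟨0, Or.inl rfl, by rw [odd_quadric_kerSum_of_isTangent hQ' hk hφ hφt]; ring⟩
      · obtain ⟨ε, hε, h1⟩ := odd_quadric_kerSum_of_not_isTangent hQ' hk hφt
        exact ⟨ε, Or.inr hε, h1⟩
  · have hb' := isNondegenerate_hermitianPolarForm (hσ := hσ) (hσ1 := hσ1) (hs := hs) hb
    refine Or.inr (Or.inr ⟨fixedCard σ, Module.finrank F V - 2, two_le_fixedCard hσ hσ1,
      card_eq_fixedCard_sq hσ hσ1, by omega, fun φ hφ => ?_⟩)
    by_cases hφt : (hermitianPolarForm hσ hσ1 b hs).IsTangent φ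
    · exact Or.inl (hermitian_kerSum_of_isTangent hb' (by omega) hφ hφt)
    · exact Or.inr (hermitian_kerSum_of_not_isTangent hb' (by omega) hφt)

theorem IsQuasiPolarSpace.hasPolarNumbers {t : PolarType} {S : Set (ℙ F V)}
    (h : IsQuasiPolarSpace t S) (hn : 2 ≤ Module.finrank F V) : HasPolarNumbers S := by
  obtain ⟨P₀, hP₀, hS⟩ := h.exists_kerSum
  rcases hasPolarNumbers_of_isPolarSpace hP₀ hn with
    ⟨k, ε, hk, hε, h1⟩ | ⟨k, hk, h1⟩ | ⟨r, k, hr, hq, hk, h1⟩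
  · refine Or.inl ⟨k, ε, hk, hε, fun φ hφ => ?_⟩
    obtain ⟨ψ, hψ, e⟩ := hS φ hφ
    rw [e]
    exact h1 ψ hψ
  · refine Or.inr (Or.inl ⟨k, hk, fun φ hφ => ?_⟩)
    obtain ⟨ψ, hψ, e⟩ := hS φ hφ
    rw [e]
    exact h1 ψ hψ
  · refine Or.inr (Or.inr ⟨r, k, hr, hq, hk, fun φ hφ => ?_⟩)
    obtain ⟨ψ, hψ, e⟩ := hS φ hφ
    rw [e]
    exact h1 ψ hψ

theorem le_pow_natCard {k : ℕ} (hk : 1 ≤ k) : (Nat.card F : ℤ) ≤ (Nat.card F : ℤ) ^ k := by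
  have : (1 : ℤ) ≤ Nat.card F := by exact_mod_cast Nat.card_pos (α := F)
  exact le_self_pow₀ this (by omega)

theorem natCard_eq_pow_int {n : ℕ} (hn : Module.finrank F V = n) :
    (Nat.card V : ℤ) = (Nat.card F : ℤ) ^ n := by
  rw [Module.natCard_eq_pow_finrank (K := F) (V := V), hn]
  push_cast
  rfl

end Numbers

/-! ### Rigidity of even-dimensional quadrics and of Hermitian varieties. -/

section Cases

variable {F : Type u} {V : Type v} [Field F] [Fintype F] [AddCommGroup V] [Module F V] [Fintype V]
  [Fintype (Module.Dual F V)] {P' : Set (ℙ F V)} {ψ : Module.Dual F V}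

theorem even_quadric_rigidity {Q : QuadraticForm F V} (hQ : Q.Nondegenerate) {k : ℕ}
    (hk : Module.finrank F V = 2 * (k + 1)) (hk1 : 1 ≤ k) (hq3 : 3 ≤ Nat.card F)
    (hsw : ∀ v, ψ v ≠ 0 → pointIndicator P' v = pointIndicator (quadricPoints Q) v)
    (hψ : ψ ≠ 0) (hψt : ¬ (quadraticPolarForm Q).IsTangent ψ) (hP' : HasPolarNumbers P') :
    P' = quadricPoints Q := by
  have hQ' := isNondegenerate_quadraticPolarForm hQ
  obtain ⟨ε, hε, h1, hs⟩ := even_quadric_sizes hQ' hk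
  have hV := natCard_eq_pow_int (F := F) hk
  have hTc : ({φ | (quadraticPolarForm Q).IsTangent φ}.ncard : ℤ) =
      Nat.card F * (Nat.card F ^ k) ^ 2 + ε * Nat.card F ^ k * (Nat.card F - 1) := by
    have h2 := (quadraticPolarForm Q).kerSum_pointIndicator_eq (mem_vectors_quadricPoints Q) 0
    rw [kerSum_zero_right, hs, PolarForm.singCount_restrict] at h2
    rw [PolarForm.ncard_isTangent hQ', PolarForm.singCount]
    simp only [LinearMap.ker_zero, Submodule.mem_top, true_and] at h2
    rw [← h2]
    ring
  -- Whatever the type of P', its two section sizes differ by y (q - 1), so they can be written b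
  -- and b + E with the E of P. For the type of P, b = y² - 1; for the opposite type, b is shifted
  -- by exactly E; Hermitian sizes are far above y² - 1.
  obtain ⟨b, hb, hP'b⟩ : ∃ b : ℤ, (b = (Nat.card F ^ k) ^ 2 - 1 ∨
      (Nat.card F : ℤ) ^ k * (Nat.card F - 1) ≤ |b - ((Nat.card F ^ k) ^ 2 - 1)|) ∧
      ∀ φ : Module.Dual F V, φ ≠ 0 → kerSum (pointIndicator P') φ = b ∨
        kerSum (pointIndicator P') φ = b + ε * Nat.card F ^ k * (Nat.card F - 1) := by
    rcases hP' with ⟨k', ε', hk', hε', h⟩ | ⟨k', hk', -⟩ | ⟨r, k', hr, hqr, hk', h⟩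
    · obtain rfl : k = k' := by omega
      by_cases hεε : ε' = ε
      · subst hεε
        exact ⟨_, Or.inl rfl, h⟩
      · have hεε' : ε' = -ε := by omega
        refine ⟨(Nat.card F ^ k) ^ 2 - 1 - ε * Nat.card F ^ k * (Nat.card F - 1), Or.inr ?_,
          fun φ hφ => ?_⟩
        · rw [sub_sub_cancel_left, abs_neg]
          rcases hε with rfl | rfl
          · rw [one_mul]
            exact le_abs_self _
          · rw [neg_one_mul, neg_mul, abs_neg]
            exact le_abs_self _
        · rw [sub_add_cancel]
          rcases h φ hφ with h' | h'
          · exact Or.inr h'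
          · left
            rw [h', hεε']
            ring
    · omega
    · obtain rfl : k' = 2 * k := by omega
      have hy : (r : ℤ) ^ (2 * k) = (Nat.card F : ℤ) ^ k := by
        rw [hqr, pow_mul]
        push_cast
        rfl
      have hyq := le_pow_natCard (F := F) hk1
      rw [hy] at h
      have hq : (Nat.card F : ℤ) = (r : ℤ) ^ 2 := by exact_mod_cast hqr
      have hr' : (2 : ℤ) ≤ r := by exact_mod_cast hr
      simp only [pow_mul, neg_one_sq, one_pow, one_mul] at h
      generalize (Nat.card F : ℤ) ^ k = y at *
      rw [hq] at hyq ⊢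
      have hyr : (r : ℤ) + 2 ≤ y := by nlinarith
      have hlo : y * ((r : ℤ) ^ 2 - 1) ≤ (r : ℤ) * y ^ 2 - 1 - y * (r - 1) - (y ^ 2 - 1) := by
        have : 0 ≤ y * (r - 1) * (y - (r + 2)) :=
          mul_nonneg (mul_nonneg (by omega) (by omega)) (by omega)
        linear_combination this
      have hpos : 0 ≤ y * ((r : ℤ) ^ 2 - 1) := mul_nonneg (by omega) (by nlinarith)
      rcases hε with rfl | rfl
      · refine ⟨r * y ^ 2 - 1 - y * (r - 1), Or.inr (hlo.trans (le_abs_self _)), fun φ hφ => ?_⟩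
        rcases h φ hφ with h' | h' <;> rw [h']
        · right; ring
        · left; ring
      · refine ⟨r * y ^ 2 - 1 + r * y * (r - 1), Or.inr (le_trans ?_ (le_abs_self _)),
          fun φ hφ => ?_⟩
        · linear_combination hlo + hpos
        · rcases h φ hφ with h' | h' <;> rw [h']
          · left; ring
          · right; ring
  rw [Nat.card_eq_fintype_card] at *
  refine eq_of_even_quadric (T := (quadraticPolarForm Q).IsTangent)
    (q := Fintype.card F) (y := (Fintype.card F : ℤ) ^ k) (ε := ε) (b := b)
    hsw hψ hψt (ncard_isTangent_line_le hψt) hTc rfl (by exact_mod_cast hq3) ?_ hε ?_ h1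
    (fun φ hφ => ?_) hs hP'b hb
  · have := le_pow_natCard (F := F) hk1
    rwa [Nat.card_eq_fintype_card] at this
  · rw [Nat.card_eq_fintype_card] at hV
    rw [hV]
    ring
  · rw [even_quadric_kerSum_of_not_isTangent hQ' hk hφ, Nat.card_eq_fintype_card]

theorem eq_of_sub_eq_of_two {u v c : ℤ} (hc : c ≠ 0) {x y x' y' : ℤ} (hx : x = u ∨ x = v)
    (hy : y = u ∨ y = v) (hx' : x' = u ∨ x' = v) (hy' : y' = u ∨ y' = v) (h : x - y = c)
    (h' : x' - y' = c) : x = x' := by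
  rcases hx with rfl | rfl <;> rcases hy with rfl | rfl <;> rcases hx' with rfl | rfl <;>
    rcases hy' with rfl | rfl <;> omega

/-- Among three numbers with spacing g, a difference of absolute value at least 2 g arises only
between the two extremes, so its sign identifies them. -/
theorem eq_of_sub_eq_of_three {u g c : ℤ} (hg : 0 < g) (hc : 2 * g ≤ |c|) {x y x' y' : ℤ}
    (hx : ∃ ε : ℤ, (ε = 0 ∨ ε = 1 ∨ ε = -1) ∧ x = u + ε * g)
    (hy : ∃ ε : ℤ, (ε = 0 ∨ ε = 1 ∨ ε = -1) ∧ y = u + ε * g)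
    (hx' : ∃ ε : ℤ, (ε = 0 ∨ ε = 1 ∨ ε = -1) ∧ x' = u + ε * g)
    (hy' : ∃ ε : ℤ, (ε = 0 ∨ ε = 1 ∨ ε = -1) ∧ y' = u + ε * g) (h : x - y = c)
    (h' : x' - y' = c) : x = x' := by
  obtain ⟨a, ha, rfl⟩ := hx
  obtain ⟨b, hb, rfl⟩ := hy
  obtain ⟨a', ha', rfl⟩ := hx'
  obtain ⟨b', hb', rfl⟩ := hy'
  have h1 : (a - b) * g = (a' - b') * g := by linear_combination h - h'
  have h2 := mul_right_cancel₀ hg.ne' h1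
  have h3 : 2 * g ≤ |a - b| * g := by
    have : c = (a - b) * g := by linear_combination -h
    rwa [this, abs_mul, abs_of_pos hg] at hc
  have h4 := le_of_mul_le_mul_right h3 hg
  rw [le_abs] at h4
  have : a = a' := by omega
  rw [this]

theorem hermitian_rigidity {σ : F →+* F} {hσ : ∀ a, σ (σ a) = a} {hσ1 : σ ≠ RingHom.id F}
    {h : V →ₛₗ[σ] V →ₗ[F] F} {hs : h.IsSymm} (hn : h.Nondegenerate) {k : ℕ}
    (hk : Module.finrank F V = k + 2) (hk1 : 1 ≤ k)
    (hsw : ∀ v, ψ v ≠ 0 →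
      pointIndicator P' v = pointIndicator {x : ℙ F V | h x.rep x.rep = 0} v)
    (hψ : ψ ≠ 0) (hψt : ¬ (hermitianPolarForm hσ hσ1 h hs).IsTangent ψ)
    (hP' : HasPolarNumbers P') : P' = {x : ℙ F V | h x.rep x.rep = 0} := by
  have hn' := isNondegenerate_hermitianPolarForm (hσ := hσ) (hσ1 := hσ1) (hs := hs) hn
  have hr : (2 : ℤ) ≤ fixedCard σ := by exact_mod_cast two_le_fixedCard hσ hσ1
  have hq : (Nat.card F : ℤ) = (fixedCard σ : ℤ) ^ 2 := by
    exact_mod_cast card_eq_fixedCard_sq hσ hσ1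
  have hPt := fun φ hφ => hermitian_kerSum_of_isTangent hn' hk (φ := φ) hφ
  have hPn := fun φ => hermitian_kerSum_of_not_isTangent hn' hk (φ := φ)
  have hker : (Nat.card (LinearMap.ker ψ) : ℤ) =
      (fixedCard σ : ℤ) ^ 2 * ((fixedCard σ : ℤ) ^ k) ^ 2 := by
    have hf := finrank_ker_eq (n := k + 1) hψ (by omega)
    rw [Module.natCard_eq_pow_finrank (K := F) (V := LinearMap.ker ψ), hf]
    push_cast
    rw [hq]
    ring
  have hy2 : (2 : ℤ) ≤ (fixedCard σ : ℤ) ^ k := hr.trans (le_self_pow₀ (by omega) (by omega))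
  obtain ⟨s, hsd, hs1⟩ : ∃ s : ℤ, s = (-1) ^ k ∧ (s = 1 ∨ s = -1) :=
    ⟨_, rfl, neg_one_pow_eq_or ℤ k⟩
  obtain ⟨y, hy⟩ : ∃ y : ℤ, y = (fixedCard σ : ℤ) ^ k := ⟨_, rfl⟩
  obtain ⟨r, hrd⟩ : ∃ r : ℤ, r = (fixedCard σ : ℤ) := ⟨_, rfl⟩
  rw [← hsd, ← hy, ← hrd] at hPt
  rw [← hsd, ← hy, ← hrd] at hPn
  rw [← hy, ← hrd] at hker
  rw [← hy] at hy2
  rw [← hrd] at hr hq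
  have hg : 0 < y * (r ^ 2 - 1) := mul_pos (by omega) (by nlinarith)
  have hC : |(r * y ^ 2 - 1 + s * (r * y * (r - 1))) - (r * y ^ 2 - 1 - s * (y * (r - 1)))| =
      y * (r ^ 2 - 1) := by
    rcases hs1 with h1 | h1 <;> rw [h1]
    · rw [← abs_of_pos hg]
      congr 1
      ring
    · rw [← abs_of_pos hg, ← abs_neg]
      congr 1
      ring
  have hC0 : (r * y ^ 2 - 1 + s * (r * y * (r - 1))) - (r * y ^ 2 - 1 - s * (y * (r - 1))) ≠ 0 := by
    rw [← abs_pos, hC]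
    exact hg
  have hZ : ∃ Z : Set ℤ, (∀ x ∈ Z, ∀ w ∈ Z, ∀ x' ∈ Z, ∀ w' ∈ Z,
      x - w = (r * y ^ 2 - 1 + s * (r * y * (r - 1))) - (r * y ^ 2 - 1 - s * (y * (r - 1))) →
      x' - w' = (r * y ^ 2 - 1 + s * (r * y * (r - 1))) - (r * y ^ 2 - 1 - s * (y * (r - 1))) →
      x = x') ∧ ∀ φ : Module.Dual F V, φ ≠ 0 → kerSum (pointIndicator P') φ ∈ Z := by
    rcases hP' with ⟨k', ε', hk', hε', h'⟩ | ⟨k', hk', h'⟩ | ⟨r', k', hr', hqr', hk', h'⟩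
    · exact ⟨{z | z = _ ∨ z = _}, fun x hx w hw x' hx' w' hw' => eq_of_sub_eq_of_two hC0 hx hw hx' hw',
        h'⟩
    -- The tangent and non-tangent Hermitian sizes differ by r times the spacing q ^ k' (q - 1) of
    -- the parabolic sizes, and r ≥ 2.
    · have hyk : y = r * (Nat.card F : ℤ) ^ k' := by
        obtain rfl : k = 2 * k' + 1 := by omega
        rw [hy, hq, hrd, pow_succ', pow_mul]
      have hk0 : 0 < (Nat.card F : ℤ) ^ k' * (Nat.card F - 1) := by
        rw [hq]
        refine mul_pos (pow_pos (by positivity) _) (by nlinarith)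
      refine ⟨{z | ∃ ε : ℤ, (ε = 0 ∨ ε = 1 ∨ ε = -1) ∧
        z = Nat.card F * (Nat.card F ^ k') ^ 2 - 1 + ε * (Nat.card F ^ k' * (Nat.card F - 1))},
        fun x hx w hw x' hx' w' hw' => eq_of_sub_eq_of_three hk0 ?_ hx hw hx' hw', fun φ hφ => ?_⟩
      · rw [hC, hyk, ← hq, mul_assoc]
        exact mul_le_mul_of_nonneg_right hr hk0.le
      · obtain ⟨ε, hε, e⟩ := h' φ hφ
        exact ⟨ε, hε, by rw [e]; ring⟩
    · exact ⟨{z | z = _ ∨ z = _}, fun x hx w hw x' hx' w' hw' => eq_of_sub_eq_of_two hC0 hx hw hx' hw',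
        h'⟩
  obtain ⟨Z, hZ, hPZ⟩ := hZ
  refine eq_of_forall_pencil hsw hψ (fun φ _ => hermitian_pencil hn hψt φ) hPt
    (fun φ _ => hPn φ) hZ hPZ ?_ ?_
  · rw [hPn ψ hψt]
    intro h0
    -- An empty section would make y divide 1.
    have hdvd : y ∣ 1 := ⟨r * y - s * (r - 1), by linear_combination -h0⟩
    have := Int.le_of_dvd one_pos hdvd
    omega
  · rw [hPn ψ hψt, hker]
    intro h0
    have h1 : y * (r * y - s * (r - 1) - r ^ 2 * y) = 0 := by linear_combination h0
    have h2 := (mul_eq_zero.1 h1).resolve_left (by omega)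
    have h3 : 0 < (r - 1) * (r * y - 1) := mul_pos (by omega) (by nlinarith)
    rcases hs1 with rfl | rfl
    · nlinarith
    · nlinarith

end Cases

/-! ### Rigidity of parabolic quadrics. -/

section Parabolic

variable {F : Type u} {V : Type v} [Field F] [Fintype F] [AddCommGroup V] [Module F V] [Fintype V]
  [Fintype (Module.Dual F V)] {P' : Set (ℙ F V)} {ψ : Module.Dual F V} {Q : QuadraticForm F V}

/-- A section of a quadric, counted inside the section. -/
theorem kerSum_quadricPoints_comp_subtype (Q : QuadraticForm F V) (K : Submodule F V) [Fintype K]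
    (φ : Module.Dual F V) :
    kerSum (pointIndicator (quadricPoints Q ∩ pts K)) φ =
      kerSum (pointIndicator (quadricPoints (Q.comp K.subtype))) (φ.comp K.subtype) := by
  rw [kerSum_pointIndicator_eq_ncard, kerSum_pointIndicator_eq_ncard,
    ← Set.ncard_image_of_injective _ K.injective_subtype]
  congr 2
  ext v
  constructor
  · rintro ⟨h0, hv, hP, hK⟩
    refine ⟨⟨v, (mem_pts_mk_iff hv).1 hK⟩, ⟨h0, (mem_vectors_quadricPoints _ _).2 ⟨?_, ?_⟩⟩, rfl⟩
    · exact fun h => hv (congrArg Subtype.val h)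
    · exact ((mem_vectors_quadricPoints Q v).1 ⟨hv, hP⟩).2
  · rintro ⟨w, ⟨h0, hw⟩, rfl⟩
    obtain ⟨hw0, hws⟩ := (mem_vectors_quadricPoints _ _).1 hw
    obtain ⟨hv, hP⟩ := (mem_vectors_quadricPoints Q (w : V)).2
      ⟨fun h => hw0 (Subtype.ext h), hws⟩
    exact ⟨h0, hv, hP, (mem_pts_mk_iff hv).2 w.2⟩

/-- The non-tangent hyperplane sections of a parabolic quadric are elliptic or hyperbolic
quadrics. -/
theorem odd_quadric_section (hQ : (quadraticPolarForm Q).IsNondegenerate) {k : ℕ}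
    (hk : Module.finrank F V = 2 * (k + 1) + 1) (hψ : ψ ≠ 0)
    (hψt : ¬ (quadraticPolarForm Q).IsTangent ψ) : ∃ η : ℤ, (η = 1 ∨ η = -1) ∧
      kerSum (pointIndicator (quadricPoints Q)) ψ =
        Nat.card F * (Nat.card F ^ k) ^ 2 - 1 + η * Nat.card F ^ k * (Nat.card F - 1) ∧
      ∀ φ, φ ∉ F ∙ ψ →
        kerSum (pointIndicator (quadricPoints Q ∩ pts (LinearMap.ker ψ))) φ =
          (Nat.card F ^ k) ^ 2 - 1 ∨
        kerSum (pointIndicator (quadricPoints Q ∩ pts (LinearMap.ker ψ))) φ =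
          (Nat.card F ^ k) ^ 2 - 1 + η * Nat.card F ^ k * (Nat.card F - 1) := by
  classical
  have : Fintype (LinearMap.ker ψ) := Fintype.ofFinite _
  have hK : (quadraticPolarForm (Q.comp (LinearMap.ker ψ).subtype)).IsNondegenerate :=
    PolarForm.restrict_ker_isNondegenerate _ hQ hψt
  have hf := finrank_ker_eq hψ hk
  obtain ⟨η, hη, h1, h2⟩ := even_quadric_sizes hK hf
  refine ⟨η, hη, ?_, fun φ hφ => ?_⟩
  · rw [← h2, ← sum_pointIndicator_inter_pts_ker, ← kerSum_zero_right (F := F),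
      ← kerSum_zero_right (F := F), kerSum_quadricPoints_comp_subtype]
    rfl
  · rw [kerSum_quadricPoints_comp_subtype]
    by_cases hφt : (quadraticPolarForm (Q.comp (LinearMap.ker ψ).subtype)).IsTangent
        (φ.comp (LinearMap.ker ψ).subtype)
    · refine Or.inr (h1 _ (fun h0 => hφ ?_) hφt)
      obtain ⟨c, rfl⟩ := exists_eq_smul_of_ker_le (φ := φ) (ψ := ψ) fun v hv =>
        congrArg (fun f : Module.Dual F (LinearMap.ker ψ) => f ⟨v, hv⟩) h0
      exact Submodule.smul_mem _ c (Submodule.mem_span_singleton_self ψ)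
    · exact Or.inl (even_quadric_kerSum_of_not_isTangent hK hf hφt)

theorem parabolic_rigidity (hQ : Q.Nondegenerate) {k : ℕ}
    (hk : Module.finrank F V = 2 * (k + 1) + 1) (hk1 : 1 ≤ k) (hq4 : 4 ≤ Nat.card F)
    (hsw : ∀ v, ψ v ≠ 0 → pointIndicator P' v = pointIndicator (quadricPoints Q) v)
    (hψ : ψ ≠ 0) (hψt : ¬ (quadraticPolarForm Q).IsTangent ψ) (hP' : HasPolarNumbers P') :
    P' = quadricPoints Q := by
  classical
  have hQ' := isNondegenerate_quadraticPolarForm hQ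
  obtain ⟨η, hη, hψη, hK⟩ := odd_quadric_section hQ' hk hψ hψt
  have hPt := fun φ hφ => odd_quadric_kerSum_of_isTangent hQ' hk (φ := φ) hφ
  have hPn := fun φ => odd_quadric_kerSum_of_not_isTangent hQ' hk (φ := φ)
  have hs := odd_quadric_sum hQ' hk
  have hV : (Fintype.card V : ℤ) = (Nat.card F : ℤ) ^ 3 * (Nat.card F ^ k) ^ 2 := by
    rw [← Nat.card_eq_fintype_card, natCard_eq_pow_int (F := F) hk]
    ring
  have hqF : (Fintype.card F : ℤ) = Nat.card F := by rw [Nat.card_eq_fintype_card]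
  have hy := le_pow_natCard (F := F) hk1
  have hT := ncard_isTangent_line_le hψt
  have hy4 : (4 : ℤ) ≤ Nat.card F := by exact_mod_cast hq4
  rcases hP' with ⟨k', ε, hk', -⟩ | ⟨k', hk', h'⟩ | ⟨r, k', hr, hqr, hk', h'⟩
  · omega
  · obtain rfl : k' = k := by omega
    exact eq_of_parabolic_quadric hsw hψ hψη hT hqF hy4 (by omega) hη hV hPt hPn hs hK h'
  · exfalso
    obtain rfl : k' = 2 * k + 1 := by omega
    have hyr : (r : ℤ) ^ (2 * k + 1) = r * (Nat.card F : ℤ) ^ k := by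
      rw [hqr, pow_succ', pow_mul]
      push_cast
      rfl
    rw [hyr, Odd.neg_one_pow ⟨k, rfl⟩] at h'
    have hqr' : (Nat.card F : ℤ) = (r : ℤ) ^ 2 := by exact_mod_cast hqr
    have hr' : (2 : ℤ) ≤ r := by exact_mod_cast hr
    generalize (Nat.card F : ℤ) ^ k = y at *
    generalize (Nat.card F : ℤ) = q at *
    have hη2 : η * η = 1 := by rcases hη with rfl | rfl <;> rfl
    have hg : 0 < y * (q - 1) := mul_pos (by omega) (by omega)
    -- Otherwise P ∩ ker ψ would have constant sections outside the span of ψ, contradicting its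
    -- first moment.
    obtain ⟨φ, hφ, hφK⟩ : ∃ φ, φ ∉ F ∙ ψ ∧
        kerSum (pointIndicator (quadricPoints Q ∩ pts (LinearMap.ker ψ))) φ =
          y ^ 2 - 1 + η * y * (q - 1) := by
      by_contra! hno
      have hall : ∀ φ, φ ∉ F ∙ ψ →
          kerSum (pointIndicator (quadricPoints Q ∩ pts (LinearMap.ker ψ))) φ = y ^ 2 - 1 :=
        fun φ hφ => (hK φ hφ).resolve_right (hno φ hφ)
      have m1 := (two_value_moments (c := 0)
        (isPointFunction_pointIndicator (quadricPoints Q ∩ pts (LinearMap.ker ψ))) hψ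
        (fun v hv => pointIndicator_inter_pts_ker_of_ne _ hv) (fun φ hφ => Or.inl (hall φ hφ))
        rfl).1
      rw [sum_pointIndicator_inter_pts_ker, hψη, hqF, hV] at m1
      have h0 : q ^ 2 * (y * (q - 1)) * ((y + η) * (1 - q * y * η)) = 0 := by
        linear_combination m1 - q ^ 3 * y ^ 2 * (q - 1) * hη2
      rcases hη with rfl | rfl
      · have h1 : 0 < (y + 1) * (q * y - 1) := mul_pos (by omega) (by nlinarith)
        have h2 : 0 < q ^ 2 * (y * (q - 1)) := by positivity
        nlinarith [mul_pos h2 h1]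
      · have h1 : 0 < (y - 1) * (q * y + 1) := mul_pos (by omega) (by nlinarith)
        have h2 : 0 < q ^ 2 * (y * (q - 1)) := by positivity
        nlinarith [mul_pos h2 h1]
    obtain ⟨e, hek, h1, -⟩ := exists_signs hψη hT hqF hy4 (by omega) hη hPt hPn hs hφ
    obtain ⟨⟨t, ht⟩, t', ht'⟩ := h1 hφK
    have hc := (change_add_smul hsw φ t).trans (change_add_smul hsw φ t').symm
    rw [change, change, hek, hek, ht, ht'] at hc
    -- Entries 0 and 1 in one pencil force sizes of P' differing by η y (q - 1), whereas Hermitian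
    -- sizes differ by 0 or ± r y (q - 1).
    have hd : kerSum (pointIndicator P') (φ + t' • ψ) - kerSum (pointIndicator P') (φ + t • ψ) =
        η * (y * (q - 1)) := by linear_combination -hc
    have h2 : y * (q - 1) < r * (y * (q - 1)) := by nlinarith
    have h3 : η * (y * (q - 1)) = 0 ∨ η * (y * (q - 1)) = r * (y * (q - 1)) ∨
        η * (y * (q - 1)) = -(r * (y * (q - 1))) := by
      rw [← hd, hqr']
      rcases h' _ (add_smul_ne_zero_of_notMem_span hφ t) with e1 | e1 <;>
      rcases h' _ (add_smul_ne_zero_of_notMem_span hφ t') with e2 | e2 <;> rw [e1, e2]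
      · left; ring
      · right; left; ring
      · right; right; ring
      · left; ring
    generalize y * (q - 1) = g at *
    rcases hη with rfl | rfl <;> rcases h3 with h3 | h3 | h3 <;> linarith

end Parabolic

theorem three_le_natCard {F V : Type*} [Field F] [Finite F] [AddCommGroup V] [Module F V]
    {t : PolarType} {Q : QuadraticForm F V} (ht : HasQuadricType F V t Q)
    (hell : t = .elliptic → Nat.card F ≠ 2) (hhyp : t = .hyperbolic → Nat.card F ≠ 2)
    (hpar : t ≠ .parabolic) : 3 ≤ Nat.card F := by
  have h2 : 1 < Nat.card F := Finite.one_lt_card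
  cases t with
  | elliptic => have := hell rfl; omega
  | hyperbolic => have := hhyp rfl; omega
  | parabolic => exact absurd rfl hpar
  | hermitian => exact ht.elim

end QuasiPolar

/-! ### The theorem. -/

theorem mainTheorem3 {F V : Type*} [Field F] [Finite F] [AddCommGroup V] [Module F V]
    (m : ℕ) (hm : 3 ≤ m) (hV : Module.finrank F V = m + 1)
    (t : QuasiPolar.PolarType)
    (hell : t = .elliptic → Nat.card F ≠ 2)
    (hhyp : t = .hyperbolic → Nat.card F ≠ 2)
    (hpar : t = .parabolic → 4 ≤ Nat.card F)
    (P P' : Set (ℙ F V)) (hP : QuasiPolar.IsPolarSpace t P)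
    (π : Submodule F V) (hπ : QuasiPolar.IsHyperplane π)
    (hswitch : QuasiPolar.IsSwitching P P' π)
    (t' : QuasiPolar.PolarType) (hP' : QuasiPolar.IsQuasiPolarSpace t' P')
    (hne : P' ≠ P) :
    QuasiPolar.IsSingularHyperplane t P π := by
  have : FiniteDimensional F V := Module.finite_of_finrank_pos (by omega)
  have : Finite V := Module.finite_of_finite F
  have : Fintype F := Fintype.ofFinite F
  have : Fintype V := Fintype.ofFinite V
  have : Finite (Module.Dual F V) := Module.finite_of_finite F
  have : Fintype (Module.Dual F V) := Fintype.ofFinite _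
  obtain ⟨ψ, hψ, rfl⟩ := QuasiPolar.isHyperplane_iff_exists_ker.1 hπ
  have hsw := fun v => hswitch.pointIndicator_eq (v := v)
  have hN := hP'.hasPolarNumbers (by omega)
  rcases hP.exists_quadric_or_hermitian with ⟨Q, hQ, ht, rfl⟩ | ⟨rfl, σ, h, hσ, hσ1, hs, hn, rfl⟩
  · by_cases hψt : (QuasiPolar.quadraticPolarForm Q).IsTangent ψ
    · exact QuasiPolar.isSingularHyperplane_quadric hQ ht hψ hψt
    · refine absurd ?_ hne
      -- In both parities m ≥ 3 gives k ≥ 1, so that y = q ^ k is at least q.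
      rcases QuasiPolar.even_or_odd_of_hasQuadricType ht (by omega) with ⟨htp, k, hk⟩ | ⟨htp, k, hk⟩
      · exact QuasiPolar.even_quadric_rigidity hQ hk (by omega)
          (QuasiPolar.three_le_natCard ht hell hhyp htp) hsw hψ hψt hN
      · exact QuasiPolar.parabolic_rigidity hQ hk (by omega) (hpar htp) hsw hψ hψt hN
  · by_cases hψt : (QuasiPolar.hermitianPolarForm hσ hσ1 h hs).IsTangent ψ
    · exact QuasiPolar.isSingularHyperplane_hermitian hn hψ hψt
    · exact absurd (QuasiPolar.hermitian_rigidity hn (k := m - 1) (by omega) (by omega) hsw hψ hψt hN)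
        hne
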